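/- Consider the symmetric cubic near-Hamiltonian system $$\dot x=H_y+\varepsilon p(x,y),\qquad \dot y=-H_x+\varepsilon q(x,y),\tag{1}$$ with $$H(x,y)=\left(\tfrac12-h_{22}\right)x^2-\tfrac14y^2+h_{40}x^4+h_{31}x^3y+h_{22}x^2y^2+\tfrac18y^4,$$ $$p=\sum_{i+j=1,3}a_{ij}x^iy^j,\quad q=\sum_{i+j=1,3}b_{ij}x^iy^j,\quad p_x+q_y=c_{00}+c_{20}x^2+c_{11}xy+c_{02}y^2.$$ (This $H$ is the even quartic Hamiltonian $\sum_{i+j=2,4}h_{ij}x^iy^j$ with critical points $(0,\pm1)$ and $h_{11}=0$, for which $(0,\pm1)$ are elementary centers, i.e. $h_{02}(h_{20}+h_{22})<0$, normalised by $h_{20}+h_{22}=\frac12$, $h_{02}=-\frac14$.) In the coordinates $u=-(y-1)$, $v=x$, system (1) becomes $$\dot u=\frac{\partial H_1}{\partial v}+\varepsilon\hat p,\qquad \dot v=-\frac{\partial H_1}{\partial u}+\varepsilon\hat q,\tag{2}$$ where $\hat p(u,v)=-q(v,1-u)$, $\hat q(u,v)=p(v,1-u)$ and $$H_1(u,v)=\tfrac12(u^2+v^2)-\tfrac12u^3-2h_{22}uv^2+h_{31}v^3+\tfrac18u^4+h_{22}u^2v^2-h_{31}uv^3+h_{40}v^4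 .$$ Put $\delta=(c_{00},c_{02},c_{11},c_{20})$ and $\sigma=(h_{31},h_{22},h_{40})$, and let $\delta_0=(c_{00}^*,c_{02}^*,c_{11}^*,c_{20}^*)$ and $\sigma_0=(h_{31}^*,h_{22}^*,h_{40}^*)$ be real vectors satisfying, for one of the two choices of the sign $\pm$, $$c_{00}^*=-c_{02}^*,\qquad c_{20}^*=3h_{31}^*c_{11}^*+(2+4h_{22}^*)c_{02}^*,\qquad c_{11}^*\neq0,$$ $$c_{02}^*=\frac{h_{31}^*\left[20(h_{22}^*)^2-8h_{22}^*-10h_{40}^*-1\right]}{-2+20(h_{31}^*)^2+8(h_{22}^*)^2-4h_{40}^*}\,c_{11}^*,$$ $$h_{31}^*\neq0,\qquad h_{22}^*=\frac12-\frac{105\pm56\sqrt3}{4}(h_{31}^*)^2,\qquad h_{40}^*=\frac1{14}\left[28(h_{22}^*)^2-21(h_{31}^*)^2-12h_{22}^*-1\right].$$ Then for some $(\varepsilon,\delta,\sigma)$ near $(0,\delta_0,\sigma_0)$ with $\varepsilon>0$, system (2) has (at least) $5$ limit cycles near the origin; equivalently, system (1) has $5$ limit cycles near $(0,1)$. By symmetry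 it also has $5$ limit cycles near $(0,-1)$, hence at least $10$ limit cycles near $(0,\pm1)$ in total. More precisely: for every $\eta>0$ there are $\delta,\sigma$ whose entries differ from those of $\delta_0,\sigma_0$ by less than $\eta$ such that, for every $p,q$ of the above form with divergence coefficients $\delta$, there is $\varepsilon\in(0,\eta)$ for which all these limit cycles exist at distance less than $\eta$ (in the maximum norm on the plane) from the respective centers. Here a limit cycle is a nonconstant periodic orbit that has a neighbourhood containing no other periodic orbit. -/

import Mathlib

/-- A periodic orbit of the planar autonomous system `z' = X z`: the trace of a nonconstant
periodic solution. -/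
def IsPeriodicOrbit (X : ℝ × ℝ → ℝ × ℝ) (C : Set (ℝ × ℝ)) : Prop :=
  ∃ (γ : ℝ → ℝ × ℝ) (T : ℝ), 0 < T ∧ (∀ t, HasDerivAt γ (X (γ t)) t) ∧
    (∀ t, γ (t + T) = γ t) ∧ (∃ t, γ t ≠ γ 0) ∧ C = Set.range γ

/-- A limit cycle: a periodic orbit that is isolated, i.e. has a neighbourhood containing no
other periodic orbit. -/
def IsLimitCycle (X : ℝ × ℝ → ℝ × ℝ) (C : Set (ℝ × ℝ)) : Prop :=
  IsPeriodicOrbit X C ∧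
    ∃ U : Set (ℝ × ℝ), IsOpen U ∧ C ⊆ U ∧ ∀ C', IsPeriodicOrbit X C' → C' ⊆ U → C' = C

/-- The limit cycles of `X` contained in the ball of radius `r` about `z₀`. -/
def limitCyclesNear (X : ℝ × ℝ → ℝ × ℝ) (z₀ : ℝ × ℝ) (r : ℝ) : Set (Set (ℝ × ℝ)) :=
  {C | IsLimitCycle X C ∧ C ⊆ Metric.ball z₀ r}

/-- The near-Hamiltonian vector field `(H_y + ε p, -H_x + ε q)`. -/
noncomputable def nearHamiltonianField (H p q : ℝ → ℝ → ℝ) (ε : ℝ) (z : ℝ × ℝ) : ℝ × ℝ :=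
  (deriv (fun y => H z.1 y) z.2 + ε * p z.1 z.2, -deriv (fun x => H x z.2) z.1 + ε * q z.1 z.2)

/-- The general Hamiltonian `∑_{i+j=2,4} h_{ij} x^i y^j`. -/
def symHamiltonian (h20 h11 h02 h40 h31 h22 h13 h04 x y : ℝ) : ℝ :=
  h20 * x ^ 2 + h11 * (x * y) + h02 * y ^ 2 +
    h40 * x ^ 4 + h31 * (x ^ 3 * y) + h22 * (x ^ 2 * y ^ 2) + h13 * (x * y ^ 3) + h04 * y ^ 4

/-- The Hamiltonian with `h₁₁ = 0` and an elementary center at `(0, 1)`, normalised by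
`h₂₀ + h₂₂ = 1/2` and `-8 h₀₂ (h₂₀ + h₂₂) = 1`; the critical points at `(0, ±1)` force
`h₁₃ = -h₁₁` and `h₀₄ = -h₀₂ / 2`. -/
noncomputable def centerHamiltonian (h31 h22 h40 : ℝ) : ℝ → ℝ → ℝ :=
  symHamiltonian (1 / 2 - h22) 0 (-1 / 4) h40 h31 h22 0 (1 / 8)

/-- The normal form of the Hamiltonian in the coordinates `u = -(y - 1)`, `v = x`. -/
noncomputable def normalHamiltonian (h31 h22 h40 u v : ℝ) : ℝ :=
  1 / 2 * (u ^ 2 + v ^ 2) - 1 / 2 * u ^ 3 - 2 * h22 * u * v ^ 2 + h31 * v ^ 3 +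
    1 / 8 * u ^ 4 + h22 * u ^ 2 * v ^ 2 - h31 * u * v ^ 3 + h40 * v ^ 4

/-- `p` is a real polynomial of the form `∑_{i+j=1,3} a_{ij} x^i y^j`. -/
def IsOddCubic (p : ℝ → ℝ → ℝ) : Prop :=
  ∃ a10 a01 a30 a21 a12 a03 : ℝ, ∀ x y, p x y =
    a10 * x + a01 * y + a30 * x ^ 3 + a21 * (x ^ 2 * y) + a12 * (x * y ^ 2) + a03 * y ^ 3

/-- `p_x + q_y = c₀₀ + c₂₀ x² + c₁₁ x y + c₀₂ y²`. -/
def HasDivergence (p q : ℝ → ℝ → ℝ) (c00 c02 c11 c20 : ℝ) : Prop :=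
  ∀ x y : ℝ, deriv (fun x' => p x' y) x + deriv (fun y' => q x y') y =
    c00 + c20 * x ^ 2 + c11 * (x * y) + c02 * y ^ 2

/-- The symmetric near-Hamiltonian system in the original coordinates `(x, y)`. -/
noncomputable def symField (h31 h22 h40 : ℝ) (p q : ℝ → ℝ → ℝ) (ε : ℝ) : ℝ × ℝ → ℝ × ℝ :=
  nearHamiltonianField (centerHamiltonian h31 h22 h40) p q ε

/-- Its normal form near `(0, 1)`, in the coordinates `u = -(y - 1)`, `v = x`; the perturbation
terms become `u' = -y' ↦ -q(v, 1 - u)` and `v' = x' ↦ p(v, 1 - u)`. -/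
noncomputable def normalField (h31 h22 h40 : ℝ) (p q : ℝ → ℝ → ℝ) (ε : ℝ) : ℝ × ℝ → ℝ × ℝ :=
  nearHamiltonianField (normalHamiltonian h31 h22 h40)
    (fun u v => -q v (1 - u)) (fun u v => p v (1 - u)) ε

/-!
In the coordinates `t = x / y`, `W = y²` the Hamiltonian is quadratic in `W`, and completing the
square turns its level curves around the center into the circles `S² + V² = ρ²`, where `S` is a
function of `t` alone. In polar coordinates the system becomes a scalar periodic equation
`dρ/dφ = O(ε)`, and by averaging every simple zero of `M(ρ) = ∫ cos² φ · K(ρ sin φ) dφ` yields a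
limit cycle for small `ε > 0`; here `K` depends on the coefficients only through the divergence.

Only the even part of `K` contributes, so the sign of `M` near `ρ = 0` is that of its first
nonvanishing Taylor coefficient. At the given coefficients the first five even Taylor coefficients
vanish while the sixth does not. Perturbing in turn `h₂₂` (with `h₄₀` bound to it), `h₄₀`, `c₀₂`,
`c₂₀` and `c₀₀`, each time by much less than before, makes these coefficients nonzero from the
fifth down to the first with signs chosen so that each step adds one sign change of `M` closer to
`0`. By Sard's theorem a further generic change of `c₀₀` makes all zeros of `M` simple.
-/

open Set Filter Topology MeasureTheory

/-! ### Periodic solutions of scalar equations -/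

lemma exists_forall_dist_lt_of_periodic {X E : Type*} [PseudoMetricSpace X] [PseudoMetricSpace E]
    {f : ℝ → X → E} {P : ℝ} {K : Set X} (hP : 0 < P) (hper : Function.Periodic f P)
    (hK : IsCompact K) (hf : ContinuousOn (Function.uncurry f) (univ ×ˢ K)) {η : ℝ} (hη : 0 < η) :
    ∃ δ > 0, ∀ φ, ∀ x ∈ K, ∀ y ∈ K, dist x y < δ → dist (f φ x) (f φ y) < η := by
  have huc := (isCompact_Icc.prod hK).uniformContinuousOn_of_continuous
    (hf.mono (prod_mono (subset_univ (Icc 0 P)) Subset.rfl))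
  obtain ⟨δ, hδ, h⟩ := Metric.uniformContinuousOn_iff.1 huc η hη
  refine ⟨δ, hδ, fun φ x hx y hy hxy => ?_⟩
  obtain ⟨φ', hφ', hφ⟩ := hper.exists_mem_Ico₀ hP φ
  rw [hφ]
  exact h (φ', x) ⟨Ico_subset_Icc_self hφ', hx⟩ (φ', y) ⟨Ico_subset_Icc_self hφ', hy⟩
    (by simpa [Prod.dist_eq, hδ] using hxy)

lemma exists_forall_norm_le_of_periodic {X E : Type*} [TopologicalSpace X]
    [SeminormedAddCommGroup E] {f : ℝ → X → E} {P : ℝ} {K : Set X} (hP : 0 < P)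
    (hper : Function.Periodic f P) (hK : IsCompact K)
    (hf : ContinuousOn (Function.uncurry f) (univ ×ˢ K)) :
    ∃ B, ∀ φ, ∀ x ∈ K, ‖f φ x‖ ≤ B := by
  obtain ⟨B, hB⟩ := (isCompact_Icc.prod hK).exists_bound_of_continuousOn
    (hf.mono (prod_mono (subset_univ (Icc 0 P)) Subset.rfl))
  refine ⟨B, fun φ x hx => ?_⟩
  obtain ⟨φ', hφ', hφ⟩ := hper.exists_mem_Ico₀ hP φ
  rw [hφ]
  exact hB (φ', x) ⟨Ico_subset_Icc_self hφ', hx⟩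

lemma exists_periodic_extension {E : Type*} [NormedAddCommGroup E] [NormedSpace ℝ E]
    {v : ℝ → E → E} {P : ℝ} (hP : 0 < P) (hper : Function.Periodic v P) {α : ℝ → E}
    (hα : ∀ t ∈ Icc 0 P, HasDerivWithinAt α (v t (α t)) (Icc 0 P) t) (hclose : α P = α 0) :
    ∃ β : ℝ → E, Function.Periodic β P ∧ EqOn β α (Icc 0 P) ∧
      ∀ t, HasDerivAt β (v t (β t)) t := by
  set β : ℝ → E := fun t => α (toIcoMod hP 0 t) with hβ
  have hβper : Function.Periodic β P := fun t => by simp [hβ]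
  have hβα : EqOn β α (Icc 0 P) := fun t ht => by
    rcases ht.2.eq_or_lt with h | h
    · have hβ0 : β 0 = α 0 := by simp [hβ]
      rw [h, hclose, ← hβ0]
      simpa using hβper 0
    · simp [hβ, (toIcoMod_eq_self hP).2 (show t ∈ Ico 0 (0 + P) by simpa using ⟨ht.1, h⟩)]
  have hshift : ∀ (k : ℤ) {t : ℝ} {s : Set ℝ}, HasDerivWithinAt β (v t (β t)) s t →
      HasDerivWithinAt β (v (t + k • P) (β (t + k • P))) ((· - k • P) ⁻¹' s) (t + k • P) := by
    intro k t s h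
    rw [hper.zsmul k t, hβper.zsmul k t]
    have hsub : HasDerivWithinAt (fun u => u - k • P) 1 ((· - k • P) ⁻¹' s) (t + k • P) :=
      ((hasDerivAt_id (t + k • P)).sub_const (k • P)).hasDerivWithinAt
    rw [← add_sub_cancel_right t (k • P)] at h
    have hcomp := HasDerivWithinAt.scomp (t + k • P) h hsub fun u hu => hu
    simpa [-zsmul_eq_mul, Function.comp_def, hβper.sub_zsmul_eq k] using hcomp
  have hIcc : ∀ t ∈ Icc 0 P, HasDerivWithinAt β (v t (β t)) (Icc 0 P) t := fun t ht => by
    rw [hβα ht]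
    exact (hα t ht).congr hβα (hβα ht)
  have hIco : ∀ t ∈ Ico 0 P, HasDerivAt β (v t (β t)) t := fun t ht => by
    rcases ht.1.eq_or_lt with rfl | h
    · have hleft := hshift (-1) (hIcc P ⟨hP.le, le_rfl⟩)
      have hright := hIcc 0 ⟨le_rfl, hP.le⟩
      simp only [neg_smul, one_smul, sub_neg_eq_add, add_neg_cancel] at hleft
      refine (hleft.union hright).hasDerivAt
        (mem_of_superset (Icc_mem_nhds (neg_neg_of_pos hP) hP) fun u hu => ?_)
      rcases le_total u 0 with h | h
      · exact Or.inl ⟨by linarith [hu.1], by linarith⟩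
      · exact Or.inr ⟨h, hu.2⟩
    · exact (hIcc t ⟨ht.1, ht.2.le⟩).hasDerivAt (Icc_mem_nhds h ht.2)
  refine ⟨β, hβper, hβα, fun t => ?_⟩
  have hmem : toIcoMod hP 0 t ∈ Ico 0 P := by simpa using toIcoMod_mem_Ico hP 0 t
  have := hshift (toIcoDiv hP 0 t) (hIco _ hmem).hasDerivWithinAt (s := univ)
  simpa [toIcoMod_add_toIcoDiv_zsmul hP 0 t] using this

lemma abs_displacement_sub_integral_le {α v A : ℝ → ℝ} {P κ : ℝ} (hP : 0 ≤ P)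
    (hα : ∀ t ∈ Icc 0 P, HasDerivWithinAt α (v t) (Icc 0 P) t) (hA : Continuous A)
    (hvA : ∀ t ∈ Icc 0 P, |v t - A t| ≤ κ) :
    |α P - α 0 - ∫ t in (0 : ℝ)..P, A t| ≤ κ * P := by
  have hderiv : ∀ t ∈ Icc 0 P, HasDerivWithinAt (fun t => α t - ∫ s in (0 : ℝ)..t, A s)
      (v t - A t) (Icc 0 P) t := fun t ht =>
    (hα t ht).sub (hA.integral_hasStrictDerivAt 0 t).hasDerivAt.hasDerivWithinAt
  have := norm_image_sub_le_of_norm_deriv_le_segment' hderiv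
    (fun t ht => hvA t (Ico_subset_Icc_self ht)) P ⟨hP, le_rfl⟩
  simpa [sub_right_comm] using this

lemma abs_integral_le_of_logDeriv_close {z m A : ℝ → ℝ} {Q κ : ℝ} (hQ : 0 ≤ Q)
    (hz : ∀ t, z t ≠ 0) (hd : ∀ t, HasDerivAt z (m t * z t) t) (hA : Continuous A)
    (hmA : ∀ t, |m t - A t| ≤ κ) (hclose : z Q = z 0) : |∫ t in (0 : ℝ)..Q, A t| ≤ κ * Q := by
  have hlog : ∀ t, HasDerivAt (fun t => Real.log (z t)) (m t) t := fun t =>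
    ((hd t).log (hz t)).congr_deriv (mul_div_cancel_right₀ _ (hz t))
  simpa [hclose] using abs_displacement_sub_integral_le hQ
    (fun t _ => (hlog t).hasDerivWithinAt) hA fun t _ => hmA t

lemma exists_sub_eq_deriv_mul_sub {f f' : ℝ → ℝ} {s : Set ℝ} (hs : s.OrdConnected)
    (hf : ∀ x ∈ s, HasDerivAt f (f' x) x) {x y : ℝ} (hx : x ∈ s) (hy : y ∈ s) (hxy : x ≠ y) :
    ∃ c ∈ s, f x - f y = f' c * (x - y) := by
  wlog h : y < x generalizing x y
  · obtain ⟨c, hc, he⟩ := this hy hx hxy.symm (lt_of_le_of_ne (not_lt.1 h) hxy)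
    exact ⟨c, hc, by linear_combination -he⟩
  have hsub := hs.out hy hx
  obtain ⟨c, hc, he⟩ := exists_hasDerivAt_eq_slope f f' h
    (fun z hz => (hf z (hsub hz)).continuousAt.continuousWithinAt)
    fun z hz => hf z (hsub (Ioo_subset_Icc_self hz))
  exact ⟨c, hsub (Ioo_subset_Icc_self hc), by rw [he, div_mul_cancel₀ _ (sub_ne_zero.2 h.ne')]⟩

/-- A `Q`-periodic solution `α` of the scalar equation `x' = v φ x` with values in `s`. -/
structure IsPeriodicSolution (v : ℝ → ℝ → ℝ) (Q : ℝ) (s : Set ℝ) (α : ℝ → ℝ) : Prop where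
  periodic : Function.Periodic α Q
  mem : ∀ φ, α φ ∈ s
  hasDerivAt : ∀ φ, HasDerivAt α (v φ (α φ)) φ

namespace IsPeriodicSolution

variable {v : ℝ → ℝ → ℝ} {Q : ℝ} {s : Set ℝ} {α : ℝ → ℝ}

lemma continuous (hα : IsPeriodicSolution v Q s α) : Continuous α :=
  continuous_iff_continuousAt.2 fun φ => (hα.hasDerivAt φ).continuousAt

lemma natCast_mul (hα : IsPeriodicSolution v Q s α) (k : ℕ) :
    IsPeriodicSolution v (k * Q) s α :=
  ⟨by simpa using hα.periodic.nsmul k, hα.mem, hα.hasDerivAt⟩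

end IsPeriodicSolution

/- The difference of two distinct solutions never vanishes, and its logarithmic derivative stays
close to `A`; as `A` has nonzero mean, the difference cannot be periodic. -/
lemma IsPeriodicSolution.unique {v v' : ℝ → ℝ → ℝ} {A : ℝ → ℝ} {P κ : ℝ} {s : Set ℝ} (hP : 0 < P)
    (hs : s.OrdConnected) (hA : Continuous A) (hAper : Function.Periodic A P)
    (hmean : κ * P < |∫ φ in (0 : ℝ)..P, A φ|)
    (hd : ∀ φ, ∀ x ∈ s, HasDerivAt (v φ) (v' φ x) x) (hvA : ∀ φ, ∀ x ∈ s, |v' φ x - A φ| ≤ κ)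
    {k : ℕ} (hk : 0 < k) {α β : ℝ → ℝ} (hα : IsPeriodicSolution v (k * P) s α)
    (hβ : IsPeriodicSolution v (k * P) s β) : α = β := by
  obtain ⟨B, hB⟩ := (hAper.isBounded_of_continuous hP.ne' hA).exists_norm_le
  have hlip : ∀ φ, LipschitzOnWith (Real.toNNReal (B + κ)) (v φ) s := fun φ =>
    hs.convex.lipschitzOnWith_of_nnnorm_hasDerivWithin_le
      (fun x hx => (hd φ x hx).hasDerivWithinAt) fun x hx => by
        have hAφ : |A φ| ≤ B := hB _ ⟨φ, rfl⟩
        have : |v' φ x| ≤ B + κ := by linarith [abs_sub_abs_le_abs_sub (v' φ x) (A φ), hvA φ x hx]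
        exact NNReal.coe_le_coe.1 (this.trans (Real.le_coe_toNNReal _))
  by_contra hne
  have hαβ : ∀ φ, α φ ≠ β φ := fun φ h => hne <|
    ODE_solution_unique_univ (s := fun _ => s) hlip (fun t => ⟨hα.hasDerivAt t, hα.mem t⟩)
      (fun t => ⟨hβ.hasDerivAt t, hβ.mem t⟩) h
  choose c hcs hc using fun φ =>
    exists_sub_eq_deriv_mul_sub hs (hd φ) (hα.mem φ) (hβ.mem φ) (hαβ φ)
  have hderiv : ∀ φ, HasDerivAt (fun φ => α φ - β φ) (v' φ (c φ) * (α φ - β φ)) φ := fun φ =>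
    ((hα.hasDerivAt φ).sub (hβ.hasDerivAt φ)).congr_deriv (hc φ)
  have hle := abs_integral_le_of_logDeriv_close (by positivity) (fun φ => sub_ne_zero.2 (hαβ φ))
    hderiv hA (fun φ => hvA φ _ (hcs φ)) (Q := k * P)
    (by simpa using congr_arg₂ (· - ·) (hα.periodic 0) (hβ.periodic 0))
  have hint : ∫ φ in (0 : ℝ)..k * P, A φ = k * ∫ φ in (0 : ℝ)..P, A φ := by
    simpa using hAper.intervalIntegral_add_zsmul_eq k 0 fun _ _ => hA.intervalIntegrable _ _
  rw [hint, abs_mul, Nat.abs_cast, mul_left_comm] at hle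
  exact hmean.not_ge (le_of_mul_le_mul_left hle (Nat.cast_pos.2 hk))

lemma exists_mem_Icc_eq_zero_of_mul_nonpos {F : ℝ → ℝ} {a b : ℝ} (hab : a ≤ b)
    (hF : ContinuousOn F (Icc a b)) (h : F a * F b ≤ 0) : ∃ x ∈ Icc a b, F x = 0 := by
  rcases mul_nonpos_iff.1 h with h | h
  · exact intermediate_value_Icc' hab hF ⟨h.2, h.1⟩
  · exact intermediate_value_Icc hab hF h

lemma exists_solutions_of_lipschitzOnWith {v : ℝ → ℝ → ℝ} {P lo hi a b : ℝ} {K M : NNReal}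
    (hP : 0 ≤ P) (hab : a ≤ b) (hcont : ∀ x ∈ Icc lo hi, Continuous fun t => v t x)
    (hlip : ∀ t, LipschitzOnWith K (v t) (Icc lo hi)) (hM : ∀ t, ∀ x ∈ Icc lo hi, |v t x| ≤ M)
    (ha : lo ≤ a - M * P) (hb : b + M * P ≤ hi) :
    ∃ α : ℝ → ℝ → ℝ, ContinuousOn (fun x => α x P) (Icc a b) ∧ ∀ x ∈ Icc a b, α x 0 = x ∧
      ∀ t ∈ Icc 0 P, |α x t - x| ≤ M * P ∧ HasDerivWithinAt (α x) (v t (α x t)) (Icc 0 P) t := by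
  have hlohi : lo ≤ hi := by linarith [mul_nonneg M.coe_nonneg hP]
  set w : ℝ → ℝ → ℝ := fun t => IccExtend hlohi ((Icc lo hi).domRestrict (v t)) with hw
  have hwM : ∀ t x, |w t x| ≤ M := fun t x => hM t _ (projIcc lo hi hlohi x).2
  obtain ⟨r, hr⟩ : ∃ r : NNReal, (r : ℝ) = (b - a) / 2 := ⟨⟨_, by linarith⟩, rfl⟩
  obtain ⟨R, hR⟩ : ∃ R : NNReal, (R : ℝ) = r + M * P := ⟨⟨_, by positivity⟩, rfl⟩
  have hPL : IsPicardLindelof w (tmin := 0) (tmax := P) ⟨0, le_rfl, hP⟩ ((a + b) / 2) R r M K := by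
    refine ⟨fun t _ => ?_, fun x _ => (hcont _ (projIcc lo hi hlohi x).2).continuousOn,
      fun t _ x _ => hwM t x, by simp [hP, hR]⟩
    have := (lipschitzOnWith_iff_restrict.1 (hlip t)).comp (LipschitzWith.projIcc hlohi)
    simpa [hw, IccExtend] using this.lipschitzOnWith
  obtain ⟨α, hα, L, hL⟩ := hPL.exists_forall_mem_closedBall_eq_hasDerivWithinAt_lipschitzOnWith
  have hball : Metric.closedBall ((a + b) / 2) r = Icc a b := by
    rw [Real.closedBall_eq_Icc, hr]
    congr 1 <;> ring
  rw [hball] at hα hL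
  refine ⟨α, (hL P ⟨hP, le_rfl⟩).continuousOn, fun x hx => ⟨(hα x hx).1, fun t ht => ?_⟩⟩
  have hstay : |α x t - x| ≤ M * P := by
    have := norm_image_sub_le_of_norm_deriv_le_segment' (hα x hx).2 (fun s _ => hwM s _) t ht
    rw [(hα x hx).1, Real.norm_eq_abs, sub_zero] at this
    exact this.trans (by gcongr; exact ht.2)
  have hmem : α x t ∈ Icc lo hi := by
    obtain ⟨h1, h2⟩ := abs_le.1 hstay
    exact ⟨by linarith [hx.1], by linarith [hx.2]⟩
  have hderiv := (hα x hx).2 t ht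
  simp only [hw, IccExtend_of_mem hlohi _ hmem, domRestrict_apply] at hderiv
  exact ⟨hstay, hderiv⟩

lemma mul_pos_of_abs_sub_le {d f c : ℝ} (h : |d - f| ≤ c) (hc : c < |f|) : 0 < d * f := by
  obtain ⟨h1, h2⟩ := abs_le.1 h
  rcases lt_abs.1 hc with h3 | h3 <;> nlinarith

lemma exists_isPeriodicSolution {v : ℝ → ℝ → ℝ} {A B : ℝ → ℝ} {P lo hi a b κ : ℝ} {K M : NNReal}
    (hP : 0 < P) (hper : Function.Periodic v P) (hab : a ≤ b)
    (hcont : ∀ x ∈ Icc lo hi, Continuous fun t => v t x)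
    (hlip : ∀ t, LipschitzOnWith K (v t) (Icc lo hi)) (hM : ∀ t, ∀ x ∈ Icc lo hi, |v t x| ≤ M)
    (ha : lo < a - M * P) (hb : b + M * P < hi) (hA : Continuous A) (hB : Continuous B)
    (hvA : ∀ t x, |x - a| ≤ M * P → |v t x - A t| ≤ κ)
    (hvB : ∀ t x, |x - b| ≤ M * P → |v t x - B t| ≤ κ)
    (hκA : κ * P < |∫ t in (0 : ℝ)..P, A t|) (hκB : κ * P < |∫ t in (0 : ℝ)..P, B t|)
    (hsign : (∫ t in (0 : ℝ)..P, A t) * (∫ t in (0 : ℝ)..P, B t) < 0) :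
    ∃ β : ℝ → ℝ, IsPeriodicSolution v P (Ioo lo hi) β := by
  obtain ⟨α, hαP, hα⟩ := exists_solutions_of_lipschitzOnWith hP.le hab hcont hlip hM ha.le hb.le
  have hdispl : ∀ x ∈ Icc a b, ∀ A : ℝ → ℝ, Continuous A →
      (∀ t y, |y - x| ≤ M * P → |v t y - A t| ≤ κ) → κ * P < |∫ t in (0 : ℝ)..P, A t| →
      0 < (α x P - x) * ∫ t in (0 : ℝ)..P, A t := fun x hx A hA hvA hκ => by
    obtain ⟨hx0, hx⟩ := hα x hx
    refine mul_pos_of_abs_sub_le ?_ hκ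
    simpa only [hx0] using abs_displacement_sub_integral_le hP.le (fun t ht => (hx t ht).2) hA
      fun t ht => hvA t _ (hx t ht).1
  have ha0 := hdispl a ⟨le_rfl, hab⟩ A hA hvA hκA
  have hb0 := hdispl b ⟨hab, le_rfl⟩ B hB hvB hκB
  obtain ⟨x, hx, hx0⟩ := exists_mem_Icc_eq_zero_of_mul_nonpos (F := fun x => α x P - x) hab
    (hαP.sub continuousOn_id) (by
      by_contra! hpos
      nlinarith [mul_pos ha0 hb0])
  obtain ⟨hαx, hαd⟩ := hα x hx
  obtain ⟨β, hβper, hβα, hβ⟩ := exists_periodic_extension hP hper (fun t ht => (hαd t ht).2)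
    (by rw [hαx]; linarith)
  refine ⟨β, hβper, fun t => ?_, hβ⟩
  obtain ⟨t', ht', h⟩ := hβper.exists_mem_Ico₀ hP t
  have ht' := Ico_subset_Icc_self ht'
  rw [h, hβα ht']
  obtain ⟨h1, h2⟩ := abs_le.1 (hαd t' ht').1
  exact ⟨by linarith [hx.1], by linarith [hx.2]⟩

lemma exists_mul_neg_of_hasDerivAt {f : ℝ → ℝ} {D x₀ r : ℝ} (hr : 0 < r) (hf : HasDerivAt f D x₀)
    (hx₀ : f x₀ = 0) (hD : D ≠ 0) : ∃ s ∈ Ioo 0 r, f (x₀ - s) * f (x₀ + s) < 0 := by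
  have hslope : ∀ᶠ t in 𝓝[≠] (0 : ℝ), 0 < t⁻¹ * f (x₀ + t) * D := by
    simpa [hx₀] using ((hasDerivAt_iff_tendsto_slope_zero.1 hf).mul_const D).eventually
      (lt_mem_nhds (mul_self_pos.2 hD))
  rw [eventually_nhdsWithin_iff, Metric.eventually_nhds_iff] at hslope
  obtain ⟨ζ, hζ, h⟩ := hslope
  obtain ⟨s, hs, hsζ⟩ := exists_between (lt_min hζ hr)
  obtain ⟨hsζ, hsr⟩ := lt_min_iff.1 hsζ
  have hleft := h (y := -s) (by simpa [abs_of_pos hs] using hsζ) (by simpa using hs.ne')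
  have hright := h (y := s) (by simpa [abs_of_pos hs] using hsζ) (by simpa using hs.ne')
  refine ⟨s, ⟨hs, hsr⟩, ?_⟩
  rw [sub_eq_add_neg]
  have hmul : f (x₀ + -s) * f (x₀ + s) * (D / s) ^ 2 < 0 := by
    have : f (x₀ + -s) * f (x₀ + s) * (D / s) ^ 2 =
        -(((-s)⁻¹ * f (x₀ + -s) * D) * (s⁻¹ * f (x₀ + s) * D)) := by field_simp
    rw [this]
    exact neg_neg_of_pos (mul_pos hleft hright)
  exact neg_of_mul_neg_left hmul (sq_nonneg _)

lemma eventually_forall_abs_mul_sub_le {g : ℝ → ℝ → ℝ → ℝ} {P e₀ lo hi c M η : ℝ} (hP : 0 < P)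
    (hper : Function.Periodic g P) (he : 0 < e₀)
    (hg : ContinuousOn (fun p : ℝ × ℝ × ℝ => g p.1 p.2.1 p.2.2)
      (univ ×ˢ Icc 0 e₀ ×ˢ Icc lo hi)) (hc : c ∈ Ioo lo hi) (hη : 0 < η) :
    ∀ᶠ ε in 𝓝[>] (0 : ℝ), ∀ φ x, |x - c| ≤ ε * M → |ε * g φ ε x - ε * g φ 0 c| ≤ ε * η := by
  obtain ⟨δ, hδ, hclose⟩ := exists_forall_dist_lt_of_periodic
    (f := fun φ (p : ℝ × ℝ) => g φ p.1 p.2) hP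
    (fun φ => by simp only [hper φ]) (isCompact_Icc.prod isCompact_Icc) hg hη
  have hsmall : ∀ᶠ ε in 𝓝[>] (0 : ℝ), ε * M < min δ (min (c - lo) (hi - c)) := by
    have : Tendsto (fun ε : ℝ => ε * M) (𝓝 0) (𝓝 0) :=
      Continuous.tendsto' (by fun_prop) _ _ (zero_mul M)
    exact (this.mono_left nhdsWithin_le_nhds).eventually_lt_const
      (lt_min hδ (lt_min (sub_pos.2 hc.1) (sub_pos.2 hc.2)))
  filter_upwards [hsmall, Ioo_mem_nhdsGT (lt_min he hδ)] with ε hεM ⟨hε, hεδ⟩ φ x hx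
  obtain ⟨hεe, hεδ⟩ := lt_min_iff.1 hεδ
  obtain ⟨hMδ, hM⟩ := lt_min_iff.1 hεM
  obtain ⟨hlo, hhi⟩ := lt_min_iff.1 hM
  obtain ⟨hx1, hx2⟩ := abs_le.1 hx
  rw [← mul_sub, abs_mul, abs_of_pos hε]
  gcongr
  refine (hclose φ (ε, x) ⟨⟨hε.le, hεe.le⟩, by linarith, by linarith⟩ (0, c)
    ⟨⟨le_rfl, he.le⟩, Ioo_subset_Icc_self hc⟩ ?_).le
  rw [Prod.dist_eq, Real.dist_eq, Real.dist_eq, sub_zero, abs_of_pos hε]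
  exact max_lt hεδ (hx.trans_lt hMδ)

lemma eventually_exists_isPeriodicSolution {g : ℝ → ℝ → ℝ → ℝ} {P e₀ lo hi a b : ℝ} {K : NNReal}
    (hP : 0 < P) (hper : Function.Periodic g P) (he : 0 < e₀)
    (hg : ContinuousOn (fun p : ℝ × ℝ × ℝ => g p.1 p.2.1 p.2.2)
      (univ ×ˢ Icc 0 e₀ ×ˢ Icc lo hi))
    (hlip : ∀ φ, ∀ ε ∈ Icc 0 e₀, LipschitzOnWith K (g φ ε) (Icc lo hi))
    (ha : a ∈ Ioo lo hi) (hb : b ∈ Ioo lo hi) (hab : a ≤ b)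
    (hsign : (∫ φ in (0 : ℝ)..P, g φ 0 a) * (∫ φ in (0 : ℝ)..P, g φ 0 b) < 0) :
    ∀ᶠ ε in 𝓝[>] (0 : ℝ), ∃ β, IsPeriodicSolution (fun φ x => ε * g φ ε x) P (Ioo lo hi) β := by
  have hcont : ∀ ε ∈ Icc 0 e₀, ∀ x ∈ Icc lo hi, Continuous fun φ => g φ ε x := fun ε hε x hx =>
    hg.comp_continuous (f := fun φ => (φ, ε, x)) (by fun_prop) fun φ => ⟨mem_univ φ, hε, hx⟩
  obtain ⟨B, hB⟩ := exists_forall_norm_le_of_periodic (f := fun φ (p : ℝ × ℝ) => g φ p.1 p.2) hP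
    (fun φ => by simp only [hper φ]) (isCompact_Icc.prod isCompact_Icc) hg
  obtain ⟨hIa, hIb⟩ := mul_ne_zero_iff.1 hsign.ne
  obtain ⟨η, hη, hηP⟩ := exists_pos_mul_lt (lt_min (abs_pos.2 hIa) (abs_pos.2 hIb)) P
  obtain ⟨hηa, hηb⟩ := lt_min_iff.1 hηP
  have hsmall : ∀ᶠ ε in 𝓝[>] (0 : ℝ), ε * B.toNNReal * P < min (a - lo) (hi - b) := by
    have : Tendsto (fun ε : ℝ => ε * B.toNNReal * P) (𝓝 0) (𝓝 0) :=
      Continuous.tendsto' (by fun_prop) _ _ (by simp)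
    exact (this.mono_left nhdsWithin_le_nhds).eventually_lt_const
      (lt_min (sub_pos.2 ha.1) (sub_pos.2 hb.2))
  filter_upwards [hsmall, Ioo_mem_nhdsGT he,
    eventually_forall_abs_mul_sub_le (M := B.toNNReal * P) hP hper he hg ha hη,
    eventually_forall_abs_mul_sub_le (M := B.toNNReal * P) hP hper he hg hb hη]
    with ε hM ⟨hε, hεe⟩ hnear_a hnear_b
  obtain ⟨hMa, hMb⟩ := lt_min_iff.1 hM
  lift ε to NNReal using hε.le
  have hεI : (ε : ℝ) ∈ Icc 0 e₀ := ⟨hε.le, hεe.le⟩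
  have hmean : ∀ c, P * η < |∫ φ in (0 : ℝ)..P, g φ 0 c| →
      ε * η * P < |∫ φ in (0 : ℝ)..P, ε * g φ 0 c| := fun c hc => by
    rw [intervalIntegral.integral_const_mul, abs_mul, NNReal.abs_eq, mul_assoc, mul_comm η]
    gcongr
  refine exists_isPeriodicSolution (v := fun φ x => ε * g φ ε x) (K := ε * K)
    (M := ε * B.toNNReal) hP (fun φ => by simp only [hper φ]) hab
    (fun x hx => (hcont _ hεI x hx).const_mul _) (fun φ => ?_) (fun φ x hx => ?_)
    (by push_cast; linarith) (by push_cast; linarith)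
    ((hcont 0 ⟨le_rfl, he.le⟩ a (Ioo_subset_Icc_self ha)).const_mul _)
    ((hcont 0 ⟨le_rfl, he.le⟩ b (Ioo_subset_Icc_self hb)).const_mul _)
    (fun φ x hx => hnear_a φ x (by simpa [mul_assoc] using hx))
    (fun φ x hx => hnear_b φ x (by simpa [mul_assoc] using hx)) (hmean a hηa) (hmean b hηb) ?_
  · simpa [Function.comp_def] using (lipschitzWith_smul (ε : ℝ)).comp_lipschitzOnWith (hlip φ ε hεI)
  · rw [abs_mul, NNReal.abs_eq, NNReal.coe_mul]
    gcongr
    exact (hB φ (ε, x) ⟨hεI, hx⟩).trans (Real.le_coe_toNNReal B)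
  · simp only [intervalIntegral.integral_const_mul]
    nlinarith [mul_pos hε hε]

lemma hasDerivAt_intervalIntegral_param {F F' : ℝ → ℝ → ℝ} {a b x₀ r : ℝ} (hr : 0 < r)
    (hF : ∀ x ∈ Icc (x₀ - r) (x₀ + r), Continuous fun φ => F φ x)
    (hF' : ContinuousOn (fun p : ℝ × ℝ => F' p.1 p.2) (univ ×ˢ Icc (x₀ - r) (x₀ + r)))
    (hd : ∀ φ, ∀ x ∈ Icc (x₀ - r) (x₀ + r), HasDerivAt (F φ) (F' φ x) x) :
    HasDerivAt (fun x => ∫ φ in a..b, F φ x) (∫ φ in a..b, F' φ x₀) x₀ := by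
  have hs : Ioo (x₀ - r) (x₀ + r) ∈ 𝓝 x₀ := Ioo_mem_nhds (by linarith) (by linarith)
  have hx₀ : x₀ ∈ Icc (x₀ - r) (x₀ + r) := ⟨by linarith, by linarith⟩
  obtain ⟨B, hB⟩ := (isCompact_uIcc.prod isCompact_Icc).exists_bound_of_continuousOn
    (hF'.mono (prod_mono (subset_univ (uIcc a b)) Subset.rfl))
  have hF'c : Continuous fun φ => F' φ x₀ :=
    hF'.comp_continuous (f := fun φ => (φ, x₀)) (by fun_prop) fun φ => ⟨mem_univ φ, hx₀⟩
  refine (intervalIntegral.hasDerivAt_integral_of_dominated_loc_of_deriv_le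
    (F := fun x φ => F φ x) (F' := fun x φ => F' φ x) (bound := fun _ => B) hs
    (by filter_upwards [hs] with x hx using (hF x (Ioo_subset_Icc_self hx)).aestronglyMeasurable)
    ((hF x₀ hx₀).intervalIntegrable _ _) hF'c.aestronglyMeasurable
    (Eventually.of_forall fun φ hφ x hx => ?_) intervalIntegrable_const
    (Eventually.of_forall fun φ _ x hx => hd φ x (Ioo_subset_Icc_self hx))).2
  exact hB (φ, x) ⟨uIoc_subset_uIcc hφ, Ioo_subset_Icc_self hx⟩

section Averaging

variable {g g' : ℝ → ℝ → ℝ → ℝ} {P e₀ x₀ r₀ : ℝ}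

lemma exists_forall_isPeriodicSolution_unique (hP : 0 < P) (hper' : Function.Periodic g' P)
    (he : 0 < e₀) (hr₀ : 0 < r₀)
    (hg' : ContinuousOn (fun p : ℝ × ℝ × ℝ => g' p.1 p.2.1 p.2.2)
      (univ ×ˢ Icc 0 e₀ ×ˢ Icc (x₀ - r₀) (x₀ + r₀)))
    (hd : ∀ φ, ∀ ε ∈ Icc 0 e₀, ∀ x ∈ Icc (x₀ - r₀) (x₀ + r₀), HasDerivAt (g φ ε) (g' φ ε x) x)
    (hD : ∫ φ in (0 : ℝ)..P, g' φ 0 x₀ ≠ 0) :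
    ∃ r ∈ Ioc 0 r₀, ∀ ε ∈ Ioo 0 r, ∀ k : ℕ, 0 < k → ∀ α β,
      IsPeriodicSolution (fun φ x => ε * g φ ε x) (k * P) (Ioo (x₀ - r) (x₀ + r)) α →
      IsPeriodicSolution (fun φ x => ε * g φ ε x) (k * P) (Ioo (x₀ - r) (x₀ + r)) β → α = β := by
  have hx₀ : x₀ ∈ Icc (x₀ - r₀) (x₀ + r₀) := ⟨by linarith, by linarith⟩
  obtain ⟨κ, hκ, hκP⟩ := exists_pos_mul_lt (abs_pos.2 hD) P
  obtain ⟨δ, hδ, hclose⟩ := exists_forall_dist_lt_of_periodic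
    (f := fun φ (p : ℝ × ℝ) => g' φ p.1 p.2) hP
    (fun φ => by simp only [hper' φ]) (isCompact_Icc.prod isCompact_Icc) hg' hκ
  obtain ⟨r, hr, hrmin⟩ := exists_between (lt_min he (lt_min hδ hr₀))
  obtain ⟨hre, hrmin⟩ := lt_min_iff.1 hrmin
  obtain ⟨hrδ, hrr₀⟩ := lt_min_iff.1 hrmin
  refine ⟨r, ⟨hr, hrr₀.le⟩, fun ε ⟨hε, hεr⟩ k hk α β hα hβ => ?_⟩
  have hεI : ε ∈ Icc 0 e₀ := ⟨hε.le, by linarith⟩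
  have hsub : Ioo (x₀ - r) (x₀ + r) ⊆ Icc (x₀ - r₀) (x₀ + r₀) := fun x hx =>
    ⟨by linarith [hx.1], by linarith [hx.2]⟩
  refine hα.unique (v' := fun φ x => ε * g' φ ε x) (A := fun φ => ε * g' φ 0 x₀) (κ := ε * κ) hP
    ordConnected_Ioo ?_ (fun φ => by simp only [hper' φ]) ?_
    (fun φ x hx => (hd φ ε hεI x (hsub hx)).const_mul ε) (fun φ x hx => ?_) hk hβ
  · exact (hg'.comp_continuous (f := fun φ => (φ, 0, x₀)) (by fun_prop)
      fun φ => ⟨mem_univ φ, ⟨le_rfl, he.le⟩, hx₀⟩).const_mul ε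
  · rw [intervalIntegral.integral_const_mul, abs_mul, abs_of_pos hε, mul_assoc, mul_comm κ]
    gcongr
  · rw [← mul_sub, abs_mul, abs_of_pos hε]
    gcongr
    refine (hclose φ (ε, x) ⟨hεI, hsub hx⟩ (0, x₀) ⟨⟨le_rfl, he.le⟩, hx₀⟩ ?_).le
    rw [Prod.dist_eq, Real.dist_eq, Real.dist_eq, sub_zero, abs_of_pos hε]
    exact max_lt (hεr.trans hrδ) (abs_lt.2 ⟨by linarith [hx.1], by linarith [hx.2]⟩)

theorem exists_unique_isPeriodicSolution (hP : 0 < P) (hper : Function.Periodic g P)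
    (hper' : Function.Periodic g' P) (he : 0 < e₀) (hr₀ : 0 < r₀)
    (hg : ContinuousOn (fun p : ℝ × ℝ × ℝ => g p.1 p.2.1 p.2.2)
      (univ ×ˢ Icc 0 e₀ ×ˢ Icc (x₀ - r₀) (x₀ + r₀)))
    (hg' : ContinuousOn (fun p : ℝ × ℝ × ℝ => g' p.1 p.2.1 p.2.2)
      (univ ×ˢ Icc 0 e₀ ×ˢ Icc (x₀ - r₀) (x₀ + r₀)))
    (hd : ∀ φ, ∀ ε ∈ Icc 0 e₀, ∀ x ∈ Icc (x₀ - r₀) (x₀ + r₀), HasDerivAt (g φ ε) (g' φ ε x) x)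
    (hz : ∫ φ in (0 : ℝ)..P, g φ 0 x₀ = 0) (hD : ∫ φ in (0 : ℝ)..P, g' φ 0 x₀ ≠ 0) :
    ∃ r ∈ Ioc 0 r₀, ∀ᶠ ε in 𝓝[>] (0 : ℝ), ∃ β,
      IsPeriodicSolution (fun φ x => ε * g φ ε x) P (Ioo (x₀ - r) (x₀ + r)) β ∧
      ∀ k : ℕ, 0 < k → ∀ α,
        IsPeriodicSolution (fun φ x => ε * g φ ε x) (k * P) (Ioo (x₀ - r) (x₀ + r)) α → α = β := by
  obtain ⟨r, ⟨hr, hrr₀⟩, hunique⟩ :=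
    exists_forall_isPeriodicSolution_unique hP hper' he hr₀ hg' hd hD
  have h0e : (0 : ℝ) ∈ Icc 0 e₀ := ⟨le_rfl, he.le⟩
  have hsub : Icc (x₀ - r) (x₀ + r) ⊆ Icc (x₀ - r₀) (x₀ + r₀) :=
    Icc_subset_Icc (by linarith) (by linarith)
  obtain ⟨B, hB⟩ := exists_forall_norm_le_of_periodic (f := fun φ (p : ℝ × ℝ) => g' φ p.1 p.2) hP
    (fun φ => by simp only [hper' φ]) (isCompact_Icc.prod isCompact_Icc) hg'
  have hlip : ∀ φ, ∀ ε ∈ Icc 0 e₀, LipschitzOnWith B.toNNReal (g φ ε) (Icc (x₀ - r) (x₀ + r)) :=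
    fun φ ε hε => (convex_Icc _ _).lipschitzOnWith_of_nnnorm_hasDerivWithin_le
      (fun x hx => (hd φ ε hε x (hsub hx)).hasDerivWithinAt) fun x hx =>
        NNReal.coe_le_coe.1 ((hB φ (ε, x) ⟨hε, hsub hx⟩).trans (Real.le_coe_toNNReal B))
  have hderiv : HasDerivAt (fun x => ∫ φ in (0 : ℝ)..P, g φ 0 x) (∫ φ in (0 : ℝ)..P, g' φ 0 x₀)
      x₀ :=
    hasDerivAt_intervalIntegral_param (F := fun φ => g φ 0) (F' := fun φ => g' φ 0) hr₀
      (fun x hx => hg.comp_continuous (f := fun φ => (φ, 0, x)) (by fun_prop)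
        fun φ => ⟨mem_univ φ, h0e, hx⟩)
      (hg'.comp (f := fun p : ℝ × ℝ => (p.1, 0, p.2)) (by fun_prop)
        fun p hp => ⟨mem_univ p.1, h0e, hp.2⟩)
      fun φ x hx => hd φ 0 h0e x hx
  obtain ⟨s, ⟨hs, hsr⟩, hsign⟩ := exists_mul_neg_of_hasDerivAt hr hderiv hz hD
  refine ⟨r, ⟨hr, hrr₀⟩, ?_⟩
  filter_upwards [eventually_exists_isPeriodicSolution hP hper he
    (hg.mono (prod_mono Subset.rfl (prod_mono Subset.rfl hsub))) hlip
    (a := x₀ - s) (b := x₀ + s) ⟨by linarith, by linarith⟩ ⟨by linarith, by linarith⟩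
    (by linarith) hsign, Ioo_mem_nhdsGT hr] with ε ⟨β, hβ⟩ hε
  exact ⟨β, hβ, fun k hk α hα => hunique ε hε k hk α β hα (hβ.natCast_mul k)⟩

end Averaging

/-! ### Reparametrisation of time -/

lemma surjective_of_le_deriv {φ ω : ℝ → ℝ} {m : ℝ} (hm : 0 < m)
    (hφ : ∀ t, HasDerivAt φ (ω t) t) (hω : ∀ t, m ≤ ω t) : Function.Surjective φ := by
  have hmono : Monotone fun t => φ t - m * t := by
    have hd : ∀ t, HasDerivAt (fun t => φ t - m * t) (ω t - m) t := fun t => by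
      simpa using HasDerivAt.fun_sub (hφ t) ((hasDerivAt_id t).const_mul m)
    exact monotone_of_hasDerivAt_nonneg hd fun t => sub_nonneg.2 (hω t)
  have hcont : Continuous φ := continuous_iff_continuousAt.2 fun t => (hφ t).continuousAt
  refine hcont.surjective
    (tendsto_atTop_mono' _ (f₁ := fun t => φ 0 + m * t) ?_
      (tendsto_atTop_add_const_left _ _ (tendsto_id.const_mul_atTop hm)))
    (tendsto_atBot_mono' _ (f₁ := fun t => φ 0 + m * t) ?_
      (tendsto_atBot_add_const_left _ _ (tendsto_id.const_mul_atBot hm)))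
  · filter_upwards [eventually_ge_atTop 0] with t ht
    linarith [hmono ht]
  · filter_upwards [eventually_le_atBot 0] with t ht
    linarith [hmono ht]

lemma exists_inverse_of_le_deriv {φ ω : ℝ → ℝ} {m : ℝ} (hm : 0 < m)
    (hφ : ∀ t, HasDerivAt φ (ω t) t) (hω : ∀ t, m ≤ ω t) :
    ∃ ψ : ℝ → ℝ, (∀ x, φ (ψ x) = x) ∧ (∀ t, ψ (φ t) = t) ∧
      ∀ x, HasDerivAt ψ (ω (ψ x))⁻¹ x := by
  have hmono : StrictMono φ := strictMono_of_hasDerivAt_pos hφ fun t => hm.trans_le (hω t)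
  set e := hmono.orderIsoOfSurjective φ (surjective_of_le_deriv hm hφ hω)
  have hright : ∀ x, φ (e.symm x) = x := e.apply_symm_apply
  exact ⟨e.symm, hright, e.symm_apply_apply, fun x =>
    HasDerivAt.of_local_left_inverse e.symm.continuous.continuousAt (hφ _)
      (hm.trans_le (hω _)).ne' (Eventually.of_forall hright)⟩

lemma exists_periodic_inverse {φ Ω : ℝ → ℝ} {T : ℝ} (hT : 0 < T) (hφ : ∀ t, HasDerivAt φ (Ω t) t)
    (hΩ : Continuous Ω) (hper : Function.Periodic Ω T) (hpos : ∀ t, 0 < Ω t) :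
    ∃ (ψ : ℝ → ℝ) (Φ : ℝ), 0 < Φ ∧ (∀ t, φ (t + T) = φ t + Φ) ∧ (∀ x, φ (ψ x) = x) ∧
      (∀ t, ψ (φ t) = t) ∧ (∀ x, ψ (x + Φ) = ψ x + T) ∧ ∀ x, HasDerivAt ψ (Ω (ψ x))⁻¹ x := by
  obtain ⟨_, ⟨t₀, rfl⟩, hmin⟩ :=
    (hper.compact_of_continuous hT.ne' hΩ).exists_isLeast (range_nonempty Ω)
  obtain ⟨ψ, hφψ, hψφ, hψ⟩ :=
    exists_inverse_of_le_deriv (hpos t₀) hφ fun t => hmin (mem_range_self t)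
  have hincr : ∀ t, HasDerivAt (fun t => φ (t + T) - φ t) 0 t := fun t =>
    (((hφ (t + T)).comp_add_const t T).sub (hφ t)).congr_deriv (by rw [hper t, sub_self])
  have hφT : ∀ t, φ (t + T) = φ t + (φ (0 + T) - φ 0) := fun t => by
    linarith [is_const_of_deriv_eq_zero (fun t => (hincr t).differentiableAt)
      (fun t => (hincr t).deriv) t 0]
  refine ⟨ψ, φ (0 + T) - φ 0, ?_, hφT, hφψ, hψφ, fun x => ?_, hψ⟩
  · exact sub_pos.2 (strictMono_of_hasDerivAt_pos hφ hpos (by linarith))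
  · rw [← hψφ (ψ x + T), hφT (ψ x), hφψ]

/-! ### Perturbed rotations -/

/-- The point with clockwise polar coordinates `(ρ, φ)`, the angle measured from the second axis. -/
noncomputable def polarPoint (ρ φ : ℝ) : ℝ × ℝ := (ρ * Real.sin φ, ρ * Real.cos φ)

/-- The Euclidean distance to the origin (the norm of `ℝ × ℝ` is the maximum norm). -/
noncomputable def polarRadius (z : ℝ × ℝ) : ℝ := √(z.1 ^ 2 + z.2 ^ 2)

/-- The perturbed rotation `z' = J(z) (z₂, -z₁) + ε K(z)`. -/
def rotationField (J K₁ K₂ : ℝ × ℝ → ℝ) (ε : ℝ) (z : ℝ × ℝ) : ℝ × ℝ :=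
  (J z * z.2 + ε * K₁ z, -(J z * z.1) + ε * K₂ z)

/-- Angular velocity of `rotationField` in polar coordinates. -/
noncomputable def angularSpeed (J K₁ K₂ : ℝ × ℝ → ℝ) (φ ε ρ : ℝ) : ℝ :=
  J (polarPoint ρ φ) +
    ε / ρ * (Real.cos φ * K₁ (polarPoint ρ φ) - Real.sin φ * K₂ (polarPoint ρ φ))

/-- The function `g` in the orbit equation `dρ/dφ = ε g(φ, ε, ρ)` of `rotationField`. -/
noncomputable def radialSlope (J K₁ K₂ : ℝ × ℝ → ℝ) (φ ε ρ : ℝ) : ℝ :=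
  (Real.sin φ * K₁ (polarPoint ρ φ) + Real.cos φ * K₂ (polarPoint ρ φ)) /
    angularSpeed J K₁ K₂ φ ε ρ

/-- The averaged right-hand side of the orbit equation of `rotationField`. -/
noncomputable def radialAverage (J K₁ K₂ : ℝ × ℝ → ℝ) (ρ : ℝ) : ℝ :=
  ∫ φ in (0 : ℝ)..2 * Real.pi, radialSlope J K₁ K₂ φ 0 ρ

lemma polarPoint_periodic (ρ : ℝ) : Function.Periodic (polarPoint ρ) (2 * Real.pi) := fun φ => by
  simp [polarPoint]

lemma continuous_polarRadius : Continuous polarRadius := by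
  unfold polarRadius
  fun_prop

lemma polarPoint_sq (ρ φ : ℝ) : (polarPoint ρ φ).1 ^ 2 + (polarPoint ρ φ).2 ^ 2 = ρ ^ 2 := by
  simp only [polarPoint]
  linear_combination ρ ^ 2 * Real.sin_sq_add_cos_sq φ

lemma polarRadius_polarPoint {ρ : ℝ} (hρ : 0 ≤ ρ) (φ : ℝ) : polarRadius (polarPoint ρ φ) = ρ := by
  rw [polarRadius, polarPoint_sq, Real.sqrt_sq hρ]

lemma polarPoint_add_pi_ne {ρ ρ' : ℝ} (hρ : 0 < ρ) (hρ' : 0 < ρ') (φ : ℝ) :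
    polarPoint ρ' (φ + Real.pi) ≠ polarPoint ρ φ := by
  intro h
  simp only [polarPoint, Real.sin_add_pi, Real.cos_add_pi, Prod.mk.injEq] at h
  have : ρ' + ρ = 0 := by
    linear_combination -Real.sin φ * h.1 - Real.cos φ * h.2 -
      (ρ' + ρ) * Real.sin_sq_add_cos_sq φ
  linarith

lemma exists_eq_natCast_mul_two_pi {ρ φ Φ : ℝ} (hρ : ρ ≠ 0) (hΦ : 0 < Φ)
    (h : polarPoint ρ (φ + Φ) = polarPoint ρ φ) : ∃ k : ℕ, 0 < k ∧ Φ = k * (2 * Real.pi) := by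
  simp only [polarPoint, Prod.mk.injEq, mul_right_inj' hρ] at h
  obtain ⟨k, hk⟩ := Real.Angle.angle_eq_iff_two_pi_dvd_sub.1 (Real.Angle.cos_sin_inj h.2 h.1)
  rw [add_sub_cancel_left] at hk
  have hkpos : 0 < k := by
    have : (0 : ℝ) < k := pos_of_mul_pos_right (hk ▸ hΦ) (by positivity)
    exact_mod_cast this
  lift k to ℕ using hkpos.le
  exact ⟨k, by exact_mod_cast hkpos, by rw [hk, Int.cast_natCast, mul_comm]⟩

lemma angularSpeed_periodic (J K₁ K₂ : ℝ × ℝ → ℝ) :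
    Function.Periodic (angularSpeed J K₁ K₂) (2 * Real.pi) := fun φ => by
  ext ε ρ
  simp [angularSpeed, polarPoint_periodic ρ φ]

lemma radialSlope_periodic (J K₁ K₂ : ℝ × ℝ → ℝ) :
    Function.Periodic (radialSlope J K₁ K₂) (2 * Real.pi) := fun φ => by
  ext ε ρ
  simp [radialSlope, polarPoint_periodic ρ φ, angularSpeed_periodic J K₁ K₂ φ]

lemma exists_eq_cexp {Z Z' : ℝ → ℂ} (hZ : ∀ t, HasDerivAt Z (Z' t) t) (hZ' : Continuous Z')
    (h0 : ∀ t, Z t ≠ 0) :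
    ∃ L : ℝ → ℂ, (∀ t, Z t = Complex.exp (L t)) ∧ ∀ t, HasDerivAt L (Z' t / Z t) t := by
  have hZc : Continuous Z := continuous_iff_continuousAt.2 fun t => (hZ t).continuousAt
  set L : ℝ → ℂ := fun t => Complex.log (Z 0) + ∫ x in (0 : ℝ)..t, Z' x / Z x with hL
  have hLd : ∀ t, HasDerivAt L (Z' t / Z t) t := fun t =>
    ((hZ'.div hZc h0).integral_hasStrictDerivAt 0 t).hasDerivAt.const_add _
  have hconst : ∀ t, HasDerivAt (fun t => Z t * Complex.exp (-L t)) 0 t := fun t => by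
    refine ((hZ t).mul (hLd t).neg.cexp).congr_deriv ?_
    field_simp [h0 t]
    ring
  refine ⟨L, fun t => ?_, hLd⟩
  have h1 : Z t * Complex.exp (-L t) = 1 := by
    rw [is_const_of_deriv_eq_zero (fun t => (hconst t).differentiableAt)
      (fun t => (hconst t).deriv) t 0]
    simp [hL, Complex.exp_neg, Complex.exp_log (h0 0), h0 0]
  rw [Complex.exp_neg] at h1
  exact eq_of_mul_inv_eq_one h1

lemma re_im_div_of_polar {x y ρ φ : ℝ} (hρ : ρ ≠ 0) (hx : x = ρ * Real.cos φ)
    (hy : y = ρ * Real.sin φ) (a b : ℝ) :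
    (((b + a * Complex.I) / (x + y * Complex.I) : ℂ)).re =
        (Real.sin φ * a + Real.cos φ * b) / ρ ∧
      ((b + a * Complex.I) / (x + y * Complex.I) : ℂ).im =
        (Real.cos φ * a - Real.sin φ * b) / ρ := by
  have hnorm : Complex.normSq (x + y * Complex.I) = ρ ^ 2 := by
    rw [Complex.normSq_add_mul_I, hx, hy]
    linear_combination ρ ^ 2 * Real.sin_sq_add_cos_sq φ
  rw [Complex.div_re, Complex.div_im, hnorm]
  simp only [Complex.add_re, Complex.add_im, Complex.re_ofReal_mul, Complex.im_ofReal_mul,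
    Complex.ofReal_re, Complex.ofReal_im, Complex.I_re, Complex.I_im]
  rw [hx, hy]
  constructor <;> field_simp <;> ring

lemma exists_polar_lift {γ γ' : ℝ → ℝ × ℝ} (hγ : ∀ t, HasDerivAt γ (γ' t) t)
    (hγ' : Continuous γ') (h0 : ∀ t, γ t ≠ 0) :
    ∃ ρ φ : ℝ → ℝ, (∀ t, 0 < ρ t) ∧ (∀ t, γ t = polarPoint (ρ t) (φ t)) ∧
      (∀ t, HasDerivAt ρ (Real.sin (φ t) * (γ' t).1 + Real.cos (φ t) * (γ' t).2) t) ∧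
      ∀ t, HasDerivAt φ ((Real.cos (φ t) * (γ' t).1 - Real.sin (φ t) * (γ' t).2) / ρ t) t := by
  have hγ₁ : ∀ t, HasDerivAt (fun t => (γ t).1) (γ' t).1 t := fun t => (hγ t).fst
  have hγ₂ : ∀ t, HasDerivAt (fun t => (γ t).2) (γ' t).2 t := fun t => (hγ t).snd
  obtain ⟨L, hL, hLd⟩ := exists_eq_cexp (Z := fun t => (γ t).2 + (γ t).1 * Complex.I)
    (Z' := fun t => (γ' t).2 + (γ' t).1 * Complex.I)
    (fun t => (hγ₂ t).ofReal_comp.add ((hγ₁ t).ofReal_comp.mul_const _)) (by fun_prop)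
    fun t h => h0 t (Prod.ext (by simpa using congrArg Complex.im h)
      (by simpa using congrArg Complex.re h))
  have hre : ∀ t, (γ t).2 = Real.exp (L t).re * Real.cos (L t).im := fun t => by
    simpa [Complex.exp_re] using congrArg Complex.re (hL t)
  have him : ∀ t, (γ t).1 = Real.exp (L t).re * Real.sin (L t).im := fun t => by
    simpa [Complex.exp_im] using congrArg Complex.im (hL t)
  have hreim : ∀ t, HasDerivAt (fun t => (L t).re) _ t ∧ HasDerivAt (fun t => (L t).im) _ t :=
    fun t => ⟨Complex.reCLM.hasFDerivAt.comp_hasDerivAt t (hLd t),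
      Complex.imCLM.hasFDerivAt.comp_hasDerivAt t (hLd t)⟩
  refine ⟨fun t => Real.exp (L t).re, fun t => (L t).im, fun t => Real.exp_pos _,
    fun t => Prod.ext (him t) (hre t), fun t => ?_, fun t => ?_⟩
  · refine (hreim t).1.exp.congr_deriv ?_
    rw [Complex.reCLM_apply, (re_im_div_of_polar (Real.exp_pos _).ne' (hre t) (him t) _ _).1,
      mul_div_cancel₀ _ (Real.exp_pos _).ne']
  · refine (hreim t).2.congr_deriv ?_
    rw [Complex.imCLM_apply, (re_im_div_of_polar (Real.exp_pos _).ne' (hre t) (him t) _ _).2]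

section RotationField

variable {J K₁ K₂ : ℝ × ℝ → ℝ} {ε : ℝ}

lemma angularSpeed_mul {ρ : ℝ} (hρ : ρ ≠ 0) (φ : ℝ) :
    ρ * angularSpeed J K₁ K₂ φ ε ρ =
      Real.cos φ * (rotationField J K₁ K₂ ε (polarPoint ρ φ)).1 -
        Real.sin φ * (rotationField J K₁ K₂ ε (polarPoint ρ φ)).2 := by
  have hfst : (polarPoint ρ φ).1 = ρ * Real.sin φ := rfl
  have hsnd : (polarPoint ρ φ).2 = ρ * Real.cos φ := rfl
  simp only [angularSpeed, rotationField, hfst, hsnd]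
  field_simp
  linear_combination -ρ * J (polarPoint ρ φ) * Real.sin_sq_add_cos_sq φ

lemma angularSpeed_eq_div {ρ : ℝ} (hρ : 0 < ρ) (φ : ℝ) :
    angularSpeed J K₁ K₂ φ ε ρ =
      ((polarPoint ρ φ).2 * (rotationField J K₁ K₂ ε (polarPoint ρ φ)).1 -
        (polarPoint ρ φ).1 * (rotationField J K₁ K₂ ε (polarPoint ρ φ)).2) /
        polarRadius (polarPoint ρ φ) ^ 2 := by
  rw [polarRadius_polarPoint hρ.le, eq_div_iff (by positivity)]
  have hfst : (polarPoint ρ φ).1 = ρ * Real.sin φ := rfl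
  have hsnd : (polarPoint ρ φ).2 = ρ * Real.cos φ := rfl
  rw [hfst, hsnd]
  linear_combination ρ * angularSpeed_mul (J := J) (K₁ := K₁) (K₂ := K₂) (ε := ε) hρ.ne' φ

lemma radialSlope_mul_angularSpeed {φ ρ : ℝ} (h : angularSpeed J K₁ K₂ φ ε ρ ≠ 0) :
    ε * radialSlope J K₁ K₂ φ ε ρ * angularSpeed J K₁ K₂ φ ε ρ =
      Real.sin φ * (rotationField J K₁ K₂ ε (polarPoint ρ φ)).1 +
        Real.cos φ * (rotationField J K₁ K₂ ε (polarPoint ρ φ)).2 := by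
  rw [radialSlope, mul_assoc, div_mul_cancel₀ _ h]
  simp only [rotationField, polarPoint]
  ring

lemma hasDerivAt_polarPoint_comp {β : ℝ → ℝ} {φ : ℝ} (hβ0 : β φ ≠ 0)
    (hω : angularSpeed J K₁ K₂ φ ε (β φ) ≠ 0)
    (hβ : HasDerivAt β (ε * radialSlope J K₁ K₂ φ ε (β φ)) φ) :
    HasDerivAt (fun φ => polarPoint (β φ) φ)
      ((angularSpeed J K₁ K₂ φ ε (β φ))⁻¹ • rotationField J K₁ K₂ ε (polarPoint (β φ) φ)) φ := by
  refine ((hβ.mul (Real.hasDerivAt_sin φ)).prodMk (hβ.mul (Real.hasDerivAt_cos φ))).congr_deriv ?_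
  have hang := angularSpeed_mul (J := J) (K₁ := K₁) (K₂ := K₂) (ε := ε) hβ0 φ
  have hrad := radialSlope_mul_angularSpeed hω
  have hsc := Real.sin_sq_add_cos_sq φ
  rw [eq_inv_smul_iff₀ hω]
  ext
  · simp only [Prod.smul_fst, smul_eq_mul]
    linear_combination Real.cos φ * hang + Real.sin φ * hrad +
      (rotationField J K₁ K₂ ε (polarPoint (β φ) φ)).1 * hsc
  · simp only [Prod.smul_snd, smul_eq_mul]
    linear_combination -Real.sin φ * hang + Real.cos φ * hrad +
      (rotationField J K₁ K₂ ε (polarPoint (β φ) φ)).2 * hsc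

lemma IsPeriodicSolution.isPeriodicOrbit {s : Set ℝ} {β : ℝ → ℝ} (hs : s ⊆ Ioi 0)
    (hβ : IsPeriodicSolution (fun φ ρ => ε * radialSlope J K₁ K₂ φ ε ρ) (2 * Real.pi) s β)
    (hω : ∀ φ, ∀ ρ ∈ s, 0 < angularSpeed J K₁ K₂ φ ε ρ)
    (hωc : Continuous fun φ => angularSpeed J K₁ K₂ φ ε (β φ)) :
    IsPeriodicOrbit (rotationField J K₁ K₂ ε) (range fun φ => polarPoint (β φ) φ) := by
  have hω0 : ∀ φ, 0 < angularSpeed J K₁ K₂ φ ε (β φ) := fun φ => hω φ _ (hβ.mem φ)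
  have hdt : Continuous fun φ => (angularSpeed J K₁ K₂ φ ε (β φ))⁻¹ :=
    hωc.inv₀ fun φ => (hω0 φ).ne'
  set τ : ℝ → ℝ := fun φ => ∫ x in (0 : ℝ)..φ, (angularSpeed J K₁ K₂ x ε (β x))⁻¹
  have hτ : ∀ φ, HasDerivAt τ (angularSpeed J K₁ K₂ φ ε (β φ))⁻¹ φ := fun φ =>
    (hdt.integral_hasStrictDerivAt 0 φ).hasDerivAt
  obtain ⟨ψ, T, hT, -, -, hψτ, hψT, hψ⟩ := exists_periodic_inverse Real.two_pi_pos hτ hdt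
    (fun φ => by rw [hβ.periodic φ, angularSpeed_periodic J K₁ K₂ φ]) fun φ => inv_pos.2 (hω0 φ)
  refine ⟨fun t => polarPoint (β (ψ t)) (ψ t), T, hT, fun t => ?_, fun t => ?_,
    ⟨τ (ψ 0 + Real.pi), ?_⟩, ?_⟩
  · have hcurve := hasDerivAt_polarPoint_comp (hs (hβ.mem (ψ t))).ne' (hω0 _).ne'
      (hβ.hasDerivAt (ψ t))
    refine (hcurve.scomp t (hψ t)).congr_deriv ?_
    rw [inv_inv, smul_inv_smul₀ (hω0 _).ne']
  · simp only [hψT, hβ.periodic (ψ t), polarPoint_periodic _ (ψ t)]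
  · simp only [hψτ]
    exact polarPoint_add_pi_ne (hs (hβ.mem _)) (hs (hβ.mem _)) _
  · exact (Function.LeftInverse.surjective hψτ).range_comp (fun φ => polarPoint (β φ) φ) |>.symm

lemma exists_isPeriodicSolution_of_isPeriodicOrbit {C : Set (ℝ × ℝ)} {s : Set ℝ} (hs : s ⊆ Ioi 0)
    (hJ : ContinuousOn J (polarRadius ⁻¹' s)) (hK₁ : ContinuousOn K₁ (polarRadius ⁻¹' s))
    (hK₂ : ContinuousOn K₂ (polarRadius ⁻¹' s))
    (hω : ∀ φ, ∀ ρ ∈ s, 0 < angularSpeed J K₁ K₂ φ ε ρ)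
    (hC : IsPeriodicOrbit (rotationField J K₁ K₂ ε) C) (hCs : C ⊆ polarRadius ⁻¹' s) :
    ∃ (k : ℕ) (α : ℝ → ℝ), 0 < k ∧
      IsPeriodicSolution (fun φ ρ => ε * radialSlope J K₁ K₂ φ ε ρ) (k * (2 * Real.pi)) s α ∧
      C = range fun φ => polarPoint (α φ) φ := by
  obtain ⟨γ, T, hT, hγ, hγT, -, rfl⟩ := hC
  have hmem : ∀ t, polarRadius (γ t) ∈ s := fun t => hCs ⟨t, rfl⟩
  have hγc : Continuous γ := continuous_iff_continuousAt.2 fun t => (hγ t).continuousAt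
  have hX : ContinuousOn (rotationField J K₁ K₂ ε) (polarRadius ⁻¹' s) := by
    unfold rotationField
    fun_prop
  have hXγ : Continuous fun t => rotationField J K₁ K₂ ε (γ t) := hX.comp_continuous hγc hmem
  have hradius0 : ∀ t, 0 < polarRadius (γ t) := fun t => hs (hmem t)
  obtain ⟨ρ, φ, hρ0, hpolar, hρ, hφ⟩ := exists_polar_lift hγ hXγ
    fun t h => (hradius0 t).ne' (by simp [h, polarRadius])
  have hradius : ∀ t, polarRadius (γ t) = ρ t := fun t => by
    rw [hpolar, polarRadius_polarPoint (hρ0 t).le]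
  have hρs : ∀ t, ρ t ∈ s := fun t => hradius t ▸ hmem t
  have hρT : Function.Periodic ρ T := fun t => by rw [← hradius, hγT, hradius]
  set Ω : ℝ → ℝ := fun t => angularSpeed J K₁ K₂ (φ t) ε (ρ t)
  have hΩ0 : ∀ t, 0 < Ω t := fun t => hω _ _ (hρs t)
  have hΩ : Ω = fun t => ((γ t).2 * (rotationField J K₁ K₂ ε (γ t)).1 -
      (γ t).1 * (rotationField J K₁ K₂ ε (γ t)).2) / polarRadius (γ t) ^ 2 := by
    ext t
    rw [hpolar]
    exact angularSpeed_eq_div (hρ0 t) (φ t)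
  obtain ⟨ψ, Φ, hΦ, hφT, hφψ, hψφ, hψΦ, hψ⟩ := exists_periodic_inverse (Ω := Ω) hT
    (fun t => by simpa only [hpolar, ← angularSpeed_mul (hρ0 _).ne',
      mul_div_cancel_left₀ _ (hρ0 _).ne'] using hφ t)
    (hΩ ▸ ((hγc.snd.mul hXγ.fst).sub (hγc.fst.mul hXγ.snd)).div
      ((continuous_polarRadius.comp hγc).pow 2) fun t => (pow_pos (hradius0 t) 2).ne')
    (fun t => by simp only [hΩ, hγT t]) hΩ0
  obtain ⟨k, hk, rfl⟩ := exists_eq_natCast_mul_two_pi (φ := φ 0) (hρ0 0).ne' hΦ (by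
    rw [← hφT, ← hρT, ← hpolar, hγT, hpolar, hρT])
  refine ⟨k, fun x => ρ (ψ x), hk, ⟨fun x => by simp only [hψΦ, hρT (ψ x)], fun x => hρs _,
    fun x => ?_⟩, ?_⟩
  · refine ((hρ (ψ x)).scomp x (hψ x)).congr_deriv ?_
    rw [hpolar, ← radialSlope_mul_angularSpeed (hΩ0 (ψ x)).ne', smul_eq_mul, mul_comm,
      mul_inv_cancel_right₀ (hΩ0 (ψ x)).ne', hφψ]
  · rw [← (Function.LeftInverse.surjective hψφ).range_comp γ]
    simp [hφψ, hpolar, Function.comp_def]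

end RotationField

lemma hasDerivAt_deriv_of_contDiffOn_uncurried {g : ℝ → ℝ → ℝ → ℝ} {U : Set (ℝ × ℝ × ℝ)}
    (hU : IsOpen U) (hg : ContDiffOn ℝ 1 (fun p : ℝ × ℝ × ℝ => g p.1 p.2.1 p.2.2) U) {φ ε x : ℝ}
    (h : (φ, ε, x) ∈ U) : HasDerivAt (g φ ε) (deriv (g φ ε) x) x := by
  have hdiff := (hg.contDiffAt (hU.mem_nhds h)).differentiableAt one_ne_zero
  exact (DifferentiableAt.comp (f := fun y : ℝ => ((φ, ε, y) : ℝ × ℝ × ℝ)) x hdiff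
    (by fun_prop)).hasDerivAt

lemma continuousOn_deriv_of_contDiffOn_uncurried {g : ℝ → ℝ → ℝ → ℝ} {U : Set (ℝ × ℝ × ℝ)}
    (hU : IsOpen U) (hg : ContDiffOn ℝ 1 (fun p : ℝ × ℝ × ℝ => g p.1 p.2.1 p.2.2) U) :
    ContinuousOn (fun p : ℝ × ℝ × ℝ => deriv (g p.1 p.2.1) p.2.2) U := by
  refine ((hg.continuousOn_fderiv_of_isOpen hU le_rfl).clm_apply
    (continuousOn_const (c := ((0, 0, 1) : ℝ × ℝ × ℝ)))).congr fun p hp => ?_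
  have hline : HasDerivAt (fun y : ℝ => ((p.1, p.2.1, y) : ℝ × ℝ × ℝ)) (0, 0, 1) p.2.2 :=
    (hasDerivAt_const _ _).prodMk ((hasDerivAt_const _ _).prodMk (hasDerivAt_id _))
  have hdiff := (hg.contDiffAt (hU.mem_nhds hp)).differentiableAt one_ne_zero
  exact (hdiff.hasFDerivAt.comp_hasDerivAt (f := fun y : ℝ => ((p.1, p.2.1, y) : ℝ × ℝ × ℝ))
    p.2.2 hline).deriv

section RotationField

variable {J K₁ K₂ : ℝ × ℝ → ℝ} {s I : Set ℝ}

lemma contDiffOn_comp_polarPoint {F : ℝ × ℝ → ℝ} (hs0 : s ⊆ Ioi 0)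
    (hF : ContDiffOn ℝ 1 F (polarRadius ⁻¹' s)) :
    ContDiffOn ℝ 1 (fun p : ℝ × ℝ × ℝ => F (polarPoint p.2.2 p.1)) {p | p.2.2 ∈ s} := by
  have hpolar : ContDiff ℝ 1 fun p : ℝ × ℝ × ℝ => polarPoint p.2.2 p.1 := by
    unfold polarPoint
    fun_prop
  refine hF.comp hpolar.contDiffOn fun p hp => ?_
  rwa [mem_preimage, polarRadius_polarPoint (hs0 hp).le]

lemma contDiffOn_angularSpeed (hs0 : s ⊆ Ioi 0) (hJ : ContDiffOn ℝ 1 J (polarRadius ⁻¹' s))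
    (hK₁ : ContDiffOn ℝ 1 K₁ (polarRadius ⁻¹' s)) (hK₂ : ContDiffOn ℝ 1 K₂ (polarRadius ⁻¹' s)) :
    ContDiffOn ℝ 1 (fun p : ℝ × ℝ × ℝ => angularSpeed J K₁ K₂ p.1 p.2.1 p.2.2)
      {p | p.2.2 ∈ s} := by
  have hdiv : ContDiffOn ℝ 1 (fun p : ℝ × ℝ × ℝ => p.2.1 / p.2.2) {p | p.2.2 ∈ s} :=
    ContDiffOn.div (by fun_prop) (by fun_prop) fun p hp => (hs0 hp).ne'
  have hcos : ContDiff ℝ 1 fun p : ℝ × ℝ × ℝ => Real.cos p.1 := by fun_prop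
  have hsin : ContDiff ℝ 1 fun p : ℝ × ℝ × ℝ => Real.sin p.1 := by fun_prop
  exact (contDiffOn_comp_polarPoint hs0 hJ).add
    (hdiv.mul ((hcos.contDiffOn.mul (contDiffOn_comp_polarPoint hs0 hK₁)).sub
      (hsin.contDiffOn.mul (contDiffOn_comp_polarPoint hs0 hK₂))))

lemma isOpen_angularSpeed_ne_zero (hs : IsOpen s) (hs0 : s ⊆ Ioi 0)
    (hJ : ContDiffOn ℝ 1 J (polarRadius ⁻¹' s)) (hK₁ : ContDiffOn ℝ 1 K₁ (polarRadius ⁻¹' s))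
    (hK₂ : ContDiffOn ℝ 1 K₂ (polarRadius ⁻¹' s)) :
    IsOpen ({p : ℝ × ℝ × ℝ | p.2.2 ∈ s} ∩ {p | angularSpeed J K₁ K₂ p.1 p.2.1 p.2.2 ≠ 0}) :=
  (contDiffOn_angularSpeed hs0 hJ hK₁ hK₂).continuousOn.isOpen_inter_preimage
    (hs.preimage (by fun_prop)) isOpen_ne

lemma contDiffOn_radialSlope (hs0 : s ⊆ Ioi 0) (hJ : ContDiffOn ℝ 1 J (polarRadius ⁻¹' s))
    (hK₁ : ContDiffOn ℝ 1 K₁ (polarRadius ⁻¹' s)) (hK₂ : ContDiffOn ℝ 1 K₂ (polarRadius ⁻¹' s)) :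
    ContDiffOn ℝ 1 (fun p : ℝ × ℝ × ℝ => radialSlope J K₁ K₂ p.1 p.2.1 p.2.2)
      ({p | p.2.2 ∈ s} ∩ {p | angularSpeed J K₁ K₂ p.1 p.2.1 p.2.2 ≠ 0}) := by
  have hcos : ContDiff ℝ 1 fun p : ℝ × ℝ × ℝ => Real.cos p.1 := by fun_prop
  have hsin : ContDiff ℝ 1 fun p : ℝ × ℝ × ℝ => Real.sin p.1 := by fun_prop
  exact (((hsin.contDiffOn.mul (contDiffOn_comp_polarPoint hs0 hK₁)).add
    (hcos.contDiffOn.mul (contDiffOn_comp_polarPoint hs0 hK₂))).mono inter_subset_left).div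
    ((contDiffOn_angularSpeed hs0 hJ hK₁ hK₂).mono inter_subset_left) fun p hp => hp.2

lemma angularSpeed_zero_pos (hs0 : s ⊆ Ioi 0) (hJ0 : ∀ z ∈ polarRadius ⁻¹' s, 0 < J z) {ρ : ℝ}
    (hρ : ρ ∈ s) (φ : ℝ) : 0 < angularSpeed J K₁ K₂ φ 0 ρ := by
  simp only [angularSpeed, zero_div, zero_mul, add_zero]
  refine hJ0 _ ?_
  rwa [mem_preimage, polarRadius_polarPoint (hs0 hρ).le]

lemma eventually_forall_angularSpeed_pos (hs : IsOpen s) (hs0 : s ⊆ Ioi 0)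
    (hJ : ContDiffOn ℝ 1 J (polarRadius ⁻¹' s)) (hK₁ : ContDiffOn ℝ 1 K₁ (polarRadius ⁻¹' s))
    (hK₂ : ContDiffOn ℝ 1 K₂ (polarRadius ⁻¹' s)) (hJ0 : ∀ z ∈ polarRadius ⁻¹' s, 0 < J z)
    (hI : IsCompact I) (hIs : I ⊆ s) :
    ∀ᶠ ε in 𝓝 (0 : ℝ), ∀ φ, ∀ ρ ∈ I, 0 < angularSpeed J K₁ K₂ φ ε ρ := by
  have hcont := (contDiffOn_angularSpeed hs0 hJ hK₁ hK₂).continuousOn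
  have hnear : ∀ᶠ ε in 𝓝 (0 : ℝ), ∀ p ∈ Icc 0 (2 * Real.pi) ×ˢ I,
      0 < angularSpeed J K₁ K₂ p.1 ε p.2 := by
    refine (isCompact_Icc.prod hI).eventually_forall_of_forall_eventually fun p hp => ?_
    have hat := hcont.continuousAt (x := (p.1, 0, p.2))
      ((hs.preimage (f := fun p : ℝ × ℝ × ℝ => p.2.2) (by fun_prop)).mem_nhds (hIs hp.2))
    exact (hat.comp_of_eq (f := fun q : ℝ × ℝ × ℝ => ((q.2.1, q.1, q.2.2) : ℝ × ℝ × ℝ))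
      (y := (p.1, 0, p.2)) (x := (0, p)) (by fun_prop) rfl).eventually
        (lt_mem_nhds (angularSpeed_zero_pos hs0 hJ0 (hIs hp.2) p.1))
  filter_upwards [hnear] with ε hε φ ρ hρ
  obtain ⟨φ', hφ', h⟩ := (angularSpeed_periodic J K₁ K₂).exists_mem_Ico₀ Real.two_pi_pos φ
  rw [h]
  exact hε (φ', ρ) ⟨Ico_subset_Icc_self hφ', hρ⟩

lemma hasDerivAt_radialAverage {ρ₀ : ℝ} (hs : IsOpen s) (hs0 : s ⊆ Ioi 0)
    (hJ : ContDiffOn ℝ 1 J (polarRadius ⁻¹' s)) (hK₁ : ContDiffOn ℝ 1 K₁ (polarRadius ⁻¹' s))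
    (hK₂ : ContDiffOn ℝ 1 K₂ (polarRadius ⁻¹' s)) (hJ0 : ∀ z ∈ polarRadius ⁻¹' s, 0 < J z)
    (hρ₀ : ρ₀ ∈ s) :
    HasDerivAt (radialAverage J K₁ K₂)
      (∫ φ in (0 : ℝ)..2 * Real.pi, deriv (radialSlope J K₁ K₂ φ 0) ρ₀) ρ₀ := by
  obtain ⟨r, hr, hrs⟩ := Metric.nhds_basis_closedBall.mem_iff.1 (hs.mem_nhds hρ₀)
  rw [Real.closedBall_eq_Icc] at hrs
  have hV := isOpen_angularSpeed_ne_zero hs hs0 hJ hK₁ hK₂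
  have hslope := contDiffOn_radialSlope hs0 hJ hK₁ hK₂
  have hmem : ∀ φ, ∀ ρ ∈ Icc (ρ₀ - r) (ρ₀ + r), ((φ, 0, ρ) : ℝ × ℝ × ℝ) ∈
      {p | p.2.2 ∈ s} ∩ {p | angularSpeed J K₁ K₂ p.1 p.2.1 p.2.2 ≠ 0} := fun φ ρ hρ =>
    ⟨hrs hρ, (angularSpeed_zero_pos hs0 hJ0 (hrs hρ) φ).ne'⟩
  refine hasDerivAt_intervalIntegral_param (F := fun φ => radialSlope J K₁ K₂ φ 0)
    (F' := fun φ ρ => deriv (radialSlope J K₁ K₂ φ 0) ρ) hr (fun ρ hρ => ?_) ?_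
    fun φ ρ hρ => hasDerivAt_deriv_of_contDiffOn_uncurried hV hslope (hmem φ ρ hρ)
  · exact hslope.continuousOn.comp_continuous (f := fun φ => (φ, 0, ρ)) (by fun_prop)
      fun φ => hmem φ ρ hρ
  · exact (continuousOn_deriv_of_contDiffOn_uncurried hV hslope).comp
      (f := fun p : ℝ × ℝ => ((p.1, 0, p.2) : ℝ × ℝ × ℝ)) (by fun_prop)
      fun p hp => hmem p.1 p.2 hp.2

lemma exists_unique_isPeriodicSolution_radialSlope {ρ₀ D : ℝ} (hs : IsOpen s) (hs0 : s ⊆ Ioi 0)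
    (hJ : ContDiffOn ℝ 1 J (polarRadius ⁻¹' s)) (hK₁ : ContDiffOn ℝ 1 K₁ (polarRadius ⁻¹' s))
    (hK₂ : ContDiffOn ℝ 1 K₂ (polarRadius ⁻¹' s)) (hJ0 : ∀ z ∈ polarRadius ⁻¹' s, 0 < J z)
    (hρ₀ : ρ₀ ∈ s) (hz : radialAverage J K₁ K₂ ρ₀ = 0)
    (hD : HasDerivAt (radialAverage J K₁ K₂) D ρ₀) (hD0 : D ≠ 0) :
    ∃ t ⊆ s, IsOpen t ∧ ∀ᶠ ε in 𝓝[>] (0 : ℝ), (∀ φ, ∀ ρ ∈ t, 0 < angularSpeed J K₁ K₂ φ ε ρ) ∧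
      ∃ β, IsPeriodicSolution (fun φ ρ => ε * radialSlope J K₁ K₂ φ ε ρ) (2 * Real.pi) t β ∧
        ∀ k : ℕ, 0 < k → ∀ α, IsPeriodicSolution (fun φ ρ => ε * radialSlope J K₁ K₂ φ ε ρ)
          (k * (2 * Real.pi)) t α → α = β := by
  obtain ⟨r₀, hr₀, hr₀s⟩ := Metric.nhds_basis_closedBall.mem_iff.1 (hs.mem_nhds hρ₀)
  rw [Real.closedBall_eq_Icc] at hr₀s
  have hω := eventually_forall_angularSpeed_pos hs hs0 hJ hK₁ hK₂ hJ0 isCompact_Icc hr₀s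
  obtain ⟨e₀, he₀, hωe₀⟩ := Metric.nhds_basis_closedBall.eventually_iff.1 hω
  have hωpos : ∀ φ, ∀ ε ∈ Icc 0 e₀, ∀ ρ ∈ Icc (ρ₀ - r₀) (ρ₀ + r₀),
      0 < angularSpeed J K₁ K₂ φ ε ρ := fun φ ε hε => hωe₀ (by
    rw [Real.closedBall_eq_Icc]
    exact ⟨by linarith [hε.1], by linarith [hε.2]⟩) φ
  have hV := isOpen_angularSpeed_ne_zero hs hs0 hJ hK₁ hK₂
  have hslope := contDiffOn_radialSlope hs0 hJ hK₁ hK₂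
  have hsub : univ ×ˢ Icc 0 e₀ ×ˢ Icc (ρ₀ - r₀) (ρ₀ + r₀) ⊆
      {p | p.2.2 ∈ s} ∩ {p | angularSpeed J K₁ K₂ p.1 p.2.1 p.2.2 ≠ 0} := fun p hp =>
    ⟨hr₀s hp.2.2, (hωpos p.1 p.2.1 hp.2.1 p.2.2 hp.2.2).ne'⟩
  have hDeq := (hasDerivAt_radialAverage hs hs0 hJ hK₁ hK₂ hJ0 hρ₀).unique hD
  obtain ⟨r, hr, hcycle⟩ := exists_unique_isPeriodicSolution Real.two_pi_pos
    (radialSlope_periodic J K₁ K₂) (g' := fun φ ε => deriv (radialSlope J K₁ K₂ φ ε))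
    (fun φ => by simp only [radialSlope_periodic J K₁ K₂ φ]) he₀ hr₀
    (hslope.continuousOn.mono hsub)
    ((continuousOn_deriv_of_contDiffOn_uncurried hV hslope).mono hsub)
    (fun φ ε hε ρ hρ =>
      hasDerivAt_deriv_of_contDiffOn_uncurried hV hslope (hsub ⟨mem_univ _, hε, hρ⟩))
    hz (hDeq ▸ hD0)
  have hrI : Ioo (ρ₀ - r) (ρ₀ + r) ⊆ Icc (ρ₀ - r₀) (ρ₀ + r₀) :=
    Ioo_subset_Icc_self.trans (Icc_subset_Icc (by linarith [hr.2]) (by linarith [hr.2]))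
  refine ⟨_, hrI.trans hr₀s, isOpen_Ioo, ?_⟩
  filter_upwards [hcycle, Ioo_mem_nhdsGT he₀] with ε hβ hε
  exact ⟨fun φ ρ hρ => hωpos φ ε (Ioo_subset_Icc_self hε) ρ (hrI hρ), hβ⟩

theorem eventually_exists_isLimitCycle {ρ₀ D : ℝ} (hs : IsOpen s) (hs0 : s ⊆ Ioi 0)
    (hJ : ContDiffOn ℝ 1 J (polarRadius ⁻¹' s)) (hK₁ : ContDiffOn ℝ 1 K₁ (polarRadius ⁻¹' s))
    (hK₂ : ContDiffOn ℝ 1 K₂ (polarRadius ⁻¹' s)) (hJ0 : ∀ z ∈ polarRadius ⁻¹' s, 0 < J z)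
    (hρ₀ : ρ₀ ∈ s) (hz : radialAverage J K₁ K₂ ρ₀ = 0)
    (hD : HasDerivAt (radialAverage J K₁ K₂) D ρ₀) (hD0 : D ≠ 0) :
    ∀ᶠ ε in 𝓝[>] (0 : ℝ), ∃ C ⊆ polarRadius ⁻¹' s, IsLimitCycle (rotationField J K₁ K₂ ε) C := by
  obtain ⟨t, hts, ht, hcycle⟩ :=
    exists_unique_isPeriodicSolution_radialSlope hs hs0 hJ hK₁ hK₂ hJ0 hρ₀ hz hD hD0
  have hU : polarRadius ⁻¹' t ⊆ polarRadius ⁻¹' s := preimage_mono hts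
  filter_upwards [hcycle] with ε ⟨hω, β, hβ, hunique⟩
  have horbit := hβ.isPeriodicOrbit (hts.trans hs0) hω
    ((contDiffOn_angularSpeed hs0 hJ hK₁ hK₂).continuousOn.comp_continuous
      (f := fun φ => (φ, ε, β φ)) (by have := hβ.continuous; fun_prop) fun φ => hts (hβ.mem φ))
  have hmem : range (fun φ => polarPoint (β φ) φ) ⊆ polarRadius ⁻¹' t := by
    rintro _ ⟨φ, rfl⟩
    rw [mem_preimage, polarRadius_polarPoint (hs0 (hts (hβ.mem φ))).le]
    exact hβ.mem φ
  refine ⟨_, hmem.trans hU, horbit, _, ht.preimage continuous_polarRadius, hmem,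
    fun C' hC' hC't => ?_⟩
  obtain ⟨k, α, hk, hα, rfl⟩ := exists_isPeriodicSolution_of_isPeriodicOrbit (hts.trans hs0)
    (hJ.continuousOn.mono hU) (hK₁.continuousOn.mono hU) (hK₂.continuousOn.mono hU) hω hC' hC't
  rw [hunique k hk α hα]

end RotationField

/-! ### Images of limit cycles -/

lemma IsPeriodicOrbit.image {X Z Θ Ψ : ℝ × ℝ → ℝ × ℝ} {C : Set (ℝ × ℝ)}
    (hC : IsPeriodicOrbit Z C)
    (hΘ : ∀ z ∈ C, ∃ L : ℝ × ℝ →L[ℝ] ℝ × ℝ, HasFDerivAt Θ L z ∧ L (Z z) = X (Θ z))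
    (hΨ : LeftInvOn Ψ Θ C) : IsPeriodicOrbit X (Θ '' C) := by
  obtain ⟨γ, T, hT, hγ, hper, ⟨t, ht⟩, rfl⟩ := hC
  refine ⟨Θ ∘ γ, T, hT, fun t => ?_, fun t => congrArg Θ (hper t),
    ⟨t, hΨ.injOn.ne ⟨t, rfl⟩ ⟨0, rfl⟩ ht⟩, (range_comp Θ γ).symm⟩
  obtain ⟨L, hL, hX⟩ := hΘ (γ t) ⟨t, rfl⟩
  exact hX ▸ hL.comp_hasDerivAt t (hγ t)

section Image

variable {X Z Θ Ψ : ℝ × ℝ → ℝ × ℝ} {D O C : Set (ℝ × ℝ)}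

lemma exists_hasFDerivAt_intertwining (hO : IsOpen O) (hΘO : MapsTo Θ D O) (hΨΘ : LeftInvOn Ψ Θ D)
    (hΘΨ : LeftInvOn Θ Ψ O) (hΘ : ∀ z ∈ D, DifferentiableAt ℝ Θ z)
    (hΨ : ∀ x ∈ O, ∃ L : ℝ × ℝ →L[ℝ] ℝ × ℝ, HasFDerivAt Ψ L x ∧ L (X x) = Z (Ψ x)) {z : ℝ × ℝ}
    (hz : z ∈ D) : ∃ L : ℝ × ℝ →L[ℝ] ℝ × ℝ, HasFDerivAt Θ L z ∧ L (Z z) = X (Θ z) := by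
  obtain ⟨L, hL, hX⟩ := hΨ (Θ z) (hΘO hz)
  refine ⟨fderiv ℝ Θ z, (hΘ z hz).hasFDerivAt, ?_⟩
  have hcomp : HasFDerivAt (Θ ∘ Ψ) ((fderiv ℝ Θ z).comp L) (Θ z) :=
    HasFDerivAt.comp (Θ z) ((hΨΘ hz).symm ▸ (hΘ z hz).hasFDerivAt) hL
  have hid : HasFDerivAt (Θ ∘ Ψ) (ContinuousLinearMap.id ℝ (ℝ × ℝ)) (Θ z) :=
    (hasFDerivAt_id (Θ z)).congr_of_eventuallyEq (mem_of_superset (hO.mem_nhds (hΘO hz)) hΘΨ)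
  rw [← hΨΘ hz, ← hX, hΨΘ hz]
  exact DFunLike.congr_fun (hcomp.unique hid) (X (Θ z))

lemma IsLimitCycle.image (hC : IsLimitCycle Z C) (hCD : C ⊆ D) (hO : IsOpen O)
    (hΘO : MapsTo Θ D O) (hΨΘ : LeftInvOn Ψ Θ D) (hΘΨ : LeftInvOn Θ Ψ O)
    (hΘ : ∀ z ∈ D, DifferentiableAt ℝ Θ z)
    (hΨ : ∀ x ∈ O, ∃ L : ℝ × ℝ →L[ℝ] ℝ × ℝ, HasFDerivAt Ψ L x ∧ L (X x) = Z (Ψ x)) :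
    IsLimitCycle X (Θ '' C) := by
  obtain ⟨horbit, U, hU, hCU, hunique⟩ := hC
  have hΨc : ContinuousOn Ψ O := fun x hx => by
    obtain ⟨L, hL, -⟩ := hΨ x hx
    exact hL.continuousAt.continuousWithinAt
  refine ⟨horbit.image (fun z hz => exists_hasFDerivAt_intertwining hO hΘO hΨΘ hΘΨ hΘ hΨ (hCD hz))
    (hΨΘ.mono hCD), O ∩ Ψ ⁻¹' U, hΨc.isOpen_inter_preimage hO hU, ?_, fun C' hC' hC'U => ?_⟩
  · rintro _ ⟨z, hz, rfl⟩
    refine ⟨hΘO (hCD hz), ?_⟩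
    rw [mem_preimage, hΨΘ (hCD hz)]
    exact hCU hz
  · have hC'O : C' ⊆ O := hC'U.trans inter_subset_left
    have hpull : IsPeriodicOrbit Z (Ψ '' C') :=
      hC'.image (fun x hx => hΨ x (hC'O hx)) (hΘΨ.mono hC'O)
    rw [← hunique _ hpull (image_subset_iff.2 (hC'U.trans inter_subset_right)),
      (hΘΨ.mono hC'O).image_image]

end Image

/-! ### The Hamiltonian in the coordinates `t = x / y`, `W = y²`

With `u = 1 - l t²`, `C = 1 + 2 h t - n t²` and `b = u² + 4 t² C` the Hamiltonian satisfies
`8 H + 1 = b W² - 2 u W + 1 = S(t)² + V²`, `S = 2 t √C / √b`, `V = (b W - u) / √b`. -/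

/-- The polynomial `u` for which `W = u / b` on the axis `V = 0`. -/
def axisPoly (l t : ℝ) : ℝ := 1 - l * t ^ 2

/-- The polynomial `C` in the discriminant `u² - b = -4 t² C` of the Hamiltonian. -/
def crossPoly (h n t : ℝ) : ℝ := 1 + 2 * h * t - n * t ^ 2

/-- The coefficient `b` of `W²` in `8 H`. -/
def leadPoly (h l n t : ℝ) : ℝ := axisPoly l t ^ 2 + 4 * t ^ 2 * crossPoly h n t

/-- The polynomial factor of `dS/dt`, which is positive near `t = 0`; it equals
`(4 l t b + u b') / (4 t)`. -/
def slopePoly (h l n t : ℝ) : ℝ :=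
  2 * (1 + 3 * h * t + (l - 2 * n) * t ^ 2 + l * h * t ^ 3)

/-- The coordinate `S`. -/
noncomputable def sCoord (h l n t : ℝ) : ℝ := 2 * t * √(crossPoly h n t) / √(leadPoly h l n t)

/-- The derivative of `sCoord`. -/
noncomputable def sCoordDeriv (h l n t : ℝ) : ℝ :=
  slopePoly h l n t * axisPoly l t /
    (√(crossPoly h n t) * leadPoly h l n t * √(leadPoly h l n t))

/-- The coordinate `V`. -/
noncomputable def vCoord (h l n t W : ℝ) : ℝ :=
  (leadPoly h l n t * W - axisPoly l t) / √(leadPoly h l n t)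

/-- The inverse of `vCoord` at fixed `t`. -/
noncomputable def wOfV (h l n t V : ℝ) : ℝ :=
  (V * √(leadPoly h l n t) + axisPoly l t) / leadPoly h l n t

/-- `∂b/∂t`. -/
def leadPolyDeriv (h l n t : ℝ) : ℝ :=
  2 * axisPoly l t * (-(2 * l * t)) + 8 * t * crossPoly h n t + 4 * t ^ 2 * (2 * h - 2 * n * t)

/-- `∂V/∂t` at fixed `W`. -/
noncomputable def vCoordDeriv (h l n t W : ℝ) : ℝ :=
  (leadPolyDeriv h l n t * W + 2 * l * t) / √(leadPoly h l n t) -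
    (leadPoly h l n t * W - axisPoly l t) * leadPolyDeriv h l n t /
      (2 * leadPoly h l n t * √(leadPoly h l n t))

section Coordinates

variable {h l n t W V : ℝ}

lemma leadPoly_pos (hC : 0 < crossPoly h n t) (hu : 0 < axisPoly l t) : 0 < leadPoly h l n t := by
  unfold leadPoly
  positivity

lemma slopePoly_identity (h l n t : ℝ) :
    4 * l * t * leadPoly h l n t + axisPoly l t * leadPolyDeriv h l n t =
      4 * t * slopePoly h l n t := by
  simp only [leadPolyDeriv, leadPoly, slopePoly, axisPoly, crossPoly]
  ring

lemma hasDerivAt_crossPoly (h n t : ℝ) : HasDerivAt (crossPoly h n) (2 * h - 2 * n * t) t := by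
  unfold crossPoly
  refine ((((hasDerivAt_id t).const_mul (2 * h)).const_add 1).sub
    (((hasDerivAt_id t).pow 2).const_mul n)).congr_deriv ?_
  simp
  ring

lemma hasDerivAt_axisPoly (l t : ℝ) : HasDerivAt (axisPoly l) (-(2 * l * t)) t := by
  unfold axisPoly
  refine ((((hasDerivAt_id t).pow 2).const_mul l).const_sub 1).congr_deriv ?_
  simp
  ring

lemma hasDerivAt_leadPoly (h l n t : ℝ) :
    HasDerivAt (leadPoly h l n) (leadPolyDeriv h l n t) t := by
  unfold leadPoly leadPolyDeriv
  refine (((hasDerivAt_axisPoly l t).pow 2).add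
    ((((hasDerivAt_id t).pow 2).const_mul 4).mul (hasDerivAt_crossPoly h n t))).congr_deriv ?_
  simp
  ring

lemma hasDerivAt_sCoord (hC : 0 < crossPoly h n t) (hu : 0 < axisPoly l t) :
    HasDerivAt (sCoord h l n) (sCoordDeriv h l n t) t := by
  have hb := leadPoly_pos (h := h) hC hu
  refine ((((hasDerivAt_id t).const_mul 2).mul ((hasDerivAt_crossPoly h n t).sqrt hC.ne')).div
    ((hasDerivAt_leadPoly h l n t).sqrt hb.ne') (Real.sqrt_pos.2 hb).ne').congr_deriv ?_
  have hc := Real.sq_sqrt hC.le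
  have hd : √(leadPoly h l n t) ^ 2 = axisPoly l t ^ 2 + 4 * t ^ 2 * crossPoly h n t :=
    Real.sq_sqrt hb.le
  have hd0 := Real.sqrt_pos.2 hb
  have := Real.sqrt_pos.2 hC
  simp only [sCoordDeriv, Pi.mul_apply, id]
  rw [← Real.sq_sqrt hb.le, Real.sqrt_sq hd0.le]
  field_simp
  rw [hc, hd]
  simp only [slopePoly, axisPoly, crossPoly, leadPolyDeriv]
  ring

lemma hasDerivAt_vCoord_left (hb : 0 < leadPoly h l n t) :
    HasDerivAt (fun t => vCoord h l n t W) (vCoordDeriv h l n t W) t := by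
  refine ((((hasDerivAt_leadPoly h l n t).mul_const W).sub (hasDerivAt_axisPoly l t)).div
    ((hasDerivAt_leadPoly h l n t).sqrt hb.ne') (Real.sqrt_pos.2 hb).ne').congr_deriv ?_
  have hd := Real.sqrt_pos.2 hb
  simp only [vCoordDeriv, Pi.sub_apply]
  rw [← Real.sq_sqrt hb.le, Real.sqrt_sq hd.le]
  field_simp
  ring

lemma hasDerivAt_vCoord_right (h l n t W : ℝ) :
    HasDerivAt (fun W => vCoord h l n t W) (√(leadPoly h l n t)) W := by
  refine ((((hasDerivAt_id W).const_mul (leadPoly h l n t)).sub_const (axisPoly l t)).div_const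
    (√(leadPoly h l n t))).congr_deriv ?_
  rw [mul_one, Real.div_sqrt]

lemma vCoord_wOfV (hb : 0 < leadPoly h l n t) : vCoord h l n t (wOfV h l n t V) = V := by
  have := Real.sqrt_pos.2 hb
  simp only [vCoord, wOfV]
  field_simp
  ring

lemma wOfV_vCoord (hb : 0 < leadPoly h l n t) : wOfV h l n t (vCoord h l n t W) = W := by
  have := Real.sqrt_pos.2 hb
  simp only [vCoord, wOfV]
  field_simp
  ring

lemma one_sub_sCoord_sq (hC : 0 < crossPoly h n t) (hu : 0 < axisPoly l t) :
    1 - sCoord h l n t ^ 2 = axisPoly l t ^ 2 / leadPoly h l n t := by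
  have hb := leadPoly_pos (h := h) hC hu
  rw [sCoord, div_pow, mul_pow, Real.sq_sqrt hC.le, Real.sq_sqrt hb.le]
  field_simp
  simp only [leadPoly]
  ring

lemma wOfV_pos (hC : 0 < crossPoly h n t) (hu : 0 < axisPoly l t)
    (hV : sCoord h l n t ^ 2 + V ^ 2 < 1) : 0 < wOfV h l n t V := by
  have hb := leadPoly_pos (h := h) hC hu
  have hsq : (V * √(leadPoly h l n t)) ^ 2 < axisPoly l t ^ 2 := by
    rw [mul_pow, Real.sq_sqrt hb.le, ← lt_div_iff₀ hb, ← one_sub_sCoord_sq hC hu]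
    linarith
  have habs := abs_lt.1 (abs_lt_of_sq_lt_sq hsq hu.le)
  exact div_pos (by linarith) hb

lemma contDiff_crossPoly (h n : ℝ) : ContDiff ℝ 1 (crossPoly h n) := by
  unfold crossPoly; fun_prop

lemma contDiff_axisPoly (l : ℝ) : ContDiff ℝ 1 (axisPoly l) := by
  unfold axisPoly; fun_prop

lemma contDiff_leadPoly (h l n : ℝ) : ContDiff ℝ 1 (leadPoly h l n) := by
  unfold leadPoly axisPoly crossPoly; fun_prop

lemma contDiff_leadPolyDeriv (h l n : ℝ) : ContDiff ℝ 1 (leadPolyDeriv h l n) := by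
  unfold leadPolyDeriv axisPoly crossPoly; fun_prop

lemma contDiff_slopePoly (h l n : ℝ) : ContDiff ℝ 1 (slopePoly h l n) := by
  unfold slopePoly; fun_prop

lemma contDiffAt_sqrt_leadPoly (hb : 0 < leadPoly h l n t) :
    ContDiffAt ℝ 1 (fun t => √(leadPoly h l n t)) t :=
  (contDiff_leadPoly h l n).contDiffAt.sqrt hb.ne'

lemma contDiffAt_sCoordDeriv (hC : 0 < crossPoly h n t) (hu : 0 < axisPoly l t) :
    ContDiffAt ℝ 1 (sCoordDeriv h l n) t := by
  have hb := leadPoly_pos (h := h) hC hu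
  have := Real.sqrt_pos.2 hC
  have := Real.sqrt_pos.2 hb
  exact ((contDiff_slopePoly h l n).contDiffAt.mul (contDiff_axisPoly l).contDiffAt).div
    ((((contDiff_crossPoly h n).contDiffAt.sqrt hC.ne').mul
      (contDiff_leadPoly h l n).contDiffAt).mul (contDiffAt_sqrt_leadPoly hb)) (by positivity)

lemma contDiffAt_wOfV (hb : 0 < leadPoly h l n t) :
    ContDiffAt ℝ 1 (fun z : ℝ × ℝ => wOfV h l n z.1 z.2) (t, V) :=
  ((contDiffAt_snd.mul ((contDiffAt_sqrt_leadPoly hb).fst')).add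
    ((contDiff_axisPoly l).contDiffAt.fst')).div
    ((contDiff_leadPoly h l n).contDiffAt.fst') hb.ne'

lemma contDiffAt_vCoord_numerator (h l n t W : ℝ) :
    ContDiffAt ℝ 1 (fun z : ℝ × ℝ => leadPoly h l n z.1 * z.2 - axisPoly l z.1) (t, W) :=
  ((contDiff_leadPoly h l n).contDiffAt.fst'.mul contDiffAt_snd).sub
    (contDiff_axisPoly l).contDiffAt.fst'

lemma contDiffAt_vCoord (hb : 0 < leadPoly h l n t) :
    ContDiffAt ℝ 1 (fun z : ℝ × ℝ => vCoord h l n z.1 z.2) (t, W) :=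
  (contDiffAt_vCoord_numerator h l n t W).div
    ((contDiffAt_sqrt_leadPoly hb).fst') (Real.sqrt_pos.2 hb).ne'

lemma contDiffAt_vCoordDeriv (hb : 0 < leadPoly h l n t) :
    ContDiffAt ℝ 1 (fun z : ℝ × ℝ => vCoordDeriv h l n z.1 z.2) (t, W) := by
  have hd := Real.sqrt_pos.2 hb
  have hb' : ContDiffAt ℝ 1 (fun z : ℝ × ℝ => leadPolyDeriv h l n z.1) (t, W) :=
    (contDiff_leadPolyDeriv h l n).contDiffAt.fst'
  have hroot : ContDiffAt ℝ 1 (fun z : ℝ × ℝ => √(leadPoly h l n z.1)) (t, W) :=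
    (contDiffAt_sqrt_leadPoly hb).fst'
  have hlead : ContDiffAt ℝ 1 (fun z : ℝ × ℝ => leadPoly h l n z.1) (t, W) :=
    (contDiff_leadPoly h l n).contDiffAt.fst'
  exact (((hb'.mul contDiffAt_snd).add (contDiffAt_const.mul contDiffAt_fst)).div hroot hd.ne').sub
    (((contDiffAt_vCoord_numerator h l n t W).mul hb').div
      ((contDiffAt_const.mul hlead).mul hroot) (by positivity))

end Coordinates

lemma hasFDerivAt_of_partial {F : ℝ × ℝ → ℝ} {x y a b : ℝ} (hF : DifferentiableAt ℝ F (x, y))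
    (ha : HasDerivAt (fun x => F (x, y)) a x) (hb : HasDerivAt (fun y => F (x, y)) b y) :
    HasFDerivAt F (a • ContinuousLinearMap.fst ℝ ℝ ℝ + b • ContinuousLinearMap.snd ℝ ℝ ℝ)
      (x, y) := by
  have ha' := hF.hasFDerivAt.comp_hasDerivAt (f := fun x' : ℝ => (x', y)) x
    ((hasDerivAt_id x).prodMk (hasDerivAt_const x y))
  have hb' := hF.hasFDerivAt.comp_hasDerivAt (f := fun y' : ℝ => (x, y')) y
    ((hasDerivAt_const y x).prodMk (hasDerivAt_id y))
  convert hF.hasFDerivAt using 1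
  ext
  · simp [← ha'.unique ha]
  · simp [← hb'.unique hb]

/-- A local inverse `T` of `sCoord`, defined for `|s| < R` with values in `|t| < τ`. -/
structure IsChart (h l n : ℝ) (T : ℝ → ℝ) (τ R : ℝ) : Prop where
  pos : ∀ t, |t| < τ → 0 < crossPoly h n t ∧ 0 < axisPoly l t ∧ 0 < slopePoly h l n t
  lt_one : R < 1
  mem : ∀ s, |s| < R → |T s| < τ
  right_inv : ∀ s, |s| < R → sCoord h l n (T s) = s
  left_inv : ∀ t, |t| < τ → |sCoord h l n t| < R → T (sCoord h l n t) = t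
  contDiffAt : ∀ s, |s| < R → ContDiffAt ℝ 1 T s

/-- The change of coordinates `(t, W) ↦ (S, V)`. -/
noncomputable def svCoord (h l n : ℝ) (z : ℝ × ℝ) : ℝ × ℝ :=
  (sCoord h l n z.1, vCoord h l n z.1 z.2)

/-- The change of coordinates `(S, V) ↦ (t, W)` given by a chart `T`. -/
noncomputable def twCoord (h l n : ℝ) (T : ℝ → ℝ) (z : ℝ × ℝ) : ℝ × ℝ :=
  (T z.1, wOfV h l n (T z.1) z.2)

/-- The perturbed system in the coordinates `(t, W)`: the perturbation is
`(A₁ + W A₃, 2 (W Q₁ + W² Q₃))`. -/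
noncomputable def twField (h l n : ℝ) (A₁ A₃ Q₁ Q₃ : ℝ → ℝ) (ε : ℝ) (z : ℝ × ℝ) : ℝ × ℝ :=
  ((leadPoly h l n z.1 * z.2 - axisPoly l z.1) / 2 + ε * (A₁ z.1 + z.2 * A₃ z.1),
    -(leadPolyDeriv h l n z.1 * z.2 ^ 2 + 4 * l * z.1 * z.2) / 4 +
      ε * (2 * (z.2 * Q₁ z.1 + z.2 ^ 2 * Q₃ z.1)))

/-- The rotation speed of the unperturbed system in the coordinates `(S, V)`. -/
noncomputable def chartJ (h l n : ℝ) (T : ℝ → ℝ) (z : ℝ × ℝ) : ℝ :=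
  sCoordDeriv h l n (T z.1) * √(leadPoly h l n (T z.1)) / 2

/-- The `S`-component of the perturbation in `twField`, in the coordinates `(S, V)`. -/
noncomputable def chartK₁ (h l n : ℝ) (T A₁ A₃ : ℝ → ℝ) (z : ℝ × ℝ) : ℝ :=
  sCoordDeriv h l n (T z.1) * (A₁ (T z.1) + wOfV h l n (T z.1) z.2 * A₃ (T z.1))

/-- The `V`-component of the perturbation in `twField`, in the coordinates `(S, V)`. -/
noncomputable def chartK₂ (h l n : ℝ) (T A₁ A₃ Q₁ Q₃ : ℝ → ℝ) (z : ℝ × ℝ) : ℝ :=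
  2 * √(leadPoly h l n (T z.1)) *
      (wOfV h l n (T z.1) z.2 * Q₁ (T z.1) + wOfV h l n (T z.1) z.2 ^ 2 * Q₃ (T z.1)) +
    vCoordDeriv h l n (T z.1) (wOfV h l n (T z.1) z.2) *
      (A₁ (T z.1) + wOfV h l n (T z.1) z.2 * A₃ (T z.1))

section Rotation

variable {h l n t W : ℝ}

lemma hasFDerivAt_svCoord (hC : 0 < crossPoly h n t) (hu : 0 < axisPoly l t) :
    HasFDerivAt (svCoord h l n)
      ((sCoordDeriv h l n t • ContinuousLinearMap.fst ℝ ℝ ℝ).prod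
        (vCoordDeriv h l n t W • ContinuousLinearMap.fst ℝ ℝ ℝ +
          √(leadPoly h l n t) • ContinuousLinearMap.snd ℝ ℝ ℝ)) (t, W) := by
  have hb := leadPoly_pos (h := h) hC hu
  have hs : HasFDerivAt (fun z : ℝ × ℝ => sCoord h l n z.1)
      (sCoordDeriv h l n t • ContinuousLinearMap.fst ℝ ℝ ℝ) (t, W) :=
    (hasDerivAt_sCoord hC hu).comp_hasFDerivAt (f := Prod.fst) (t, W) hasFDerivAt_fst
  exact hs.prodMk (hasFDerivAt_of_partial ((contDiffAt_vCoord hb).differentiableAt one_ne_zero)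
      (hasDerivAt_vCoord_left hb) (hasDerivAt_vCoord_right h l n t W))

-- Conservation of `S² + V²` along the unperturbed flow: `V' = -J S` follows from `S' = J V`.
lemma unperturbed_vCoord_speed (hC : 0 < crossPoly h n t) (hu : 0 < axisPoly l t) :
    vCoordDeriv h l n t W * ((leadPoly h l n t * W - axisPoly l t) / 2) +
        √(leadPoly h l n t) * (-(leadPolyDeriv h l n t * W ^ 2 + 4 * l * t * W) / 4) =
      -(sCoordDeriv h l n t * √(leadPoly h l n t) / 2 * sCoord h l n t) := by
  have hb := leadPoly_pos (h := h) hC hu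
  have hd := Real.sqrt_pos.2 hb
  have := Real.sqrt_pos.2 hC
  have hkey := slopePoly_identity h l n t
  simp only [vCoordDeriv, sCoordDeriv, sCoord]
  rw [← Real.sq_sqrt hb.le] at hkey
  rw [← Real.sq_sqrt hb.le, Real.sqrt_sq hd.le]
  field_simp
  linear_combination (-4 * axisPoly l t) * hkey

lemma svCoord_twField {ε : ℝ} {A₁ A₃ Q₁ Q₃ T : ℝ → ℝ} (hC : 0 < crossPoly h n t)
    (hu : 0 < axisPoly l t) (hT : T (sCoord h l n t) = t) :
    ((sCoordDeriv h l n t • ContinuousLinearMap.fst ℝ ℝ ℝ).prod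
        (vCoordDeriv h l n t W • ContinuousLinearMap.fst ℝ ℝ ℝ +
          √(leadPoly h l n t) • ContinuousLinearMap.snd ℝ ℝ ℝ))
        (twField h l n A₁ A₃ Q₁ Q₃ ε (t, W)) =
      rotationField (chartJ h l n T) (chartK₁ h l n T A₁ A₃) (chartK₂ h l n T A₁ A₃ Q₁ Q₃) ε
        (svCoord h l n (t, W)) := by
  have hb := leadPoly_pos (h := h) hC hu
  have := Real.sqrt_pos.2 hb
  simp only [rotationField, svCoord, chartJ, chartK₁, chartK₂, hT, wOfV_vCoord hb, twField,
    ContinuousLinearMap.prod_apply, add_apply, smul_apply, ContinuousLinearMap.coe_fst',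
    ContinuousLinearMap.coe_snd', smul_eq_mul, Prod.mk.injEq]
  constructor
  · simp only [vCoord]
    field_simp
  · linear_combination unperturbed_vCoord_speed (W := W) hC hu

end Rotation

namespace IsChart

variable {h l n τ R : ℝ} {T : ℝ → ℝ}

lemma lead_pos (H : IsChart h l n T τ R) {t : ℝ} (ht : |t| < τ) : 0 < leadPoly h l n t :=
  leadPoly_pos (H.pos t ht).1 (H.pos t ht).2.1

lemma deriv_pos (H : IsChart h l n T τ R) {t : ℝ} (ht : |t| < τ) : 0 < sCoordDeriv h l n t := by
  obtain ⟨hC, hu, hK⟩ := H.pos t ht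
  have hb := H.lead_pos ht
  unfold sCoordDeriv
  positivity

lemma hasDerivAt (H : IsChart h l n T τ R) {s : ℝ} (hs : |s| < R) :
    HasDerivAt T (sCoordDeriv h l n (T s))⁻¹ s := by
  have ht := H.mem s hs
  refine HasDerivAt.of_local_left_inverse (H.contDiffAt s hs).continuousAt
    (hasDerivAt_sCoord (H.pos _ ht).1 (H.pos _ ht).2.1) (H.deriv_pos ht).ne' ?_
  filter_upwards [(isOpen_lt continuous_abs continuous_const).mem_nhds hs] with s' hs'
    using H.right_inv s' hs'

lemma chartJ_pos (H : IsChart h l n T τ R) {z : ℝ × ℝ} (hz : |z.1| < R) :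
    0 < chartJ h l n T z := by
  have := H.deriv_pos (H.mem _ hz)
  have := Real.sqrt_pos.2 (H.lead_pos (H.mem _ hz))
  unfold chartJ
  positivity

lemma svCoord_twCoord (H : IsChart h l n T τ R) {z : ℝ × ℝ} (hz : |z.1| < R) :
    svCoord h l n (twCoord h l n T z) = z := by
  simp only [svCoord, twCoord, H.right_inv _ hz, vCoord_wOfV (H.lead_pos (H.mem _ hz))]

lemma twCoord_svCoord (H : IsChart h l n T τ R) {z : ℝ × ℝ} (hz : |z.1| < τ)
    (hs : |sCoord h l n z.1| < R) : twCoord h l n T (svCoord h l n z) = z := by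
  simp only [svCoord, twCoord, H.left_inv _ hz hs, wOfV_vCoord (H.lead_pos hz)]

section ContDiff

variable (H : IsChart h l n T τ R) {z : ℝ × ℝ} (hz : |z.1| < R)

include H hz

lemma contDiffAt_twCoord : ContDiffAt ℝ 1 (twCoord h l n T) z := by
  have hT : ContDiffAt ℝ 1 (fun z : ℝ × ℝ => T z.1) z :=
    (H.contDiffAt z.1 hz).comp z contDiffAt_fst
  exact hT.prodMk (ContDiffAt.comp (g := fun z : ℝ × ℝ => wOfV h l n z.1 z.2)
    (f := fun z : ℝ × ℝ => (T z.1, z.2)) z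
    (contDiffAt_wOfV (H.lead_pos (H.mem _ hz))) (hT.prodMk contDiffAt_snd))

lemma contDiffAt_comp_left {f : ℝ → ℝ} (hf : ContDiffAt ℝ 1 f (T z.1)) :
    ContDiffAt ℝ 1 (fun z : ℝ × ℝ => f (T z.1)) z :=
  hf.comp z ((H.contDiffAt z.1 hz).comp z contDiffAt_fst)

lemma contDiffAt_sCoordDeriv_comp :
    ContDiffAt ℝ 1 (fun z : ℝ × ℝ => sCoordDeriv h l n (T z.1)) z :=
  H.contDiffAt_comp_left hz
    (contDiffAt_sCoordDeriv (H.pos _ (H.mem _ hz)).1 (H.pos _ (H.mem _ hz)).2.1)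

lemma contDiffAt_chartJ : ContDiffAt ℝ 1 (chartJ h l n T) z :=
  ((H.contDiffAt_sCoordDeriv_comp hz).mul (H.contDiffAt_comp_left hz
    (contDiffAt_sqrt_leadPoly (H.lead_pos (H.mem _ hz))))).div_const 2

variable {A₁ A₃ Q₁ Q₃ : ℝ → ℝ} (hA₁ : ContDiff ℝ 1 A₁) (hA₃ : ContDiff ℝ 1 A₃)

include hA₁ hA₃

lemma contDiffAt_tPerturbation :
    ContDiffAt ℝ 1 (fun z : ℝ × ℝ => A₁ (T z.1) + wOfV h l n (T z.1) z.2 * A₃ (T z.1)) z :=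
  (H.contDiffAt_comp_left hz hA₁.contDiffAt).add
    ((H.contDiffAt_twCoord hz).snd.mul (H.contDiffAt_comp_left hz hA₃.contDiffAt))

lemma contDiffAt_chartK₁ : ContDiffAt ℝ 1 (chartK₁ h l n T A₁ A₃) z :=
  (H.contDiffAt_sCoordDeriv_comp hz).mul (H.contDiffAt_tPerturbation hz hA₁ hA₃)

lemma contDiffAt_chartK₂ (hQ₁ : ContDiff ℝ 1 Q₁) (hQ₃ : ContDiff ℝ 1 Q₃) :
    ContDiffAt ℝ 1 (chartK₂ h l n T A₁ A₃ Q₁ Q₃) z := by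
  have hb := H.lead_pos (H.mem _ hz)
  have hW : ContDiffAt ℝ 1 (fun z : ℝ × ℝ => wOfV h l n (T z.1) z.2) z :=
    (H.contDiffAt_twCoord hz).snd
  have hV : ContDiffAt ℝ 1
      (fun z : ℝ × ℝ => vCoordDeriv h l n (T z.1) (wOfV h l n (T z.1) z.2)) z :=
    ContDiffAt.comp (g := fun z : ℝ × ℝ => vCoordDeriv h l n z.1 z.2)
      (f := twCoord h l n T) z (contDiffAt_vCoordDeriv hb) (H.contDiffAt_twCoord hz)
  have hroot : ContDiffAt ℝ 1 (fun z : ℝ × ℝ => √(leadPoly h l n (T z.1))) z :=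
    H.contDiffAt_comp_left hz (contDiffAt_sqrt_leadPoly hb)
  have hQ : ContDiffAt ℝ 1 (fun z : ℝ × ℝ => wOfV h l n (T z.1) z.2 * Q₁ (T z.1) +
      wOfV h l n (T z.1) z.2 ^ 2 * Q₃ (T z.1)) z :=
    (hW.mul (H.contDiffAt_comp_left hz hQ₁.contDiffAt)).add
      ((hW.pow 2).mul (H.contDiffAt_comp_left hz hQ₃.contDiffAt))
  unfold chartK₂
  exact ((contDiffAt_const.mul hroot).mul hQ).add
    (hV.mul (H.contDiffAt_tPerturbation hz hA₁ hA₃))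

end ContDiff

end IsChart

/-! ### The averaged function -/

/-- The divergence of the perturbation is `c₀₀ + W divPoly(t)`. -/
def divPoly (c02 c11 c20 t : ℝ) : ℝ := c02 + c11 * t + c20 * t ^ 2

/-- The kernel of the averaged function, as a function of `t`: twice the coefficient of `V²` in the
divergence density `divDensity`, whose other terms are odd in `V`. -/
noncomputable def meanKernel (h l n c00 c02 c11 c20 t : ℝ) : ℝ :=
  √(crossPoly h n t) * (c00 * leadPoly h l n t + divPoly c02 c11 c20 t * axisPoly l t) /
    (slopePoly h l n t * axisPoly l t)

/-- The averaged function (up to the factor `2 ρ`), whose simple zeros are the radii in the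
coordinates `(S, V)` of the circles from which limit cycles bifurcate. -/
noncomputable def meanFun (h l n c00 c02 c11 c20 : ℝ) (T : ℝ → ℝ) (ρ : ℝ) : ℝ :=
  ∫ φ in (0 : ℝ)..2 * Real.pi,
    Real.cos φ ^ 2 * meanKernel h l n c00 c02 c11 c20 (T (ρ * Real.sin φ))

/-- The density that the orbit equation integrates along circles: half the primitive in `W` of the
divergence `c₀₀ + W divPoly(t)`, times `V dt/dS`, with `t` and `W` expressed by `(S, V)`. -/
noncomputable def divDensity (h l n c00 c02 c11 c20 : ℝ) (T : ℝ → ℝ) (z : ℝ × ℝ) : ℝ :=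
  (c00 / 2 * wOfV h l n (T z.1) z.2 +
    divPoly c02 c11 c20 (T z.1) / 4 * wOfV h l n (T z.1) z.2 ^ 2) *
      (z.2 / sCoordDeriv h l n (T z.1))

/-- The part of `divDensity` that is odd in `V`. -/
noncomputable def divDensityOdd (h l n c00 c02 c11 c20 : ℝ) (T : ℝ → ℝ) (z : ℝ × ℝ) : ℝ :=
  (c00 * axisPoly l (T z.1) / (2 * leadPoly h l n (T z.1)) +
    divPoly c02 c11 c20 (T z.1) / 4 * (z.2 ^ 2 / leadPoly h l n (T z.1) +
      axisPoly l (T z.1) ^ 2 / leadPoly h l n (T z.1) ^ 2)) * (z.2 / sCoordDeriv h l n (T z.1))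

lemma integral_eq_zero_of_antisymm {f : ℝ → ℝ} (hp : Function.Periodic f (2 * Real.pi))
    (h : ∀ φ, f (Real.pi - φ) = -f φ) : ∫ φ in (0 : ℝ)..2 * Real.pi, f φ = 0 := by
  have hreflect := intervalIntegral.integral_comp_sub_left (a := 0) (b := 2 * Real.pi) f Real.pi
  simp only [h, intervalIntegral.integral_neg, sub_zero] at hreflect
  have hshift := hp.intervalIntegral_add_eq (Real.pi - 2 * Real.pi) 0
  rw [zero_add, show Real.pi - 2 * Real.pi + 2 * Real.pi = Real.pi by ring] at hshift
  linarith

lemma polarPoint_pi_sub (ρ φ : ℝ) :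
    polarPoint ρ (Real.pi - φ) = ((polarPoint ρ φ).1, -(polarPoint ρ φ).2) := by
  simp [polarPoint]

lemma abs_polarPoint_fst_lt {ρ R : ℝ} (hρ : 0 ≤ ρ) (hρR : ρ < R) (φ : ℝ) :
    |(polarPoint ρ φ).1| < R := by
  rw [polarPoint, abs_mul, abs_of_nonneg hρ]
  exact (mul_le_of_le_one_right hρ (Real.abs_sin_le_one φ)).trans_lt hρR

lemma continuous_comp_polarPoint {ρ R : ℝ} {f : ℝ × ℝ → ℝ} (hρ : 0 ≤ ρ) (hρR : ρ < R)
    (hf : ∀ z : ℝ × ℝ, |z.1| < R → ContDiffAt ℝ 1 f z) : Continuous fun φ => f (polarPoint ρ φ) :=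
  continuous_iff_continuousAt.2 fun φ => by
    refine (hf _ (abs_polarPoint_fst_lt hρ hρR φ)).continuousAt.comp (f := polarPoint ρ) ?_
    unfold polarPoint
    fun_prop

section Average

variable {h l n c00 c02 c11 c20 : ℝ} {T : ℝ → ℝ}

lemma integral_divDensityOdd (h l n c00 c02 c11 c20 : ℝ) (T : ℝ → ℝ) (ρ : ℝ) :
    ∫ φ in (0 : ℝ)..2 * Real.pi, divDensityOdd h l n c00 c02 c11 c20 T (polarPoint ρ φ) = 0 := by
  refine integral_eq_zero_of_antisymm (fun φ => ?_) fun φ => ?_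
  · simp only [polarPoint_periodic ρ φ]
  · simp only [polarPoint_pi_sub, divDensityOdd]
    ring

namespace IsChart

variable {τ R : ℝ} (H : IsChart h l n T τ R)

include H

lemma contDiffAt_meanKernel {t : ℝ} (ht : |t| < τ) :
    ContDiffAt ℝ 1 (meanKernel h l n c00 c02 c11 c20) t := by
  obtain ⟨hC, hu, hK⟩ := H.pos t ht
  have hdiv : ContDiff ℝ 1 (divPoly c02 c11 c20) := by
    unfold divPoly
    fun_prop
  exact (((contDiff_crossPoly h n).contDiffAt.sqrt hC.ne').mul
    ((contDiffAt_const.mul (contDiff_leadPoly h l n).contDiffAt).add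
      (hdiv.contDiffAt.mul (contDiff_axisPoly l).contDiffAt))).div
    ((contDiff_slopePoly h l n).contDiffAt.mul (contDiff_axisPoly l).contDiffAt) (mul_pos hK hu).ne'

lemma contDiffAt_meanKernel_comp {s : ℝ} (hs : |s| < R) :
    ContDiffAt ℝ 1 (fun s => meanKernel h l n c00 c02 c11 c20 (T s)) s :=
  (H.contDiffAt_meanKernel (H.mem s hs)).comp s (H.contDiffAt s hs)

lemma contDiffAt_divDensity {z : ℝ × ℝ} (hz : |z.1| < R) :
    ContDiffAt ℝ 1 (divDensity h l n c00 c02 c11 c20 T) z := by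
  have hW : ContDiffAt ℝ 1 (fun z : ℝ × ℝ => wOfV h l n (T z.1) z.2) z :=
    (H.contDiffAt_twCoord hz).snd
  have hdiv : ContDiff ℝ 1 (divPoly c02 c11 c20) := by
    unfold divPoly
    fun_prop
  exact ((contDiffAt_const.mul hW).add
    (((H.contDiffAt_comp_left hz hdiv.contDiffAt).div_const 4).mul (hW.pow 2))).mul
    (contDiffAt_snd.div (H.contDiffAt_sCoordDeriv_comp hz) (H.deriv_pos (H.mem _ hz)).ne')

lemma divDensity_eq {z : ℝ × ℝ} (hz : |z.1| < R) :
    divDensity h l n c00 c02 c11 c20 T z =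
      1 / 2 * (z.2 ^ 2 * meanKernel h l n c00 c02 c11 c20 (T z.1)) +
        divDensityOdd h l n c00 c02 c11 c20 T z := by
  have ht := H.mem _ hz
  obtain ⟨hC, hu, hK⟩ := H.pos _ ht
  have hb := H.lead_pos ht
  have hd := Real.sqrt_pos.2 hb
  have hc := Real.sqrt_pos.2 hC
  simp only [divDensity, divDensityOdd, wOfV, sCoordDeriv, meanKernel]
  rw [← Real.sq_sqrt hb.le, Real.sqrt_sq hd.le]
  field_simp [hu.ne', hK.ne', hc.ne']
  ring

section Polar

variable {A₁ A₃ Q₁ Q₃ : ℝ → ℝ} {ρ : ℝ} (hρ : 0 < ρ) (hρR : ρ < R)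

include hρ hρR

lemma hasDerivAt_comp_polarPoint (φ : ℝ) :
    HasDerivAt (fun φ => T (polarPoint ρ φ).1)
      ((polarPoint ρ φ).2 / sCoordDeriv h l n (T (polarPoint ρ φ).1)) φ := by
  refine ((H.hasDerivAt (abs_polarPoint_fst_lt hρ.le hρR φ)).scomp φ
    ((Real.hasDerivAt_sin φ).const_mul ρ)).congr_deriv ?_
  simp [polarPoint, div_eq_mul_inv]

-- Differentiate `V = vCoord t W` along the circle `S = ρ sin φ`, `V = ρ cos φ` and solve for `W'`.
lemma hasDerivAt_wOfV_polarPoint (φ : ℝ) :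
    HasDerivAt (fun φ => wOfV h l n (T (polarPoint ρ φ).1) (polarPoint ρ φ).2)
      (-((polarPoint ρ φ).1 +
          vCoordDeriv h l n (T (polarPoint ρ φ).1)
            (wOfV h l n (T (polarPoint ρ φ).1) (polarPoint ρ φ).2) *
          ((polarPoint ρ φ).2 / sCoordDeriv h l n (T (polarPoint ρ φ).1))) /
        √(leadPoly h l n (T (polarPoint ρ φ).1))) φ := by
  have ht := H.mem _ (abs_polarPoint_fst_lt hρ.le hρR φ)
  have hb := H.lead_pos ht
  have hd := Real.sqrt_pos.2 hb
  have hS := H.deriv_pos ht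
  have htd := H.hasDerivAt_comp_polarPoint hρ hρR φ
  have hbd := (hasDerivAt_leadPoly h l n (T (polarPoint ρ φ).1)).comp φ htd
  refine (((((Real.hasDerivAt_cos φ).const_mul ρ).mul (hbd.sqrt hb.ne')).add
    ((hasDerivAt_axisPoly l (T (polarPoint ρ φ).1)).comp φ htd)).div hbd hb.ne').congr_deriv ?_
  simp only [vCoordDeriv, wOfV, Pi.add_apply, Pi.mul_apply, Function.comp_apply]
  set S' := sCoordDeriv h l n (T (polarPoint ρ φ).1)
  simp only [polarPoint] at *
  rw [← Real.sq_sqrt hb.le, Real.sqrt_sq hd.le]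
  field_simp [hS.ne']
  ring

-- Integration by parts in `W`: the orbit equation is a divergence integral up to a derivative.
lemma hasDerivAt_primitive_polarPoint (hA₁ : ∀ t, HasDerivAt A₁ (c00 - 2 * Q₁ t) t)
    (hA₃ : ∀ t, HasDerivAt A₃ (divPoly c02 c11 c20 t - 4 * Q₃ t) t) (φ : ℝ) :
    HasDerivAt (fun φ =>
        -(1 / 2) * (A₁ (T (polarPoint ρ φ).1) *
          wOfV h l n (T (polarPoint ρ φ).1) (polarPoint ρ φ).2) -
        1 / 4 * (A₃ (T (polarPoint ρ φ).1) *
          wOfV h l n (T (polarPoint ρ φ).1) (polarPoint ρ φ).2 ^ 2))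
      (ρ / 4 * radialSlope (chartJ h l n T) (chartK₁ h l n T A₁ A₃) (chartK₂ h l n T A₁ A₃ Q₁ Q₃)
          φ 0 ρ - divDensity h l n c00 c02 c11 c20 T (polarPoint ρ φ)) φ := by
  have ht := H.mem _ (abs_polarPoint_fst_lt hρ.le hρR φ)
  have hd := Real.sqrt_pos.2 (H.lead_pos ht)
  have hS := H.deriv_pos ht
  have htd := H.hasDerivAt_comp_polarPoint hρ hρR φ
  have hWd := H.hasDerivAt_wOfV_polarPoint hρ hρR φ
  refine (((((hA₁ _).comp φ htd).mul hWd).const_mul (-(1 / 2))).sub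
    ((((hA₃ _).comp φ htd).mul (hWd.pow 2)).const_mul (1 / 4))).congr_deriv ?_
  simp only [radialSlope, angularSpeed, chartJ, chartK₁, chartK₂, zero_div, zero_mul, add_zero,
    divDensity, Pi.pow_apply, Function.comp_apply]
  have hfst : (polarPoint ρ φ).1 = ρ * Real.sin φ := rfl
  have hsnd : (polarPoint ρ φ).2 = ρ * Real.cos φ := rfl
  generalize wOfV h l n (T (polarPoint ρ φ).1) (polarPoint ρ φ).2 = W at *
  simp only [hfst, hsnd] at *
  field_simp [hd.ne', hS.ne']
  push_cast
  ring

lemma integral_divDensity :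
    ∫ φ in (0 : ℝ)..2 * Real.pi, divDensity h l n c00 c02 c11 c20 T (polarPoint ρ φ) =
      ρ ^ 2 / 2 * meanFun h l n c00 c02 c11 c20 T ρ := by
  set m : ℝ × ℝ → ℝ := fun z => 1 / 2 * (z.2 ^ 2 * meanKernel h l n c00 c02 c11 c20 (T z.1)) with hm
  have hdensity := continuous_comp_polarPoint hρ.le hρR fun z hz =>
    H.contDiffAt_divDensity (c00 := c00) (c02 := c02) (c11 := c11) (c20 := c20) hz
  have hmc := continuous_comp_polarPoint (f := m) hρ.le hρR fun z hz =>
    contDiffAt_const.mul ((contDiffAt_snd.pow 2).mul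
      ((H.contDiffAt_meanKernel_comp hz).comp z contDiffAt_fst))
  have hodd := integral_divDensityOdd h l n c00 c02 c11 c20 T ρ
  have hsplit : ∀ φ, divDensityOdd h l n c00 c02 c11 c20 T (polarPoint ρ φ) =
      divDensity h l n c00 c02 c11 c20 T (polarPoint ρ φ) - m (polarPoint ρ φ) := fun φ =>
    eq_sub_of_add_eq' (H.divDensity_eq (abs_polarPoint_fst_lt hρ.le hρR φ)).symm
  simp only [hsplit] at hodd
  rw [intervalIntegral.integral_sub (hdensity.intervalIntegrable _ _)
    (hmc.intervalIntegrable _ _), sub_eq_zero] at hodd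
  rw [hodd, meanFun, ← intervalIntegral.integral_const_mul]
  congr 1
  ext φ
  simp only [hm, polarPoint]
  ring

section Smooth

variable (cA₁ : ContDiff ℝ 1 A₁) (cA₃ : ContDiff ℝ 1 A₃) (cQ₁ : ContDiff ℝ 1 Q₁)
  (cQ₃ : ContDiff ℝ 1 Q₃)

include cA₁ cA₃ cQ₁ cQ₃

lemma continuous_radialSlope_zero :
    Continuous fun φ => radialSlope (chartJ h l n T) (chartK₁ h l n T A₁ A₃)
      (chartK₂ h l n T A₁ A₃ Q₁ Q₃) φ 0 ρ := by
  have hJ := continuous_comp_polarPoint hρ.le hρR fun z hz => H.contDiffAt_chartJ hz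
  have hK₁ := continuous_comp_polarPoint hρ.le hρR fun z hz => H.contDiffAt_chartK₁ hz cA₁ cA₃
  have hK₂ := continuous_comp_polarPoint hρ.le hρR fun z hz =>
    H.contDiffAt_chartK₂ hz cA₁ cA₃ cQ₁ cQ₃
  simp only [radialSlope, angularSpeed, zero_div, zero_mul, add_zero]
  exact ((Real.continuous_sin.mul hK₁).add (Real.continuous_cos.mul hK₂)).div hJ fun φ =>
    (H.chartJ_pos (abs_polarPoint_fst_lt hρ.le hρR φ)).ne'

theorem radialAverage_eq_meanFun (hA₁ : ∀ t, HasDerivAt A₁ (c00 - 2 * Q₁ t) t)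
    (hA₃ : ∀ t, HasDerivAt A₃ (divPoly c02 c11 c20 t - 4 * Q₃ t) t) :
    radialAverage (chartJ h l n T) (chartK₁ h l n T A₁ A₃) (chartK₂ h l n T A₁ A₃ Q₁ Q₃) ρ =
      2 * ρ * meanFun h l n c00 c02 c11 c20 T ρ := by
  have hslope := (H.continuous_radialSlope_zero hρ hρR cA₁ cA₃ cQ₁ cQ₃).const_mul (ρ / 4)
  have hdensity := continuous_comp_polarPoint hρ.le hρR fun z hz =>
    H.contDiffAt_divDensity (c00 := c00) (c02 := c02) (c11 := c11) (c20 := c20) hz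
  have hzero := intervalIntegral.integral_eq_sub_of_hasDerivAt
    (fun φ _ => H.hasDerivAt_primitive_polarPoint hρ hρR hA₁ hA₃ φ)
    ((hslope.sub hdensity).intervalIntegrable 0 (2 * Real.pi))
  rw [intervalIntegral.integral_sub (hslope.intervalIntegrable _ _)
    (hdensity.intervalIntegrable _ _), intervalIntegral.integral_const_mul,
    H.integral_divDensity hρ hρR] at hzero
  have hper : polarPoint ρ (2 * Real.pi) = polarPoint ρ 0 := by simp [polarPoint]
  rw [hper, sub_self, sub_eq_zero] at hzero
  refine mul_left_cancel₀ (div_ne_zero hρ.ne' four_ne_zero) (hzero.trans ?_)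
  ring

end Smooth

end Polar

end IsChart

end Average

/-! ### Limit cycles in the coordinates `(t, W)` -/

lemma abs_fst_le_polarRadius (z : ℝ × ℝ) : |z.1| ≤ polarRadius z :=
  Real.abs_le_sqrt (le_add_of_nonneg_right (sq_nonneg z.2))

lemma abs_snd_le_polarRadius (z : ℝ × ℝ) : |z.2| ≤ polarRadius z :=
  Real.abs_le_sqrt (le_add_of_nonneg_left (sq_nonneg z.1))

lemma hasDerivAt_mul_of_eq_zero {a f : ℝ → ℝ} {a' f' x : ℝ} (ha : HasDerivAt a a' x)
    (hf : HasDerivAt f f' x) (hx : f x = 0) : HasDerivAt (fun y => a y * f y) (a x * f') x := by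
  exact (ha.fun_mul hf).congr_deriv (by rw [hx, mul_zero, zero_add])

namespace IsChart

variable {h l n τ R : ℝ} {T : ℝ → ℝ}

lemma isOpen_svCoord_preimage (H : IsChart h l n T τ R) {B : Set (ℝ × ℝ)} (hB : IsOpen B) :
    IsOpen ({z : ℝ × ℝ | |z.1| < τ} ∩ svCoord h l n ⁻¹' B) :=
  ContinuousOn.isOpen_inter_preimage
    (fun z hz => (hasFDerivAt_svCoord (W := z.2) (H.pos _ hz).1
      (H.pos _ hz).2.1).continuousAt.continuousWithinAt)
    (isOpen_lt continuous_fst.abs continuous_const) hB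

theorem isLimitCycle_twField (H : IsChart h l n T τ R) {A₁ A₃ Q₁ Q₃ : ℝ → ℝ} {ε : ℝ}
    {C : Set (ℝ × ℝ)} (hCR : C ⊆ {z | polarRadius z < R})
    (hC : IsLimitCycle (rotationField (chartJ h l n T) (chartK₁ h l n T A₁ A₃)
      (chartK₂ h l n T A₁ A₃ Q₁ Q₃) ε) C) :
    IsLimitCycle (twField h l n A₁ A₃ Q₁ Q₃ ε) (twCoord h l n T '' C) := by
  have hfst : ∀ z : ℝ × ℝ, polarRadius z < R → |z.1| < R := fun z hz =>
    (abs_fst_le_polarRadius z).trans_lt hz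
  refine hC.image (Ψ := svCoord h l n) hCR
    (H.isOpen_svCoord_preimage (isOpen_lt continuous_polarRadius continuous_const))
    (fun z hz => ⟨H.mem _ (hfst z hz), ?_⟩) (fun z hz => H.svCoord_twCoord (hfst z hz))
    (fun z hz => H.twCoord_svCoord hz.1 (hfst _ hz.2))
    (fun z hz => (H.contDiffAt_twCoord (hfst z hz)).differentiableAt one_ne_zero)
    (fun z hz => ⟨_, hasFDerivAt_svCoord (W := z.2) (H.pos _ hz.1).1 (H.pos _ hz.1).2.1,
      svCoord_twField (H.pos _ hz.1).1 (H.pos _ hz.1).2.1 (H.left_inv _ hz.1 (hfst _ hz.2))⟩)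
  rwa [mem_preimage, H.svCoord_twCoord (hfst z hz)]

lemma twCoord_snd_pos (H : IsChart h l n T τ R) {z : ℝ × ℝ} (hz : polarRadius z < R) :
    0 < (twCoord h l n T z).2 := by
  have hs := (abs_fst_le_polarRadius z).trans_lt hz
  have hpos := H.pos _ (H.mem _ hs)
  refine wOfV_pos hpos.1 hpos.2.1 ?_
  rw [H.right_inv _ hs]
  exact (Real.sqrt_lt' one_pos).1 (hz.trans H.lt_one) |>.trans_eq (one_pow 2)

section Average

variable {c00 c02 c11 c20 : ℝ} {A₁ A₃ Q₁ Q₃ : ℝ → ℝ} (H : IsChart h l n T τ R)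
  (cA₁ : ContDiff ℝ 1 A₁) (cA₃ : ContDiff ℝ 1 A₃) (cQ₁ : ContDiff ℝ 1 Q₁) (cQ₃ : ContDiff ℝ 1 Q₃)
  (hA₁ : ∀ t, HasDerivAt A₁ (c00 - 2 * Q₁ t) t)
  (hA₃ : ∀ t, HasDerivAt A₃ (divPoly c02 c11 c20 t - 4 * Q₃ t) t)

include H cA₁ cA₃ cQ₁ cQ₃ hA₁ hA₃

theorem hasDerivAt_radialAverage {ρ₀ D : ℝ} (hρ₀ : 0 < ρ₀) (hρR : ρ₀ < R)
    (hz : meanFun h l n c00 c02 c11 c20 T ρ₀ = 0)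
    (hD : HasDerivAt (meanFun h l n c00 c02 c11 c20 T) D ρ₀) :
    HasDerivAt (radialAverage (chartJ h l n T) (chartK₁ h l n T A₁ A₃)
      (chartK₂ h l n T A₁ A₃ Q₁ Q₃)) (2 * ρ₀ * D) ρ₀ := by
  refine (hasDerivAt_mul_of_eq_zero (a := fun ρ => 2 * ρ) ((hasDerivAt_id ρ₀).const_mul 2) hD
    hz).congr_of_eventuallyEq ?_
  filter_upwards [Ioo_mem_nhds hρ₀ hρR] with ρ hρ
  exact H.radialAverage_eq_meanFun hρ.1 hρ.2 cA₁ cA₃ cQ₁ cQ₃ hA₁ hA₃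

theorem eventually_exists_isLimitCycle_twField {ρ₀ D : ℝ} {s : Set ℝ} (hs : IsOpen s)
    (hsR : s ⊆ Ioo 0 R) (hρ₀ : ρ₀ ∈ s) (hz : meanFun h l n c00 c02 c11 c20 T ρ₀ = 0)
    (hD : HasDerivAt (meanFun h l n c00 c02 c11 c20 T) D ρ₀) (hD0 : D ≠ 0) :
    ∀ᶠ ε in 𝓝[>] 0, ∃ C ⊆ polarRadius ⁻¹' s,
      IsLimitCycle (twField h l n A₁ A₃ Q₁ Q₃ ε) (twCoord h l n T '' C) := by
  have hfst : ∀ z : ℝ × ℝ, z ∈ polarRadius ⁻¹' s → |z.1| < R := fun z hz =>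
    (abs_fst_le_polarRadius z).trans_lt (hsR hz).2
  obtain ⟨hρ0, hρR⟩ := hsR hρ₀
  have hzero : radialAverage (chartJ h l n T) (chartK₁ h l n T A₁ A₃)
      (chartK₂ h l n T A₁ A₃ Q₁ Q₃) ρ₀ = 0 := by
    rw [H.radialAverage_eq_meanFun hρ0 hρR cA₁ cA₃ cQ₁ cQ₃ hA₁ hA₃, hz, mul_zero]
  filter_upwards [eventually_exists_isLimitCycle hs (hsR.trans Ioo_subset_Ioi_self)
    (fun z hz => (H.contDiffAt_chartJ (hfst z hz)).contDiffWithinAt)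
    (fun z hz => (H.contDiffAt_chartK₁ (hfst z hz) cA₁ cA₃).contDiffWithinAt)
    (fun z hz => (H.contDiffAt_chartK₂ (hfst z hz) cA₁ cA₃ cQ₁ cQ₃).contDiffWithinAt)
    (fun z hz => H.chartJ_pos (hfst z hz)) hρ₀ hzero
    (H.hasDerivAt_radialAverage cA₁ cA₃ cQ₁ cQ₃ hA₁ hA₃ hρ0 hρR hz hD)
    (by positivity)] with ε ⟨C, hCs, hC⟩
  exact ⟨C, hCs, H.isLimitCycle_twField (fun z hz => (hsR (hCs hz)).2) hC⟩

end Average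

end IsChart

/-! ### The symmetric system -/

lemma hasDerivAt_quartic (a₀ a₁ a₂ a₃ a₄ x : ℝ) :
    HasDerivAt (fun x => a₀ + a₁ * x + a₂ * x ^ 2 + a₃ * x ^ 3 + a₄ * x ^ 4)
      (a₁ + 2 * a₂ * x + 3 * a₃ * x ^ 2 + 4 * a₄ * x ^ 3) x := by
  refine ((((((hasDerivAt_id x).const_mul a₁).const_add a₀).add
    (((hasDerivAt_id x).pow 2).const_mul a₂)).add (((hasDerivAt_id x).pow 3).const_mul a₃)).add
    (((hasDerivAt_id x).pow 4).const_mul a₄)).congr_deriv ?_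
  simp
  ring

lemma deriv_quartic {f : ℝ → ℝ} (a₀ a₁ a₂ a₃ a₄ x : ℝ)
    (hf : ∀ x, f x = a₀ + a₁ * x + a₂ * x ^ 2 + a₃ * x ^ 3 + a₄ * x ^ 4) :
    deriv f x = a₁ + 2 * a₂ * x + 3 * a₃ * x ^ 2 + 4 * a₄ * x ^ 3 := by
  rw [funext hf]
  exact (hasDerivAt_quartic a₀ a₁ a₂ a₃ a₄ x).deriv

lemma symField_apply (h31 h22 h40 : ℝ) (p q : ℝ → ℝ → ℝ) (ε x y : ℝ) :
    symField h31 h22 h40 p q ε (x, y) =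
      (-(1 / 2) * y + h31 * x ^ 3 + 2 * h22 * x ^ 2 * y + 1 / 2 * y ^ 3 + ε * p x y,
        -((1 - 2 * h22) * x + 4 * h40 * x ^ 3 + 3 * h31 * x ^ 2 * y + 2 * h22 * x * y ^ 2) +
          ε * q x y) := by
  simp only [symField, nearHamiltonianField]
  rw [deriv_quartic (f := fun y => centerHamiltonian h31 h22 h40 x y)
      ((1 / 2 - h22) * x ^ 2 + h40 * x ^ 4) (h31 * x ^ 3) (-1 / 4 + h22 * x ^ 2) 0 (1 / 8) y
      (fun y => by simp only [centerHamiltonian, symHamiltonian]; ring),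
    deriv_quartic (f := fun x => centerHamiltonian h31 h22 h40 x y)
      (-1 / 4 * y ^ 2 + 1 / 8 * y ^ 4) 0 (1 / 2 - h22 + h22 * y ^ 2) (h31 * y) h40 x
      (fun x => by simp only [centerHamiltonian, symHamiltonian]; ring)]
  ext <;> simp <;> ring

lemma normalField_apply (h31 h22 h40 : ℝ) (p q : ℝ → ℝ → ℝ) (ε x y : ℝ) :
    normalField h31 h22 h40 p q ε (1 - y, x) =
      (-(symField h31 h22 h40 p q ε (x, y)).2, (symField h31 h22 h40 p q ε (x, y)).1) := by
  rw [symField_apply]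
  simp only [normalField, nearHamiltonianField]
  rw [deriv_quartic (f := fun v => normalHamiltonian h31 h22 h40 (1 - y) v)
      (1 / 2 * (1 - y) ^ 2 - 1 / 2 * (1 - y) ^ 3 + 1 / 8 * (1 - y) ^ 4) 0
      (1 / 2 - 2 * h22 * (1 - y) + h22 * (1 - y) ^ 2) (h31 - h31 * (1 - y)) h40 x
      (fun v => by simp only [normalHamiltonian]; ring),
    deriv_quartic (f := fun u => normalHamiltonian h31 h22 h40 u x)
      (1 / 2 * x ^ 2 + h31 * x ^ 3 + h40 * x ^ 4) (-2 * h22 * x ^ 2 - h31 * x ^ 3)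
      (1 / 2 + h22 * x ^ 2) (-1 / 2) (1 / 8) (1 - y)
      (fun u => by simp only [normalHamiltonian]; ring)]
  simp only [sub_sub_cancel]
  ext <;> simp <;> ring

section Transfer

variable {h31 h22 h40 ε : ℝ} {p q : ℝ → ℝ → ℝ} {C : Set (ℝ × ℝ)}

lemma IsLimitCycle.normalField (hC : IsLimitCycle (symField h31 h22 h40 p q ε) C) :
    IsLimitCycle (normalField h31 h22 h40 p q ε) ((fun z : ℝ × ℝ => (1 - z.2, z.1)) '' C) := by
  refine hC.image (Ψ := fun z => (z.2, 1 - z.1)) (subset_univ _) isOpen_univ (mapsTo_univ _ _)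
    (fun z _ => by simp) (fun z _ => by simp) (fun z _ => by fun_prop) fun z _ =>
      ⟨(ContinuousLinearMap.snd ℝ ℝ ℝ).prod (-ContinuousLinearMap.fst ℝ ℝ ℝ),
        hasFDerivAt_snd.prodMk (hasFDerivAt_fst.const_sub 1), ?_⟩
  have hfield := normalField_apply h31 h22 h40 p q ε z.2 (1 - z.1)
  rw [sub_sub_cancel] at hfield
  rw [← Prod.mk.eta (p := z), hfield]
  simp

lemma IsLimitCycle.neg_symField (hp : ∀ x y, p (-x) (-y) = -p x y)
    (hq : ∀ x y, q (-x) (-y) = -q x y) (hC : IsLimitCycle (symField h31 h22 h40 p q ε) C) :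
    IsLimitCycle (symField h31 h22 h40 p q ε) ((fun z : ℝ × ℝ => -z) '' C) := by
  refine hC.image (Ψ := fun z => -z) (subset_univ _) isOpen_univ (mapsTo_univ _ _)
    (fun z _ => neg_neg z) (fun z _ => neg_neg z) (fun z _ => by fun_prop)
    fun z _ => ⟨-ContinuousLinearMap.id ℝ (ℝ × ℝ), (hasFDerivAt_id z).neg, ?_⟩
  obtain ⟨x, y⟩ := z
  simp only [Prod.neg_mk, symField_apply, hp, hq]
  ext <;> simp <;> ring

end Transfer

lemma IsOddCubic.neg_neg {p : ℝ → ℝ → ℝ} (hp : IsOddCubic p) (x y : ℝ) :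
    p (-x) (-y) = -p x y := by
  obtain ⟨a10, a01, a30, a21, a12, a03, hp⟩ := hp
  rw [hp, hp]
  ring

/-- `P₁` and `P₃` are the homogeneous parts of degrees `1` and `3` of `p`, dehomogenised with
`t = x / y`. -/
def HasRayParts (p : ℝ → ℝ → ℝ) (P₁ P₃ : ℝ → ℝ) : Prop :=
  ∀ t y, p (t * y) y = y * P₁ t + y ^ 3 * P₃ t

lemma IsOddCubic.exists_hasRayParts {p : ℝ → ℝ → ℝ} (hp : IsOddCubic p) :
    ∃ P₁ P₃, ContDiff ℝ 1 P₁ ∧ ContDiff ℝ 1 P₃ ∧ HasRayParts p P₁ P₃ := by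
  obtain ⟨a10, a01, a30, a21, a12, a03, hp⟩ := hp
  refine ⟨fun t => a01 + a10 * t, fun t => a03 + a12 * t + a21 * t ^ 2 + a30 * t ^ 3,
    by fun_prop, by fun_prop, fun t y => ?_⟩
  rw [hp]
  ring

namespace HasRayParts

variable {p q : ℝ → ℝ → ℝ} {P₁ P₃ Q₁ Q₃ : ℝ → ℝ} {t y P₁' P₃' : ℝ}

lemma apply (hp : HasRayParts p P₁ P₃) (x : ℝ) (hy : y ≠ 0) :
    p x y = y * P₁ (x / y) + y ^ 3 * P₃ (x / y) := by
  rw [← hp, div_mul_cancel₀ x hy]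

lemma hasDerivAt_left (hp : HasRayParts p P₁ P₃) (hy : y ≠ 0) (hP₁ : HasDerivAt P₁ P₁' t)
    (hP₃ : HasDerivAt P₃ P₃' t) :
    HasDerivAt (fun x => p x y) (P₁' + y ^ 2 * P₃') (t * y) := by
  have hdiv : HasDerivAt (fun x => x / y) (1 / y) (t * y) := (hasDerivAt_id _).div_const y
  have ht : t * y / y = t := mul_div_cancel_right₀ t hy
  rw [← ht] at hP₁ hP₃
  refine (((hP₁.comp (t * y) hdiv).const_mul y).add
    ((hP₃.comp (t * y) hdiv).const_mul (y ^ 3))).congr_of_eventuallyEq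
    (Eventually.of_forall fun x => hp.apply x hy) |>.congr_deriv ?_
  field_simp

lemma hasDerivAt_right (hp : HasRayParts p P₁ P₃) (hy : y ≠ 0) (hP₁ : HasDerivAt P₁ P₁' t)
    (hP₃ : HasDerivAt P₃ P₃' t) :
    HasDerivAt (fun y' => p (t * y) y') (P₁ t - t * P₁' + y ^ 2 * (3 * P₃ t - t * P₃')) y := by
  have hdiv : HasDerivAt (fun y' => t * y / y') (-(t / y)) y := by
    refine ((hasDerivAt_inv hy).const_mul (t * y)).congr_deriv ?_
    field_simp
  have ht : t * y / y = t := mul_div_cancel_right₀ t hy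
  have hpow : HasDerivAt (fun y' : ℝ => y' ^ 3) (3 * y ^ 2) y := by simpa using hasDerivAt_pow 3 y
  rw [← ht] at hP₁ hP₃
  refine (((hasDerivAt_id y).mul (hP₁.comp y hdiv)).add
    (hpow.mul (hP₃.comp y hdiv))).congr_of_eventuallyEq ?_ |>.congr_deriv ?_
  · filter_upwards [isOpen_ne.mem_nhds hy] with y' hy' using hp.apply (t * y) hy'
  · simp only [Function.comp_apply, id, ht]
    field_simp
    ring

lemma divergence_eq {c00 c02 c11 c20 Q₁' Q₃' : ℝ} (hp : HasRayParts p P₁ P₃)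
    (hq : HasRayParts q Q₁ Q₃) (hd : HasDivergence p q c00 c02 c11 c20) (hy : y ≠ 0)
    (hP₁ : HasDerivAt P₁ P₁' t) (hP₃ : HasDerivAt P₃ P₃' t) (hQ₁ : HasDerivAt Q₁ Q₁' t)
    (hQ₃ : HasDerivAt Q₃ Q₃' t) :
    P₁' + y ^ 2 * P₃' + (Q₁ t - t * Q₁' + y ^ 2 * (3 * Q₃ t - t * Q₃')) =
      c00 + y ^ 2 * divPoly c02 c11 c20 t := by
  rw [← (hp.hasDerivAt_left hy hP₁ hP₃).deriv, ← (hq.hasDerivAt_right hy hQ₁ hQ₃).deriv, hd,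
    divPoly]
  ring

section Divergence

variable {c00 c02 c11 c20 : ℝ} (hp : HasRayParts p P₁ P₃) (hq : HasRayParts q Q₁ Q₃)
  (hd : HasDivergence p q c00 c02 c11 c20) (cP₁ : Differentiable ℝ P₁) (cP₃ : Differentiable ℝ P₃)
  (cQ₁ : Differentiable ℝ Q₁) (cQ₃ : Differentiable ℝ Q₃)

include hp hq hd cP₁ cP₃ cQ₁ cQ₃

-- The two homogeneous components of the divergence are separated by comparing `y = 1` and `y = 2`.
lemma hasDerivAt_linear_part (t : ℝ) :
    HasDerivAt (fun t => P₁ t - t * Q₁ t) (c00 - 2 * Q₁ t) t := by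
  have hdiv := fun y hy => hp.divergence_eq (y := y) hq hd hy (cP₁ t).hasDerivAt
    (cP₃ t).hasDerivAt (cQ₁ t).hasDerivAt (cQ₃ t).hasDerivAt
  refine ((cP₁ t).hasDerivAt.sub ((hasDerivAt_id t).mul (cQ₁ t).hasDerivAt)).congr_deriv ?_
  simp only [id, one_mul]
  linear_combination 4 / 3 * hdiv 1 one_ne_zero - 1 / 3 * hdiv 2 two_ne_zero

lemma hasDerivAt_cubic_part (t : ℝ) :
    HasDerivAt (fun t => P₃ t - t * Q₃ t) (divPoly c02 c11 c20 t - 4 * Q₃ t) t := by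
  have hdiv := fun y hy => hp.divergence_eq (y := y) hq hd hy (cP₁ t).hasDerivAt
    (cP₃ t).hasDerivAt (cQ₁ t).hasDerivAt (cQ₃ t).hasDerivAt
  refine ((cP₃ t).hasDerivAt.sub ((hasDerivAt_id t).mul (cQ₃ t).hasDerivAt)).congr_deriv ?_
  simp only [id, one_mul]
  linear_combination 1 / 3 * hdiv 2 two_ne_zero - 1 / 3 * hdiv 1 one_ne_zero

end Divergence

end HasRayParts

lemma hasFDerivAt_ray {x y : ℝ} (hy : y ≠ 0) :
    HasFDerivAt (fun z : ℝ × ℝ => (z.1 / z.2, z.2 ^ 2))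
      (((1 / y) • ContinuousLinearMap.fst ℝ ℝ ℝ +
          (-x / y ^ 2) • ContinuousLinearMap.snd ℝ ℝ ℝ).prod
        ((0 : ℝ) • ContinuousLinearMap.fst ℝ ℝ ℝ + (2 * y) • ContinuousLinearMap.snd ℝ ℝ ℝ))
      (x, y) := by
  have hdiff : DifferentiableAt ℝ (fun z : ℝ × ℝ => z.1 / z.2) (x, y) := by
    simpa only [div_eq_mul_inv] using
      differentiableAt_fst.fun_mul (differentiableAt_snd.fun_inv hy)
  refine (hasFDerivAt_of_partial hdiff ?_ ?_).prodMk
    (hasFDerivAt_of_partial (F := fun z : ℝ × ℝ => z.2 ^ 2) (by fun_prop)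
      (hasDerivAt_const x (y ^ 2)) (by simpa using hasDerivAt_pow 2 y))
  · exact (hasDerivAt_id x).div_const y
  · refine ((hasDerivAt_const y x).div (hasDerivAt_id y) hy).congr_deriv ?_
    simp

lemma ray_symField {h31 h22 h40 ε x y : ℝ} {p q : ℝ → ℝ → ℝ} {P₁ P₃ Q₁ Q₃ : ℝ → ℝ}
    (hp : HasRayParts p P₁ P₃) (hq : HasRayParts q Q₁ Q₃) (hy : y ≠ 0) :
    (((1 / y) • ContinuousLinearMap.fst ℝ ℝ ℝ +
          (-x / y ^ 2) • ContinuousLinearMap.snd ℝ ℝ ℝ).prod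
        ((0 : ℝ) • ContinuousLinearMap.fst ℝ ℝ ℝ + (2 * y) • ContinuousLinearMap.snd ℝ ℝ ℝ))
        (symField h31 h22 h40 p q ε (x, y)) =
      twField h31 (2 - 4 * h22) ((1 - 2 * h22) ^ 2 - 2 * h40) (fun t => P₁ t - t * Q₁ t)
        (fun t => P₃ t - t * Q₃ t) Q₁ Q₃ ε (x / y, y ^ 2) := by
  obtain ⟨t, rfl⟩ : ∃ t, x = t * y := ⟨x / y, (div_mul_cancel₀ x hy).symm⟩
  simp only [symField_apply, twField, leadPoly, leadPolyDeriv, axisPoly, crossPoly,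
    hp t y, hq t y, mul_div_cancel_right₀ t hy, ContinuousLinearMap.prod_apply, add_apply,
    smul_apply, ContinuousLinearMap.coe_fst', ContinuousLinearMap.coe_snd', smul_eq_mul,
    Prod.mk.injEq]
  constructor <;> field_simp <;> ring

lemma IsLimitCycle.symField_of_twField {h31 h22 h40 ε : ℝ} {p q : ℝ → ℝ → ℝ}
    {P₁ P₃ Q₁ Q₃ : ℝ → ℝ} (hp : HasRayParts p P₁ P₃) (hq : HasRayParts q Q₁ Q₃)
    {C : Set (ℝ × ℝ)} (hC0 : C ⊆ {z | 0 < z.2})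
    (hC : IsLimitCycle (twField h31 (2 - 4 * h22) ((1 - 2 * h22) ^ 2 - 2 * h40)
      (fun t => P₁ t - t * Q₁ t) (fun t => P₃ t - t * Q₃ t) Q₁ Q₃ ε) C) :
    IsLimitCycle (symField h31 h22 h40 p q ε) ((fun z : ℝ × ℝ => (z.1 * √z.2, √z.2)) '' C) := by
  refine hC.image (Ψ := fun z => (z.1 / z.2, z.2 ^ 2)) hC0
    (isOpen_lt continuous_const continuous_snd) (fun z hz => Real.sqrt_pos.2 hz)
    (fun z hz => ?_) (fun z hz => ?_) (fun z hz => ?_)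
    (fun z hz => ⟨_, hasFDerivAt_ray hz.ne', ray_symField hp hq hz.ne'⟩)
  · have := (Real.sqrt_pos.2 hz).ne'
    ext <;> simp [this, Real.sq_sqrt (le_of_lt hz)]
  · have hz : 0 < z.2 := hz
    ext <;> simp [Real.sqrt_sq hz.le, hz.ne']
  · have hroot : DifferentiableAt ℝ (fun z : ℝ × ℝ => √z.2) z :=
      differentiableAt_snd.sqrt (ne_of_gt hz)
    exact (differentiableAt_fst.mul hroot).prodMk hroot

/-! ### Existence of charts -/

lemma eventually_apply_fst_snd_of_nhds_zero {E : Type*} [PseudoMetricSpace E]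
    {P : ℝ × E → Prop} {e₀ : E} (hP : ∀ᶠ x in 𝓝 (0, e₀), P x) {δ : ℝ} (hδ : 0 < δ) :
    ∃ r > 0, r ≤ δ ∧ ∀ t, |t| < r → ∀ e ∈ Metric.ball e₀ r, P (t, e) := by
  obtain ⟨r, hr, hball⟩ := Metric.eventually_nhds_iff.1 hP
  refine ⟨min r δ, lt_min hr hδ, min_le_right _ _, fun t ht e he => hball ?_⟩
  rw [Prod.dist_eq, Real.dist_0_eq_abs]
  exact max_lt (ht.trans_le (min_le_left _ _)) ((Metric.mem_ball.1 he).trans_le (min_le_left _ _))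

-- The inverse function theorem for `(x, e) ↦ (f (x, e), e)`.
lemma exists_contDiffAt_inverse_fst {E : Type*} [NormedAddCommGroup E] [NormedSpace ℝ E]
    [CompleteSpace E] {f : ℝ × E → ℝ} {x₀ c : ℝ} {e₀ : E} (hf : ContDiffAt ℝ 1 f (x₀, e₀))
    (hc : HasDerivAt (fun x => f (x, e₀)) c x₀) (hc0 : c ≠ 0) :
    ∃ T : ℝ × E → ℝ, ContDiffAt ℝ 1 T (f (x₀, e₀), e₀) ∧ T (f (x₀, e₀), e₀) = x₀ ∧
      (∀ᶠ q in 𝓝 (f (x₀, e₀), e₀), f (T q, q.2) = q.1) ∧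
      ∀ᶠ p in 𝓝 (x₀, e₀), T (f p, p.2) = p.1 := by
  set p₀ : ℝ × E := (x₀, e₀)
  set Φ : ℝ × E → ℝ × E := fun p => (f p, p.2)
  set f' := fderiv ℝ f p₀
  have hf' : HasFDerivAt f f' p₀ := (hf.differentiableAt one_ne_zero).hasFDerivAt
  have hone : f' (1, 0) = c :=
    (hf'.comp_hasDerivAt x₀ ((hasDerivAt_id x₀).prodMk (hasDerivAt_const x₀ e₀))).unique hc
  have hsplit : ∀ v e, f' (v, e) = c * v + f' (0, e) := fun v e => by
    rw [← hone, mul_comm, ← smul_eq_mul, ← map_smul, ← map_add]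
    simp
  set L : (ℝ × E) ≃L[ℝ] ℝ × E := ContinuousLinearEquiv.equivOfInverse
    (f'.prod (ContinuousLinearMap.snd ℝ ℝ E))
    ((c⁻¹ • (ContinuousLinearMap.fst ℝ ℝ E -
      f'.comp ((0 : ℝ × E →L[ℝ] ℝ).prod (ContinuousLinearMap.snd ℝ ℝ E)))).prod
        (ContinuousLinearMap.snd ℝ ℝ E))
    (fun p => by simp [hsplit p.1 p.2, hc0])
    (fun p => by simp [hsplit (c⁻¹ * (p.1 - f' (0, p.2))) p.2, hc0])
  have hΦ : ContDiffAt ℝ 1 Φ p₀ := hf.prodMk contDiffAt_snd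
  have hΦ' : HasFDerivAt Φ (L : (ℝ × E) →L[ℝ] ℝ × E) p₀ := hf'.prodMk hasFDerivAt_snd
  set e := hΦ.toOpenPartialHomeomorph Φ hΦ' one_ne_zero
  have hmem : p₀ ∈ e.source := hΦ.mem_toOpenPartialHomeomorph_source hΦ' one_ne_zero
  refine ⟨fun q => (e.symm q).1, contDiffAt_fst.comp _ (hΦ.to_localInverse hΦ' one_ne_zero),
    congrArg Prod.fst (e.left_inv hmem), ?_, ?_⟩
  · filter_upwards [e.open_target.mem_nhds (e.map_source hmem)] with q hq
    have hright : Φ (e.symm q) = q := e.right_inv hq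
    rw [← congrArg Prod.snd hright]
    exact congrArg Prod.fst hright
  · filter_upwards [e.open_source.mem_nhds hmem] with p hp using
      congrArg Prod.fst (e.left_inv hp)

@[simp] lemma crossPoly_zero (h n : ℝ) : crossPoly h n 0 = 1 := by simp [crossPoly]

@[simp] lemma axisPoly_zero (l : ℝ) : axisPoly l 0 = 1 := by simp [axisPoly]

@[simp] lemma leadPoly_zero (h l n : ℝ) : leadPoly h l n 0 = 1 := by simp [leadPoly]

@[simp] lemma slopePoly_zero (h l n : ℝ) : slopePoly h l n 0 = 2 := by simp [slopePoly]

@[simp] lemma sCoord_zero (h l n : ℝ) : sCoord h l n 0 = 0 := by simp [sCoord]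

lemma contDiffAt_sCoord_param (h : ℝ) (a : ℝ × ℝ) :
    ContDiffAt ℝ 1 (fun p : ℝ × ℝ × ℝ => sCoord h p.2.1 p.2.2 p.1) (0, a) := by
  have hC : ContDiff ℝ 1 fun p : ℝ × ℝ × ℝ => crossPoly h p.2.2 p.1 := by
    unfold crossPoly; fun_prop
  have hb : ContDiff ℝ 1 fun p : ℝ × ℝ × ℝ => leadPoly h p.2.1 p.2.2 p.1 := by
    unfold leadPoly axisPoly crossPoly; fun_prop
  exact ((contDiffAt_const.mul contDiffAt_fst).mul (hC.contDiffAt.sqrt (by simp))).div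
    (hb.contDiffAt.sqrt (by simp)) (by simp)

lemma eventually_pos_param (h : ℝ) (a : ℝ × ℝ) :
    ∀ᶠ p : ℝ × ℝ × ℝ in 𝓝 (0, a), 0 < crossPoly h p.2.2 p.1 ∧ 0 < axisPoly p.2.1 p.1 ∧
      0 < slopePoly h p.2.1 p.2.2 p.1 := by
  have hC : Continuous fun p : ℝ × ℝ × ℝ => crossPoly h p.2.2 p.1 := by unfold crossPoly; fun_prop
  have hu : Continuous fun p : ℝ × ℝ × ℝ => axisPoly p.2.1 p.1 := by unfold axisPoly; fun_prop
  have hK : Continuous fun p : ℝ × ℝ × ℝ => slopePoly h p.2.1 p.2.2 p.1 := by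
    unfold slopePoly; fun_prop
  exact (hC.continuousAt.eventually (lt_mem_nhds (by simp))).and
    ((hu.continuousAt.eventually (lt_mem_nhds (by simp))).and
      (hK.continuousAt.eventually (lt_mem_nhds (by simp))))

/-- A family of charts on a common domain, for the parameters `(l, n)` in the open set `U`. -/
structure IsChartFamily (h : ℝ) (U : Set (ℝ × ℝ)) (T : ℝ × ℝ × ℝ → ℝ) (τ R : ℝ) : Prop where
  radius_pos : 0 < R
  isOpen : IsOpen U
  isChart : ∀ a ∈ U, IsChart h a.1 a.2 (fun s => T (s, a)) τ R
  continuousAt : ∀ a ∈ U, ∀ s, |s| < R → ContinuousAt T (s, a)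

lemma exists_isChartFamily (h : ℝ) (a₀ : ℝ × ℝ) {δ : ℝ} (hδ : 0 < δ) :
    ∃ (U : Set (ℝ × ℝ)) (T : ℝ × ℝ × ℝ → ℝ) (τ R : ℝ), IsChartFamily h U T τ R ∧
      a₀ ∈ U ∧ U ⊆ Metric.ball a₀ δ ∧ τ ≤ δ ∧ R ≤ δ := by
  have hderiv : HasDerivAt (sCoord h a₀.1 a₀.2) 2 0 :=
    (hasDerivAt_sCoord (by simp) (by simp)).congr_deriv (by simp [sCoordDeriv])
  obtain ⟨T, hT, hT0, hright, hleft⟩ :=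
    exists_contDiffAt_inverse_fst (contDiffAt_sCoord_param h a₀) hderiv two_ne_zero
  simp only [sCoord_zero] at hT hT0 hright
  obtain ⟨τ, hτ, hτδ, hbox⟩ :=
    eventually_apply_fst_snd_of_nhds_zero (hleft.and (eventually_pos_param h a₀)) hδ
  have hsmall : ∀ᶠ q in 𝓝 (0, a₀), |T q| < τ :=
    hT.continuousAt.abs.eventually (gt_mem_nhds (by simpa [hT0] using hτ))
  obtain ⟨R, hR, hRmin, hbox'⟩ := eventually_apply_fst_snd_of_nhds_zero
    (hright.and (hsmall.and (hT.eventually (by simp)))) (lt_min hτ (one_half_pos (α := ℝ)))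
  have hRτ : R ≤ τ := hRmin.trans (min_le_left _ _)
  have hsub : Metric.ball a₀ R ⊆ Metric.ball a₀ τ := Metric.ball_subset_ball hRτ
  refine ⟨Metric.ball a₀ R, T, τ, R, ⟨hR, Metric.isOpen_ball, fun a ha => ?_, fun a ha s hs =>
    (hbox' s hs a ha).2.2.continuousAt⟩, Metric.mem_ball_self hR,
    Metric.ball_subset_ball (hRτ.trans hτδ), hτδ, hRτ.trans hτδ⟩
  exact
    { pos := fun t ht => (hbox t ht a (hsub ha)).2
      lt_one := (hRmin.trans (min_le_right _ _)).trans_lt one_half_lt_one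
      mem := fun s hs => (hbox' s hs a ha).2.1
      right_inv := fun s hs => (hbox' s hs a ha).1
      left_inv := fun t ht _ => (hbox t ht a (hsub ha)).1
      contDiffAt := fun s hs =>
        (hbox' s hs a ha).2.2.comp s (contDiffAt_id.prodMk contDiffAt_const) }

lemma exists_pos_forall_sqrt_wOfV_mem_ball (h : ℝ) (a₀ : ℝ × ℝ) {r : ℝ} (hr : 0 < r) :
    ∃ δ > 0, ∀ t V, |t| < δ → |V| < δ → ∀ a ∈ Metric.ball a₀ δ,
      (t * √(wOfV h a.1 a.2 t V), √(wOfV h a.1 a.2 t V)) ∈ Metric.ball ((0, 1) : ℝ × ℝ) r := by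
  have hw : ContinuousAt (fun x : ℝ × ℝ × ℝ × ℝ => √(wOfV h x.2.2.1 x.2.2.2 x.1 x.2.1))
      (0, 0, a₀) := by
    refine ContinuousAt.sqrt (ContinuousAt.div ?_ ?_ (by simp)) <;>
      unfold leadPoly axisPoly crossPoly <;> fun_prop
  have hev : ∀ᶠ x : ℝ × ℝ × ℝ × ℝ in 𝓝 (0, 0, a₀),
      (x.1 * √(wOfV h x.2.2.1 x.2.2.2 x.1 x.2.1), √(wOfV h x.2.2.1 x.2.2.2 x.1 x.2.1)) ∈
        Metric.ball ((0, 1) : ℝ × ℝ) r :=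
    ((continuousAt_fst.mul hw).prodMk hw).eventually_mem
      (Metric.isOpen_ball.mem_nhds (by simpa [wOfV] using hr))
  obtain ⟨δ, hδ, hball⟩ := Metric.eventually_nhds_iff.1 hev
  refine ⟨δ, hδ, fun t V ht hV a ha => @hball (t, V, a) ?_⟩
  rw [Metric.mem_ball] at ha
  rw [Prod.dist_eq, Prod.dist_eq]
  simpa using ⟨ht, hV, ha⟩

/-! ### The averaged function as an integral operator -/

lemma continuousAt_intervalIntegral_param {E : Type*} [TopologicalSpace E] {F : E → ℝ → ℝ} {θ : E}
    {a b : ℝ} (hc : ∀ φ ∈ uIcc a b, ContinuousAt (fun p : E × ℝ => F p.1 p.2) (θ, φ))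
    (hF : ∀ᶠ θ' in 𝓝 θ, Continuous (F θ')) :
    ContinuousAt (fun θ => ∫ φ in a..b, F θ φ) θ := by
  rw [Metric.continuousAt_iff']
  intro η hη
  have hclose := isCompact_uIcc.eventually_forall_of_forall_eventually (x₀ := θ)
    (K := uIcc a b) (P := fun θ' φ => |F θ' φ - F θ φ| < η / (|b - a| + 1)) fun φ hφ => by
      have hdiff := ((hc φ hφ).sub
        ((hc φ hφ).comp (f := fun p : E × ℝ => ((θ, p.2) : E × ℝ)) (by fun_prop))).abs
      exact hdiff.eventually_lt continuousAt_const (by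
        rw [Pi.sub_apply, Function.comp_apply, sub_self, abs_zero]
        positivity)
  filter_upwards [hclose, hF] with θ' hθ' hcont
  rw [dist_eq_norm, ← intervalIntegral.integral_sub (hcont.intervalIntegrable _ _)
    (hF.self_of_nhds.intervalIntegrable _ _)]
  have hbound := intervalIntegral.norm_integral_le_of_norm_le_const
    (f := fun φ => F θ' φ - F θ φ) (a := a) (b := b) (C := η / (|b - a| + 1))
    fun φ hφ => (hθ' φ (uIoc_subset_uIcc hφ)).le
  refine hbound.trans_lt ?_
  rw [div_mul_eq_mul_div, div_lt_iff₀ (by positivity)]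
  nlinarith [abs_nonneg (b - a)]

lemma continuous_cos_sq_mul_comp_sin {G : ℝ → ℝ} {ρ R : ℝ} (hρ : 0 ≤ ρ) (hρR : ρ < R)
    (hG : ∀ s, |s| < R → ContinuousAt G s) :
    Continuous fun φ => Real.cos φ ^ 2 * G (ρ * Real.sin φ) := by
  have hGsin : Continuous fun φ => G (ρ * Real.sin φ) := continuous_iff_continuousAt.2 fun φ =>
    (hG _ (abs_polarPoint_fst_lt hρ hρR φ)).comp (f := fun φ => ρ * Real.sin φ) (by fun_prop)
  exact (Real.continuous_cos.pow 2).mul hGsin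

lemma integral_two_pi_eq_integral_add {f : ℝ → ℝ} (hf : Continuous f) :
    ∫ φ in (0 : ℝ)..2 * Real.pi, f φ = ∫ φ in (0 : ℝ)..Real.pi, (f φ + f (φ + Real.pi)) := by
  have hshift := intervalIntegral.integral_comp_add_right (a := 0) (b := Real.pi) f Real.pi
  rw [zero_add, ← two_mul] at hshift
  rw [intervalIntegral.integral_add (hf.intervalIntegrable _ _)
    ((by fun_prop : Continuous fun φ => f (φ + Real.pi)).intervalIntegrable _ _), hshift,
    intervalIntegral.integral_add_adjacent_intervals (hf.intervalIntegrable _ _)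
    (hf.intervalIntegrable _ _)]

lemma intervalIntegral_pos_of_pos_on_ne {f : ℝ → ℝ} {a b c : ℝ} (hf : Continuous f) (hac : a < c)
    (hcb : c < b) (hpos : ∀ x ∈ Ioo a b, x ≠ c → 0 < f x) : 0 < ∫ x in a..b, f x := by
  rw [← intervalIntegral.integral_add_adjacent_intervals (hf.intervalIntegrable a c)
    (hf.intervalIntegrable c b)]
  exact add_pos
    (intervalIntegral.intervalIntegral_pos_of_pos_on (hf.intervalIntegrable _ _)
      (fun x hx => hpos x ⟨hx.1, hx.2.trans hcb⟩ hx.2.ne) hac)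
    (intervalIntegral.intervalIntegral_pos_of_pos_on (hf.intervalIntegrable _ _)
      (fun x hx => hpos x ⟨hac.trans hx.1, hx.2⟩ hx.1.ne') hcb)

lemma cos_sq_pos_of_ne_pi_div_two {φ : ℝ} (hφ : φ ∈ Ioo 0 Real.pi) (hne : φ ≠ Real.pi / 2) :
    0 < Real.cos φ ^ 2 := by
  rcases hne.lt_or_gt with hlt | hgt
  · exact pow_pos (Real.cos_pos_of_mem_Ioo ⟨by linarith [hφ.1, Real.pi_pos], hlt⟩) 2
  · exact sq_pos_of_neg
      (Real.cos_neg_of_pi_div_two_lt_of_lt hgt (by linarith [hφ.2, Real.pi_pos]))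

-- Adding the values at `φ` and `φ + π` leaves the even part of `G`.
lemma eventually_integral_cos_sq_pos {G : ℝ → ℝ} {R c : ℝ} (hR : 0 < R)
    (hG : ∀ s, |s| < R → ContinuousAt G s) (hpos : ∀ᶠ s in 𝓝[>] (0 : ℝ), 0 < c * (G s + G (-s))) :
    ∀ᶠ ρ in 𝓝[>] (0 : ℝ),
      0 < c * ∫ φ in (0 : ℝ)..2 * Real.pi, Real.cos φ ^ 2 * G (ρ * Real.sin φ) := by
  obtain ⟨δ, hδ, hδpos⟩ := mem_nhdsGT_iff_exists_Ioo_subset.1 hpos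
  filter_upwards [Ioo_mem_nhdsGT (lt_min hδ hR)] with ρ ⟨hρ, hρmin⟩
  obtain ⟨hρδ, hρR⟩ := lt_min_iff.1 hρmin
  have hcont := continuous_cos_sq_mul_comp_sin hρ.le hρR hG
  rw [integral_two_pi_eq_integral_add hcont, ← intervalIntegral.integral_const_mul]
  refine intervalIntegral_pos_of_pos_on_ne
    (continuous_const.mul (hcont.add (hcont.comp (continuous_add_const Real.pi))))
    (half_pos Real.pi_pos) (half_lt_self Real.pi_pos) fun φ hφ hne => ?_
  have hsin := Real.sin_pos_of_pos_of_lt_pi hφ.1 hφ.2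
  have heven : 0 < c * (G (ρ * Real.sin φ) + G (-(ρ * Real.sin φ))) :=
    hδpos ⟨mul_pos hρ hsin, (mul_le_of_le_one_right hρ.le (Real.sin_le_one φ)).trans_lt hρδ⟩
  rw [Real.cos_add_pi, Real.sin_add_pi, mul_neg, neg_sq, ← mul_add, mul_left_comm]
  exact mul_pos (cos_sq_pos_of_ne_pi_div_two hφ hne) heven

lemma hasDerivAt_integral_cos_sq {G : ℝ → ℝ} {R ρ : ℝ} (hρ : 0 < ρ) (hρR : ρ < R)
    (hG : ∀ s, |s| < R → ContDiffAt ℝ 1 G s) :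
    HasDerivAt (fun ρ => ∫ φ in (0 : ℝ)..2 * Real.pi, Real.cos φ ^ 2 * G (ρ * Real.sin φ))
      (∫ φ in (0 : ℝ)..2 * Real.pi, Real.cos φ ^ 2 * (deriv G (ρ * Real.sin φ) * Real.sin φ))
      ρ := by
  obtain ⟨r, hr, hr_lt⟩ := exists_between (lt_min hρ (sub_pos.2 hρR))
  obtain ⟨hrρ, hrR⟩ := lt_min_iff.1 hr_lt
  have hmem : ∀ x ∈ Icc (ρ - r) (ρ + r), ∀ φ, |x * Real.sin φ| < R := fun x hx =>
    abs_polarPoint_fst_lt (by linarith [hx.1]) (by linarith [hx.2])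
  have hderiv : ContinuousOn (deriv G) {s | |s| < R} :=
    ContDiffOn.continuousOn_deriv_of_isOpen (fun s hs => (hG s hs).contDiffWithinAt)
      (isOpen_lt continuous_abs continuous_const) le_rfl
  refine hasDerivAt_intervalIntegral_param (F := fun φ ρ => Real.cos φ ^ 2 * G (ρ * Real.sin φ))
    (F' := fun φ ρ => Real.cos φ ^ 2 * (deriv G (ρ * Real.sin φ) * Real.sin φ)) hr
    (fun x hx => ?_) ?_ fun φ x hx => ?_
  · exact continuous_cos_sq_mul_comp_sin (by linarith [hx.1]) (by linarith [hx.2])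
      fun s hs => (hG s hs).continuousAt
  · have hcomp : ContinuousOn (fun p : ℝ × ℝ => deriv G (p.2 * Real.sin p.1))
        (univ ×ˢ Icc (ρ - r) (ρ + r)) :=
      hderiv.comp (by fun_prop) fun p hp => hmem p.2 hp.2 p.1
    fun_prop
  · have hcomp := ((hG _ (hmem x hx φ)).differentiableAt one_ne_zero).hasDerivAt.comp x
      ((hasDerivAt_id x).mul_const (Real.sin φ))
    exact (hcomp.const_mul (Real.cos φ ^ 2)).congr_deriv (by simp)

-- The exceptional `c` are the critical values of `-N₁ / N₀`, a null set by Sard's theorem.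
lemma exists_forall_zero_simple {N₀ N₁ N₀' N₁' : ℝ → ℝ} {s : Set ℝ} {a b : ℝ} (hab : a < b)
    (h₀ : ∀ ρ ∈ s, HasDerivAt N₀ (N₀' ρ) ρ) (h₁ : ∀ ρ ∈ s, HasDerivAt N₁ (N₁' ρ) ρ)
    (hne : ∀ ρ ∈ s, N₀ ρ ≠ 0) :
    ∃ c ∈ Ioo a b, ∀ ρ ∈ s, c * N₀ ρ + N₁ ρ = 0 → c * N₀' ρ + N₁' ρ ≠ 0 := by
  set ψ : ℝ → ℝ := fun ρ => -N₁ ρ / N₀ ρ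
  set ψ' : ℝ → ℝ := fun ρ => (-N₁' ρ * N₀ ρ - -N₁ ρ * N₀' ρ) / N₀ ρ ^ 2
  have hψ : ∀ ρ ∈ s, HasDerivAt ψ (ψ' ρ) ρ := fun ρ hρ =>
    (h₁ ρ hρ).neg.div (h₀ ρ hρ) (hne ρ hρ)
  have hnull : volume (ψ '' {ρ ∈ s | ψ' ρ = 0}) = 0 := by
    refine addHaar_image_eq_zero_of_det_fderivWithin_eq_zero volume
      (f' := fun ρ => ContinuousLinearMap.toSpanSingleton ℝ (ψ' ρ))
      (fun ρ hρ => (hψ ρ hρ.1).hasFDerivAt.hasFDerivWithinAt) fun ρ hρ => ?_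
    rw [hρ.2]
    simp [ContinuousLinearMap.det]
  obtain ⟨c, hc, hcrit⟩ : (Ioo a b \ ψ '' {ρ ∈ s | ψ' ρ = 0}).Nonempty := by
    rw [sdiff_nonempty]
    intro hsub
    have := measure_mono_null hsub hnull
    rw [Real.volume_Ioo, ENNReal.ofReal_eq_zero] at this
    linarith
  refine ⟨c, hc, fun ρ hρ hz hz' => hcrit ⟨ρ, ⟨hρ, ?_⟩, ?_⟩⟩
  · refine div_eq_zero_iff.2 (Or.inl ?_)
    linear_combination N₀' ρ * hz - N₀ ρ * hz'
  · rw [div_eq_iff (hne ρ hρ)]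
    linarith

/-! ### Sign of the averaged function near the centre -/

lemma eventually_nhdsGT_mul_odd_pow_mul_pos {q : ℝ → ℝ} {c : ℝ} (hq : ContinuousAt q 0)
    (hc : 0 < c * q 0) (k : ℕ) : ∀ᶠ t in 𝓝[>] (0 : ℝ), 0 < c * (t ^ (2 * k + 1) * q t) := by
  have hqt : ∀ᶠ t in 𝓝[>] (0 : ℝ), 0 < c * q t := nhdsWithin_le_nhds
    ((continuousAt_const.mul hq).eventually (lt_mem_nhds hc))
  filter_upwards [hqt, self_mem_nhdsWithin] with t hqt ht
  rw [mul_left_comm]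
  exact mul_pos (pow_pos ht _) hqt

lemma eventually_nhdsLT_mul_odd_pow_mul_neg {q : ℝ → ℝ} {c : ℝ} (hq : ContinuousAt q 0)
    (hc : 0 < c * q 0) (k : ℕ) : ∀ᶠ t in 𝓝[<] (0 : ℝ), c * (t ^ (2 * k + 1) * q t) < 0 := by
  have hqt : ∀ᶠ t in 𝓝[<] (0 : ℝ), 0 < c * q t := nhdsWithin_le_nhds
    ((continuousAt_const.mul hq).eventually (lt_mem_nhds hc))
  filter_upwards [hqt, self_mem_nhdsWithin] with t hqt ht
  rw [mul_left_comm]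
  exact mul_neg_of_neg_of_pos ((odd_two_mul_add_one k).pow_neg ht) hqt

namespace IsChart

variable {h l n τ R c00 c02 c11 c20 c : ℝ} {T : ℝ → ℝ} (H : IsChart h l n T τ R)

include H

lemma apply_zero (hR : 0 < R) : T 0 = 0 := by
  have hτ : |(0 : ℝ)| < τ := by simpa using (abs_nonneg _).trans_lt (H.mem 0 (by simpa using hR))
  simpa using H.left_inv 0 hτ (by simpa using hR)

lemma apply_pos {s : ℝ} (hs : |s| < R) (hs0 : 0 < s) : 0 < T s := by
  rw [← H.right_inv s hs, sCoord] at hs0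
  by_contra! hT
  exact hs0.not_ge (div_nonpos_of_nonpos_of_nonneg
    (mul_nonpos_of_nonpos_of_nonneg (by linarith) (Real.sqrt_nonneg _)) (Real.sqrt_nonneg _))

lemma apply_neg {s : ℝ} (hs : |s| < R) (hs0 : s < 0) : T s < 0 := by
  rw [← H.right_inv s hs, sCoord] at hs0
  by_contra! hT
  exact hs0.not_ge (div_nonneg (mul_nonneg (by linarith) (Real.sqrt_nonneg _)) (Real.sqrt_nonneg _))

lemma tendsto_nhdsGT (hR : 0 < R) : Tendsto T (𝓝[>] 0) (𝓝[>] 0) := by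
  have hT := (H.contDiffAt 0 (by simpa using hR)).continuousAt.tendsto
  rw [H.apply_zero hR] at hT
  refine tendsto_nhdsWithin_iff.2 ⟨hT.mono_left nhdsWithin_le_nhds, ?_⟩
  filter_upwards [Ioo_mem_nhdsGT hR] with s hs
  exact H.apply_pos (abs_lt.2 ⟨by linarith [hs.1], hs.2⟩) hs.1

lemma tendsto_nhdsLT (hR : 0 < R) : Tendsto T (𝓝[<] 0) (𝓝[<] 0) := by
  have hT := (H.contDiffAt 0 (by simpa using hR)).continuousAt.tendsto
  rw [H.apply_zero hR] at hT
  refine tendsto_nhdsWithin_iff.2 ⟨hT.mono_left nhdsWithin_le_nhds, ?_⟩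
  filter_upwards [Ioo_mem_nhdsLT (neg_neg_of_pos hR)] with s hs
  exact H.apply_neg (abs_lt.2 ⟨hs.1, by linarith [hs.2]⟩) hs.2

lemma mul_sqrt_crossPoly_div_axisPoly {s : ℝ} (hs : |s| < R) :
    T s * √(crossPoly h n (T s)) / axisPoly l (T s) = s / (2 * √(1 - s ^ 2)) := by
  have ht := H.mem s hs
  obtain ⟨hC, hu, -⟩ := H.pos _ ht
  have hb := Real.sqrt_pos.2 (H.lead_pos ht)
  have hsq := one_sub_sCoord_sq (h := h) (n := n) hC hu
  have hS := H.right_inv s hs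
  rw [hS] at hsq
  rw [hsq, Real.sqrt_div (sq_nonneg _), Real.sqrt_sq hu.le]
  rw [sCoord, div_eq_iff hb.ne'] at hS
  field_simp
  linear_combination hS

lemma sq_mul_crossPoly_div_axisPoly_sq {s : ℝ} (hs : |s| < R) :
    T s ^ 2 * crossPoly h n (T s) / axisPoly l (T s) ^ 2 = (s / (2 * √(1 - s ^ 2))) ^ 2 := by
  rw [← H.mul_sqrt_crossPoly_div_axisPoly hs, div_pow, mul_pow,
    Real.sq_sqrt (H.pos _ (H.mem s hs)).1.le]

lemma meanKernel_comp_eq {f g : ℝ → ℝ} {s : ℝ} (hs : |s| < R)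
    (hfg : ∀ t, |t| < τ → c00 * leadPoly h l n t + divPoly c02 c11 c20 t * axisPoly l t =
      t * slopePoly h l n t * (f (t ^ 2 * crossPoly h n t / axisPoly l t ^ 2) + g t)) :
    meanKernel h l n c00 c02 c11 c20 (T s) =
      s / (2 * √(1 - s ^ 2)) * (f ((s / (2 * √(1 - s ^ 2))) ^ 2) + g (T s)) := by
  obtain ⟨-, hu, hK⟩ := H.pos _ (H.mem s hs)
  rw [meanKernel, hfg _ (H.mem s hs), H.sq_mul_crossPoly_div_axisPoly_sq hs,
    ← H.mul_sqrt_crossPoly_div_axisPoly hs]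
  field_simp

-- `Y = t √C / u` is an odd function of `s`, so that `Y f(Y²)` does not contribute to the even part
-- of the kernel, and the sign is that of the remainder `Y t ^ (2 k + 1) q(0)`.
lemma eventually_mul_meanFun_pos (hR : 0 < R) {f q : ℝ → ℝ} {k : ℕ}
    (hq : ContinuousAt q 0) (hc : 0 < c * q 0)
    (hfq : ∀ t, |t| < τ → c00 * leadPoly h l n t + divPoly c02 c11 c20 t * axisPoly l t =
      t * slopePoly h l n t *
        (f (t ^ 2 * crossPoly h n t / axisPoly l t ^ 2) + t ^ (2 * k + 1) * q t)) :
    ∀ᶠ ρ in 𝓝[>] (0 : ℝ), 0 < c * meanFun h l n c00 c02 c11 c20 T ρ := by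
  refine eventually_integral_cos_sq_pos hR
    (fun s hs => (H.contDiffAt_meanKernel_comp hs).continuousAt) ?_
  have hneg : Tendsto (fun s : ℝ => -s) (𝓝[>] 0) (𝓝[<] 0) := by
    simpa using tendsto_neg_nhdsGT (a := (0 : ℝ))
  filter_upwards [Ioo_mem_nhdsGT hR,
    (H.tendsto_nhdsGT hR).eventually (eventually_nhdsGT_mul_odd_pow_mul_pos hq hc k),
    ((H.tendsto_nhdsLT hR).comp hneg).eventually (eventually_nhdsLT_mul_odd_pow_mul_neg hq hc k)]
    with s hs hright hleft
  have hsR : |s| < R := abs_lt.2 ⟨by linarith [hs.1], hs.2⟩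
  have hsqrt : 0 < √(1 - s ^ 2) := Real.sqrt_pos.2 (by nlinarith [hs.1, hs.2, H.lt_one])
  have hY : 0 < s / (2 * √(1 - s ^ 2)) := div_pos hs.1 (by positivity)
  rw [H.meanKernel_comp_eq hsR hfq, H.meanKernel_comp_eq (by rwa [abs_neg]) hfq, neg_sq, neg_div,
    neg_sq (s / _)]
  simp only [Function.comp_apply] at hleft
  linarith [mul_pos hY (sub_pos.2 (hleft.trans hright))]

lemma eventually_mul_meanFun_pos_of_c00 (hR : 0 < R) (hc : 0 < c * (c00 + c02)) :
    ∀ᶠ ρ in 𝓝[>] (0 : ℝ), 0 < c * meanFun h l n c00 c02 c11 c20 T ρ := by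
  have hcont : ∀ s, |s| < R →
      ContinuousAt (fun s => meanKernel h l n c00 c02 c11 c20 (T s)) s :=
    fun s hs => (H.contDiffAt_meanKernel_comp hs).continuousAt
  refine eventually_integral_cos_sq_pos hR hcont ?_
  have hcont₀ := hcont 0 (by simpa using hR)
  have hcont_neg : ContinuousAt (fun s => meanKernel h l n c00 c02 c11 c20 (T (-s))) 0 := by
    refine ContinuousAt.comp (f := fun s : ℝ => -s)
      (g := fun s => meanKernel h l n c00 c02 c11 c20 (T s)) ?_ (by fun_prop)
    simpa using hcont₀
  refine nhdsWithin_le_nhds ((continuousAt_const.mul (hcont₀.add hcont_neg)).eventually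
    (lt_mem_nhds ?_))
  simp only [Pi.mul_apply, Pi.add_apply, neg_zero, H.apply_zero hR, meanKernel, crossPoly_zero,
    leadPoly_zero, axisPoly_zero, slopePoly_zero, divPoly, Real.sqrt_one]
  linarith

lemma eventually_mul_meanFun_pos_of_c20 (hR : 0 < R) (h00 : c00 = -c02)
    (hc : 0 < c * (c20 - (3 * h * c11 + (4 - l) * c02))) :
    ∀ᶠ ρ in 𝓝[>] (0 : ℝ), 0 < c * meanFun h l n c00 c02 c11 c20 T ρ := by
  refine H.eventually_mul_meanFun_pos hR (f := fun _ => c11 / 2) (k := 0)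
    (q := fun t => ((c20 + c02 * (l - 4) - 3 * h * c11) +
      (-8 * h * c02 - l * c11 - c11 * (l - 2 * n)) * t +
      (-c02 * (l ^ 2 - 4 * n) - l * c20 - c11 * l * h) * t ^ 2) / slopePoly h l n t) ?_ ?_ ?_
  · exact ContinuousAt.div (by fun_prop) (contDiff_slopePoly h l n).continuous.continuousAt
      (by simp)
  · simp only [slopePoly_zero]
    linarith
  · intro t ht
    have hK := (H.pos t ht).2.2.ne'
    subst h00
    field_simp
    simp only [leadPoly, divPoly, axisPoly, crossPoly, slopePoly]
    ring

end IsChart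

/-- The coefficient `k₀` in `t ² (k₀ + k₁ t)`, which is what remains of the numerator of
`meanKernel / t` after subtracting a multiple of `slopePoly`, when `c₀₀` and `c₂₀` have the values
for which the two lowest even terms of `meanKernel` vanish; see `kernel_numerator_eq`. -/
def kernelCoeffZero (h l n c02 c11 : ℝ) : ℝ := -8 * h * c02 - 2 * l * c11 + 2 * n * c11

/-- The coefficient `k₁` accompanying `kernelCoeffZero`. -/
def kernelCoeffOne (h l n c02 c11 : ℝ) : ℝ := 4 * n * c02 - 4 * l * c02 - 4 * h * l * c11

lemma kernel_numerator_eq (h l n c02 c11 t : ℝ) :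
    -c02 * leadPoly h l n t + divPoly c02 c11 (3 * h * c11 + (4 - l) * c02) t * axisPoly l t =
      t * (slopePoly h l n t * (c11 / 2) +
        t ^ 2 * (kernelCoeffZero h l n c02 c11 + kernelCoeffOne h l n c02 c11 * t)) := by
  simp only [leadPoly, divPoly, axisPoly, crossPoly, slopePoly, kernelCoeffZero, kernelCoeffOne]
  ring

-- In the next three lemmas the coefficients of the powers of `t² C` are those for which the Taylor
-- coefficients at `t = 0` agree up to the stated order; `r` is the quotient.

lemma exists_axisPoly_pow_four_eq (h l n : ℝ) :
    ∃ r : ℝ → ℝ, Continuous r ∧ r 0 = h * (8 * l - 14 * n + 42 * h ^ 2) ∧ ∀ t,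
      2 * (1 + 5 * h * t) * axisPoly l t ^ 4 = crossPoly h n t * slopePoly h l n t *
        (axisPoly l t ^ 2 + (-3 * l + 3 * n - 6 * h ^ 2) * (t ^ 2 * crossPoly h n t)) +
          2 * t ^ 3 * r t := by
  refine ⟨fun t =>
    (8 * h * l - 14 * h * n + 42 * h ^ 3) + (-20 * l * n + 10 * l ^ 2 + 10 * n ^ 2 + 64 * h ^ 2 *
    l - 72 * h ^ 2 * n + 96 * h ^ 4) * t + (-82 * h * l * n + 46 * h * l ^ 2 + 54 * h * n ^ 2 +
    66 * h ^ 3 * l - 144 * h ^ 3 * n + 72 * h ^ 5) * t ^ 2 + (25 * l * n ^ 2 - 5 * l ^ 2 * n - 5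
    * l ^ 3 - 15 * n ^ 3 - 96 * h ^ 2 * l * n + 22 * h ^ 2 * l ^ 2 + 90 * h ^ 2 * n ^ 2 + 48 * h
    ^ 4 * l - 120 * h ^ 4 * n) * t ^ 3 + (51 * h * l * n ^ 2 - 13 * h * l ^ 2 * n - 23 * h * l ^
    3 - 33 * h * n ^ 3 - 48 * h ^ 3 * l * n + 12 * h ^ 3 * l ^ 2 + 66 * h ^ 3 * n ^ 2 + 24 * h ^
    5 * l) * t ^ 4 + (-9 * l * n ^ 3 + l ^ 2 * n ^ 2 + l ^ 3 * n + l ^ 4 + 6 * n ^ 4 + 18 * h ^ 2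
    * l * n ^ 2 - 12 * h ^ 2 * l ^ 2 * n - 2 * h ^ 2 * l ^ 3 - 12 * h ^ 2 * n ^ 3 - 24 * h ^ 4 *
    l * n) * t ^ 5 + (-3 * h * l * n ^ 3 + 3 * h * l ^ 2 * n ^ 2 + h * l ^ 3 * n + 5 * h * l ^ 4
    + 6 * h ^ 3 * l * n ^ 2) * t ^ 6,
    by fun_prop, by ring, fun t => ?_⟩
  simp only [axisPoly, crossPoly, slopePoly]
  ring

lemma exists_axisPoly_pow_six_eq (h m : ℝ) :
    ∃ r : ℝ → ℝ, Continuous r ∧ r 0 = 12 * h * (m ^ 2 - 30 * h ^ 2 * m + 33 * h ^ 4) ∧ ∀ t,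
      2 * (1 + 5 * h * t) * axisPoly (7 * m) t ^ 6 =
        crossPoly h (3 * h ^ 2 + 4 * m) t * slopePoly h (7 * m) (3 * h ^ 2 + 4 * m) t *
        (axisPoly (7 * m) t ^ 4 +
          (3 * h ^ 2 - 9 * m) * (t ^ 2 * crossPoly h (3 * h ^ 2 + 4 * m) t) *
            axisPoly (7 * m) t ^ 2 +
          (90 * m ^ 2 - 20 * h ^ 2 * m - 30 * h ^ 4) *
            (t ^ 2 * crossPoly h (3 * h ^ 2 + 4 * m) t) ^ 2) + 2 * t ^ 5 * r t := by
  refine ⟨fun t =>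
    (12 * h * m ^ 2 - 360 * h ^ 3 * m + 396 * h ^ 5) + (-945 * m ^ 3 - 195 * h ^ 2 * m ^ 2 + 285
    * h ^ 4 * m + 495 * h ^ 6) * t + (-10875 * h * m ^ 3 + 13055 * h ^ 3 * m ^ 2 - 4961 * h ^ 5 *
    m - 1947 * h ^ 7) * t ^ 2 + (13041 * m ^ 4 - 18909 * h ^ 2 * m ^ 3 + 8451 * h ^ 4 * m ^ 2 -
    2895 * h ^ 6 * m - 3168 * h ^ 8) * t ^ 3 + (132021 * h * m ^ 4 - 100815 * h ^ 3 * m ^ 3 + 365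
    * h ^ 5 * m ^ 2 + 24459 * h ^ 7 * m + 5850 * h ^ 9) * t ^ 4 + (-60669 * m ^ 5 + 155421 * h ^
    2 * m ^ 4 + 17451 * h ^ 4 * m ^ 3 - 33215 * h ^ 6 * m ^ 2 + 1302 * h ^ 8 * m + 5670 * h ^ 10)
    * t ^ 5 + (-540723 * h * m ^ 5 + 166695 * h ^ 3 * m ^ 4 + 117585 * h ^ 5 * m ^ 3 - 31077 * h
    ^ 7 * m ^ 2 - 47250 * h ^ 9 * m - 12150 * h ^ 11) * t ^ 6 + (95229 * m ^ 6 - 305121 * h ^ 2 *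
    m ^ 5 - 265911 * h ^ 4 * m ^ 4 - 8145 * h ^ 6 * m ^ 3 + 73818 * h ^ 8 * m ^ 2 + 34830 * h ^
    10 * m + 4860 * h ^ 12) * t ^ 7 + (745185 * h * m ^ 6 + 189805 * h ^ 3 * m ^ 5 + 37527 * h ^
    5 * m ^ 4 - 37611 * h ^ 7 * m ^ 3 - 26460 * h ^ 9 * m ^ 2 - 5670 * h ^ 11 * m) * t ^ 8,
    by fun_prop, by ring, fun t => ?_⟩
  simp only [axisPoly, crossPoly, slopePoly]
  ring

lemma exists_axisPoly_pow_eight_eq {w : ℝ} (hw : w ^ 2 = 3) :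
    ∃ r : ℝ → ℝ, Continuous r ∧ r 0 = 442368 + 253952 * w ∧ ∀ t,
      2 * (1 + 5 * t) * axisPoly (105 + 56 * w) t ^ 8 =
        crossPoly 1 (63 + 32 * w) t * slopePoly 1 (105 + 56 * w) (63 + 32 * w) t *
        (axisPoly (105 + 56 * w) t ^ 6 +
          (-132 - 72 * w) * (t ^ 2 * crossPoly 1 (63 + 32 * w) t) *
            axisPoly (105 + 56 * w) t ^ 4 +
          (37200 + 21440 * w) * (t ^ 2 * crossPoly 1 (63 + 32 * w) t) ^ 2 *
            axisPoly (105 + 56 * w) t ^ 2 +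
          (-11430720 - 6599040 * w) * (t ^ 2 * crossPoly 1 (63 + 32 * w) t) ^ 3) +
        2 * t ^ 7 * r t := by
  refine ⟨fun t =>
    (442368 + 253952 * w) + (3650865408 + 2107815936 * w) * t + (46755378432 + 26994210816 * w) *
    t ^ 2 + (-1757053197312 - 1014435028992 * w) * t ^ 3 + (-21887509404672 - 12636758827008 * w)
    * t ^ 4 + (324608719670784 + 187412932497408 * w) * t ^ 5 + (3877068194366976 +
    2238426360188928 * w) * t ^ 6 + (-27319846621326336 - 15773120814882816 * w) * t ^ 7 +
    (-308505472704285696 - 178115717683298304 * w) * t ^ 8 + (884336790468079872 +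
    510572084082407424 * w) * t ^ 9 + (9309564618288770304 + 5374879638320166912 * w) * t ^ 10,
    by fun_prop, by ring, fun t => ?_⟩
  simp only [axisPoly, crossPoly, slopePoly]
  grind

lemma exists_axisPoly_pow_eight_eq_scaled {w : ℝ} (hw : w ^ 2 = 3) (h : ℝ) :
    ∃ r : ℝ → ℝ, Continuous r ∧ r 0 = h ^ 7 * (442368 + 253952 * w) ∧ ∀ t,
      2 * (1 + 5 * h * t) * axisPoly ((105 + 56 * w) * h ^ 2) t ^ 8 =
        crossPoly h ((63 + 32 * w) * h ^ 2) t *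
          slopePoly h ((105 + 56 * w) * h ^ 2) ((63 + 32 * w) * h ^ 2) t *
        (axisPoly ((105 + 56 * w) * h ^ 2) t ^ 6 +
          (-132 - 72 * w) * h ^ 2 * (t ^ 2 * crossPoly h ((63 + 32 * w) * h ^ 2) t) *
            axisPoly ((105 + 56 * w) * h ^ 2) t ^ 4 +
          (37200 + 21440 * w) * h ^ 4 * (t ^ 2 * crossPoly h ((63 + 32 * w) * h ^ 2) t) ^ 2 *
            axisPoly ((105 + 56 * w) * h ^ 2) t ^ 2 +
          (-11430720 - 6599040 * w) * h ^ 6 *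
            (t ^ 2 * crossPoly h ((63 + 32 * w) * h ^ 2) t) ^ 3) +
        2 * t ^ 7 * r t := by
  obtain ⟨r, hr, hr0, hrt⟩ := exists_axisPoly_pow_eight_eq hw
  refine ⟨fun t => h ^ 7 * r (h * t), by fun_prop, by simp [hr0], fun t => ?_⟩
  have haxis : axisPoly (105 + 56 * w) (h * t) = axisPoly ((105 + 56 * w) * h ^ 2) t := by
    simp only [axisPoly]
    ring
  have hcross : crossPoly 1 (63 + 32 * w) (h * t) = crossPoly h ((63 + 32 * w) * h ^ 2) t := by
    simp only [crossPoly]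
    ring
  have hslope : slopePoly 1 (105 + 56 * w) (63 + 32 * w) (h * t) =
      slopePoly h ((105 + 56 * w) * h ^ 2) ((63 + 32 * w) * h ^ 2) t := by
    simp only [slopePoly]
    ring
  have hrht := hrt (h * t)
  rw [haxis, hcross, hslope] at hrht
  linear_combination hrht

namespace IsChart

variable {h l n τ R c02 c11 c : ℝ} {T : ℝ → ℝ} (H : IsChart h l n T τ R)

include H

lemma eventually_mul_meanFun_pos_of_kernelCoeff (hR : 0 < R) {f q : ℝ → ℝ} {k : ℕ}
    (hq : ContinuousAt q 0) (hc : 0 < c * q 0)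
    (hfq : ∀ t, 0 < slopePoly h l n t → 0 < axisPoly l t →
      t ^ 2 * (kernelCoeffZero h l n c02 c11 + kernelCoeffOne h l n c02 c11 * t) =
      slopePoly h l n t *
        (f (t ^ 2 * crossPoly h n t / axisPoly l t ^ 2) + t ^ (2 * k + 1) * q t)) :
    ∀ᶠ ρ in 𝓝[>] (0 : ℝ),
      0 < c * meanFun h l n (-c02) c02 c11 (3 * h * c11 + (4 - l) * c02) T ρ := by
  refine H.eventually_mul_meanFun_pos hR (f := fun Y => c11 / 2 + f Y) (k := k) hq hc
    fun t ht => ?_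
  obtain ⟨-, hu, hK⟩ := H.pos t ht
  rw [kernel_numerator_eq, hfq t hK hu]
  ring

lemma eventually_mul_meanFun_pos_of_c02 (hR : 0 < R)
    (hc : 0 < c * (kernelCoeffOne h l n c02 c11 - 5 * h * kernelCoeffZero h l n c02 c11)) :
    ∀ᶠ ρ in 𝓝[>] (0 : ℝ),
      0 < c * meanFun h l n (-c02) c02 c11 (3 * h * c11 + (4 - l) * c02) T ρ := by
  set k₀ := kernelCoeffZero h l n c02 c11 with hk₀
  set k₁ := kernelCoeffOne h l n c02 c11 with hk₁
  refine H.eventually_mul_meanFun_pos_of_kernelCoeff hR (f := fun Y => k₀ / 2 * Y) (k := 1)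
    (q := fun t => ((k₁ - 5 * h * k₀) + k₀ * (-3 * l + 3 * n - 6 * h ^ 2) * t +
      (-2 * k₁ * l - 3 * k₀ * h * l + 7 * k₀ * h * n) * t ^ 2 +
      k₀ * (l * n + l ^ 2 - 2 * n ^ 2 - 2 * h ^ 2 * l) * t ^ 3 +
      (k₁ * l ^ 2 + k₀ * h * l * n) * t ^ 4) / (slopePoly h l n t * axisPoly l t ^ 2)) ?_ ?_ ?_
  · exact ContinuousAt.div (by fun_prop) ((contDiff_slopePoly h l n).continuous.continuousAt.mul
      ((contDiff_axisPoly l).continuous.continuousAt.pow 2)) (by simp)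
  · simp only [slopePoly_zero, axisPoly_zero]
    linarith
  · intro t hK hu
    rw [← hk₀, ← hk₁]
    clear_value k₀ k₁
    field_simp
    simp only [axisPoly, crossPoly, slopePoly]
    ring

lemma eventually_mul_meanFun_pos_of_remainder (hR : 0 < R)
    (hk : kernelCoeffOne h l n c02 c11 = 5 * h * kernelCoeffZero h l n c02 c11)
    {f r : ℝ → ℝ} {k : ℕ} (hr : Continuous r) (hc : 0 < c * (kernelCoeffZero h l n c02 c11 * r 0))
    (hfr : ∀ t, 0 < axisPoly l t → 2 * t ^ 2 * (1 + 5 * h * t) * axisPoly l t ^ (2 * k) =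
      slopePoly h l n t * (f (t ^ 2 * crossPoly h n t / axisPoly l t ^ 2) * axisPoly l t ^ (2 * k))
        + 2 * t ^ (2 * k + 1) * r t) :
    ∀ᶠ ρ in 𝓝[>] (0 : ℝ),
      0 < c * meanFun h l n (-c02) c02 c11 (3 * h * c11 + (4 - l) * c02) T ρ := by
  refine H.eventually_mul_meanFun_pos_of_kernelCoeff hR (k := k)
    (f := fun Y => kernelCoeffZero h l n c02 c11 / 2 * f Y)
    (q := fun t => kernelCoeffZero h l n c02 c11 * r t /
      (slopePoly h l n t * axisPoly l t ^ (2 * k))) ?_ ?_ fun t hK hu => ?_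
  · exact (hr.const_mul _).continuousAt.div
      ((contDiff_slopePoly h l n).continuous.continuousAt.mul
        ((contDiff_axisPoly l).continuous.continuousAt.pow (2 * k))) (by simp)
  · simp only [slopePoly_zero, axisPoly_zero, one_pow]
    linarith
  · rw [hk]
    have hu' := pow_pos hu (2 * k)
    have hfrt := hfr t hu
    generalize axisPoly l t ^ (2 * k) = a at *
    field_simp
    linear_combination kernelCoeffZero h l n c02 c11 * hfrt

lemma eventually_mul_meanFun_pos_of_n (hR : 0 < R)
    (hk : kernelCoeffOne h l n c02 c11 = 5 * h * kernelCoeffZero h l n c02 c11)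
    (hc : 0 < c * (kernelCoeffZero h l n c02 c11 * (h * (8 * l - 14 * n + 42 * h ^ 2)))) :
    ∀ᶠ ρ in 𝓝[>] (0 : ℝ),
      0 < c * meanFun h l n (-c02) c02 c11 (3 * h * c11 + (4 - l) * c02) T ρ := by
  obtain ⟨r, hr, hr0, hrt⟩ := exists_axisPoly_pow_four_eq h l n
  refine H.eventually_mul_meanFun_pos_of_remainder hR hk (k := 2)
    (f := fun Y => Y + (-3 * l + 3 * n - 6 * h ^ 2) * Y ^ 2) hr (by rwa [hr0]) fun t hu => ?_
  have hu' := hu.ne'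
  have hrt := hrt t
  generalize axisPoly l t = u at *
  generalize crossPoly h n t = C at *
  have hY : (t ^ 2 * C / u ^ 2 + (-3 * l + 3 * n - 6 * h ^ 2) * (t ^ 2 * C / u ^ 2) ^ 2) * u ^ 4 =
      t ^ 2 * C * (u ^ 2 + (-3 * l + 3 * n - 6 * h ^ 2) * (t ^ 2 * C)) := by
    field_simp
  linear_combination t ^ 2 * hrt - slopePoly h l n t * hY

lemma eventually_mul_meanFun_pos_of_l (hR : 0 < R)
    (hk : kernelCoeffOne h l n c02 c11 = 5 * h * kernelCoeffZero h l n c02 c11)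
    (hn : n = 3 * h ^ 2 + 4 * l / 7)
    (hc : 0 < c * (kernelCoeffZero h l n c02 c11 *
      (h * (l ^ 2 - 210 * h ^ 2 * l + 1617 * h ^ 4)))) :
    ∀ᶠ ρ in 𝓝[>] (0 : ℝ),
      0 < c * meanFun h l n (-c02) c02 c11 (3 * h * c11 + (4 - l) * c02) T ρ := by
  obtain ⟨m, rfl⟩ : ∃ m, l = 7 * m := ⟨l / 7, by ring⟩
  obtain rfl : n = 3 * h ^ 2 + 4 * m := by rw [hn]; ring
  obtain ⟨r, hr, hr0, hrt⟩ := exists_axisPoly_pow_six_eq h m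
  refine H.eventually_mul_meanFun_pos_of_remainder hR hk (k := 3)
    (f := fun Y => Y + (3 * h ^ 2 - 9 * m) * Y ^ 2 +
      (90 * m ^ 2 - 20 * h ^ 2 * m - 30 * h ^ 4) * Y ^ 3) hr ?_ fun t hu => ?_
  · rw [hr0]
    linarith
  · have hu' := hu.ne'
    have hrt := hrt t
    generalize axisPoly (7 * m) t = u at *
    generalize crossPoly h (3 * h ^ 2 + 4 * m) t = C at *
    generalize 3 * h ^ 2 - 9 * m = α at *
    generalize 90 * m ^ 2 - 20 * h ^ 2 * m - 30 * h ^ 4 = β at *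
    have hY : (t ^ 2 * C / u ^ 2 + α * (t ^ 2 * C / u ^ 2) ^ 2 + β * (t ^ 2 * C / u ^ 2) ^ 3) *
        u ^ 6 = t ^ 2 * C * (u ^ 4 + α * (t ^ 2 * C) * u ^ 2 + β * (t ^ 2 * C) ^ 2) := by
      field_simp
    linear_combination t ^ 2 * hrt - slopePoly h (7 * m) (3 * h ^ 2 + 4 * m) t * hY

end IsChart

lemma IsChart.eventually_mul_meanFun_pos_of_sq_eq_three {h c02 c11 c τ R w : ℝ} {T : ℝ → ℝ}
    (hw : w ^ 2 = 3) (H : IsChart h ((105 + 56 * w) * h ^ 2) ((63 + 32 * w) * h ^ 2) T τ R)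
    (hR : 0 < R)
    (hk : kernelCoeffOne h ((105 + 56 * w) * h ^ 2) ((63 + 32 * w) * h ^ 2) c02 c11 =
      5 * h * kernelCoeffZero h ((105 + 56 * w) * h ^ 2) ((63 + 32 * w) * h ^ 2) c02 c11)
    (hc : 0 < c * (kernelCoeffZero h ((105 + 56 * w) * h ^ 2) ((63 + 32 * w) * h ^ 2) c02 c11 *
      (h ^ 7 * (442368 + 253952 * w)))) :
    ∀ᶠ ρ in 𝓝[>] (0 : ℝ), 0 < c * meanFun h ((105 + 56 * w) * h ^ 2) ((63 + 32 * w) * h ^ 2)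
      (-c02) c02 c11 (3 * h * c11 + (4 - (105 + 56 * w) * h ^ 2) * c02) T ρ := by
  obtain ⟨r, hr, hr0, hrt⟩ := exists_axisPoly_pow_eight_eq_scaled hw h
  refine H.eventually_mul_meanFun_pos_of_remainder hR hk (k := 4)
    (f := fun Y => Y + (-132 - 72 * w) * h ^ 2 * Y ^ 2 + (37200 + 21440 * w) * h ^ 4 * Y ^ 3 +
      (-11430720 - 6599040 * w) * h ^ 6 * Y ^ 4) hr (by rwa [hr0]) fun t hu => ?_
  have hu' := hu.ne'
  have hrt := hrt t
  generalize slopePoly h ((105 + 56 * w) * h ^ 2) ((63 + 32 * w) * h ^ 2) t = K at *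
  generalize crossPoly h ((63 + 32 * w) * h ^ 2) t = C at *
  generalize axisPoly ((105 + 56 * w) * h ^ 2) t = u at *
  generalize (-132 - 72 * w) * h ^ 2 = α at *
  generalize (37200 + 21440 * w) * h ^ 4 = β at *
  generalize (-11430720 - 6599040 * w) * h ^ 6 = γ at *
  have hY : (t ^ 2 * C / u ^ 2 + α * (t ^ 2 * C / u ^ 2) ^ 2 + β * (t ^ 2 * C / u ^ 2) ^ 3 +
      γ * (t ^ 2 * C / u ^ 2) ^ 4) * u ^ 8 = t ^ 2 * C *
        (u ^ 6 + α * (t ^ 2 * C) * u ^ 4 + β * (t ^ 2 * C) ^ 2 * u ^ 2 + γ * (t ^ 2 * C) ^ 3) := by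
    field_simp
  linear_combination t ^ 2 * hrt - K * hY

/-! ### Creating sign changes -/

/-- `f` has the signs of `σ, -σ, σ, …` at `m + 1` points that decrease within `(0, R)`. -/
def Alternates (f : ℝ → ℝ) (R σ : ℝ) (m : ℕ) : Prop :=
  ∃ x : ℕ → ℝ, (∀ i ≤ m, x i ∈ Ioo 0 R ∧ 0 < σ * (-1) ^ i * f (x i)) ∧ ∀ i < m, x (i + 1) < x i

lemma alternates_zero_of_eventually {f : ℝ → ℝ} {R σ : ℝ} (hR : 0 < R)
    (h : ∀ᶠ ρ in 𝓝[>] (0 : ℝ), 0 < σ * f ρ) : Alternates f R σ 0 := by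
  obtain ⟨y, hy, hyR⟩ := (h.and (Ioo_mem_nhdsGT hR)).exists
  refine ⟨fun _ => y, fun i hi => ⟨hyR, ?_⟩, by simp⟩
  simpa [Nat.le_zero.1 hi] using hy

lemma Alternates.eventually {E : Type*} [TopologicalSpace E] {N : E → ℝ → ℝ} {R σ : ℝ} {m : ℕ}
    {θ : E} (ha : Alternates (N θ) R σ m) (hN : ∀ ρ ∈ Ioo 0 R, ContinuousAt (fun θ => N θ ρ) θ) :
    ∀ᶠ θ' in 𝓝 θ, Alternates (N θ') R σ m := by
  obtain ⟨x, hx, hlt⟩ := ha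
  have hsigns : ∀ᶠ θ' in 𝓝 θ, ∀ i ∈ Iic m, 0 < σ * (-1) ^ i * N θ' (x i) :=
    (eventually_all_finite (finite_Iic m)).2 fun i hi =>
      (continuousAt_const.mul (hN _ (hx i hi).1)).eventually (lt_mem_nhds (hx i hi).2)
  filter_upwards [hsigns] with θ' hθ'
  exact ⟨x, fun i hi => ⟨(hx i hi).1, hθ' i hi⟩, hlt⟩

lemma Alternates.succ {f : ℝ → ℝ} {R σ : ℝ} {m : ℕ} (ha : Alternates f R σ m)
    (h : ∀ᶠ ρ in 𝓝[>] (0 : ℝ), 0 < σ * (-1) ^ (m + 1) * f ρ) : Alternates f R σ (m + 1) := by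
  obtain ⟨x, hx, hlt⟩ := ha
  obtain ⟨hxm, hxmR⟩ := (hx m le_rfl).1
  obtain ⟨y, hy, hyx⟩ := (h.and (Ioo_mem_nhdsGT hxm)).exists
  refine ⟨fun i => if i ≤ m then x i else y, fun i hi => ?_, fun i hi => ?_⟩
  · rcases Nat.lt_or_ge m i with him | him
    · obtain rfl : i = m + 1 := by omega
      simp only [if_neg (not_le.2 him)]
      exact ⟨⟨hyx.1, hyx.2.trans hxmR⟩, hy⟩
    · simpa only [if_pos him] using hx i him
  · rcases Nat.lt_or_ge i m with him | him
    · simpa only [if_pos him.le, if_pos (Nat.succ_le_of_lt him)] using hlt i him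
    · obtain rfl : i = m := by omega
      simpa using hyx.2

lemma frequently_mul_sub_pos {k : ℝ → ℝ} {x₀ c : ℝ} (hk : ContinuousAt k x₀) (hk0 : k x₀ ≠ 0)
    (hc : c ≠ 0) : ∃ᶠ x in 𝓝 x₀, 0 < c * ((x - x₀) * k x) := by
  have hsign : ∀ᶠ x in 𝓝 x₀, 0 < c * k x₀ * (c * k x) :=
    (continuousAt_const.mul (continuousAt_const.mul hk)).eventually
      (lt_mem_nhds (mul_self_pos.2 (mul_ne_zero hc hk0)))
  have hlim : Tendsto (fun t => x₀ + t * (c * k x₀)) (𝓝[>] 0) (𝓝 x₀) := by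
    have hcont : ContinuousAt (fun t => x₀ + t * (c * k x₀)) 0 := by fun_prop
    simpa using hcont.tendsto.mono_left nhdsWithin_le_nhds
  refine hlim.frequently (((hlim.eventually hsign).and self_mem_nhdsWithin).frequently.mono ?_)
  rintro t ⟨hpos, ht⟩
  calc 0 < t * (c * k x₀ * (c * k (x₀ + t * (c * k x₀)))) := mul_pos ht hpos
    _ = c * ((x₀ + t * (c * k x₀) - x₀) * k (x₀ + t * (c * k x₀))) := by ring

-- Along the curve `γ` the sign of `N` near `0` changes when the parameter passes `x₀`, so moving
-- off `x₀` to the suitable side creates one more sign change.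
lemma Alternates.frequently_of_curve {E : Type*} [TopologicalSpace E] {N : E → ℝ → ℝ} {γ : ℝ → E}
    {k : ℝ → ℝ} {x₀ R σ : ℝ} {m : ℕ} {Q : E → Prop} (ha : Alternates (N (γ x₀)) R σ m)
    (hσ : σ ≠ 0) (hN : ∀ ρ ∈ Ioo 0 R, ContinuousAt (fun θ => N θ ρ) (γ x₀))
    (hγ : ContinuousAt γ x₀) (hk : ContinuousAt k x₀) (hk0 : k x₀ ≠ 0)
    (hsign : ∀ᶠ x in 𝓝 x₀, ∀ c, 0 < c * ((x - x₀) * k x) →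
      ∀ᶠ ρ in 𝓝[>] (0 : ℝ), 0 < c * N (γ x) ρ)
    (hQ : ∀ᶠ x in 𝓝 x₀, Alternates (N (γ x)) R σ (m + 1) → ∃ᶠ θ in 𝓝 (γ x), Q θ) :
    ∃ᶠ θ in 𝓝 (γ x₀), Q θ := by
  have hpos := frequently_mul_sub_pos hk hk0
    (mul_ne_zero hσ (pow_ne_zero (m + 1) (neg_ne_zero.2 one_ne_zero)))
  have halt := ha.eventually (N := fun x => N (γ x))
    fun ρ hρ => ContinuousAt.comp (f := γ) (g := fun θ => N θ ρ) (hN ρ hρ) hγ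
  refine frequently_frequently_nhds.1 (hγ.tendsto.frequently
    ((hpos.and_eventually (halt.and (hsign.and hQ))).mono ?_))
  rintro x ⟨hx, hx_alt, hx_sign, hxQ⟩
  exact hxQ (hx_alt.succ (hx_sign _ hx))

/-- The averaged function with parameters `θ = (l, n, c₀₂, c₂₀, c₀₀)`. -/
noncomputable def meanParam (h c11 : ℝ) (T : ℝ × ℝ × ℝ → ℝ) (θ : ℝ × ℝ × ℝ × ℝ × ℝ) (ρ : ℝ) : ℝ :=
  meanFun h θ.1 θ.2.1 θ.2.2.2.2 θ.2.2.1 c11 θ.2.2.2.1 (fun s => T (s, θ.1, θ.2.1)) ρ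

lemma continuousAt_meanKernel (h c11 : ℝ) {θ : ℝ × ℝ × ℝ × ℝ × ℝ} {t : ℝ}
    (hne : slopePoly h θ.1 θ.2.1 t * axisPoly θ.1 t ≠ 0) :
    ContinuousAt (fun p : (ℝ × ℝ × ℝ × ℝ × ℝ) × ℝ =>
      meanKernel h p.1.1 p.1.2.1 p.1.2.2.2.2 p.1.2.2.1 c11 p.1.2.2.2.1 p.2) (θ, t) := by
  unfold meanKernel
  refine ContinuousAt.div ?_ ?_ hne
  · unfold crossPoly leadPoly divPoly axisPoly crossPoly
    fun_prop
  · unfold slopePoly axisPoly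
    fun_prop

/-- The value of `c₀₂` at which `kernelCoeffOne = 5 h kernelCoeffZero`. -/
noncomputable def solveC02 (h c11 : ℝ) (a : ℝ × ℝ) : ℝ :=
  h * c11 * (10 * a.2 - 6 * a.1) / (4 * (a.2 - a.1 + 10 * h ^ 2))

lemma kernelCoeffOne_eq_iff {h c11 l n c02 : ℝ} (hD : n - l + 10 * h ^ 2 ≠ 0) :
    kernelCoeffOne h l n c02 c11 = 5 * h * kernelCoeffZero h l n c02 c11 ↔
      c02 = solveC02 h c11 (l, n) := by
  rw [solveC02, eq_div_iff (by simpa using hD), kernelCoeffOne, kernelCoeffZero]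
  constructor <;> intro heq <;> linear_combination heq

lemma continuousAt_solveC02 (h c11 : ℝ) {a : ℝ × ℝ} (hD : a.2 - a.1 + 10 * h ^ 2 ≠ 0) :
    ContinuousAt (solveC02 h c11) a := by
  unfold solveC02
  exact ContinuousAt.div (by fun_prop) (by fun_prop) (by simpa using hD)

/-- The parameters `(l, n, c₀₂, c₂₀, c₀₀)` over `a = (l, n)` at which the three lowest-order
coefficients of the averaged function vanish. -/
noncomputable def degenerateParam (h c11 : ℝ) (a : ℝ × ℝ) : ℝ × ℝ × ℝ × ℝ × ℝ :=
  (a.1, a.2, solveC02 h c11 a, 3 * h * c11 + (4 - a.1) * solveC02 h c11 a, -solveC02 h c11 a)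

lemma continuousAt_degenerateParam (h c11 : ℝ) {a : ℝ × ℝ} (hD : a.2 - a.1 + 10 * h ^ 2 ≠ 0) :
    ContinuousAt (degenerateParam h c11) a := by
  have hc02 := continuousAt_solveC02 h c11 hD
  unfold degenerateParam
  fun_prop

lemma continuousAt_kernelCoeffZero_solveC02 (h c11 : ℝ) {a : ℝ × ℝ}
    (hD : a.2 - a.1 + 10 * h ^ 2 ≠ 0) :
    ContinuousAt (fun a => kernelCoeffZero h a.1 a.2 (solveC02 h c11 a) c11) a := by
  have hc02 := continuousAt_solveC02 h c11 hD
  unfold kernelCoeffZero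
  fun_prop

namespace IsChartFamily

variable {h c11 τ R σ : ℝ} {U : Set (ℝ × ℝ)} {T : ℝ × ℝ × ℝ → ℝ} {m : ℕ}
  (H : IsChartFamily h U T τ R)

include H

lemma eventually_mem {X : Type*} [TopologicalSpace X] {f : X → ℝ × ℝ} {x : X}
    (hf : ContinuousAt f x) (hx : f x ∈ U) : ∀ᶠ y in 𝓝 x, f y ∈ U :=
  hf.eventually (H.isOpen.mem_nhds hx)

lemma continuousAt_meanParam (c11 : ℝ) {θ : ℝ × ℝ × ℝ × ℝ × ℝ} (hθ : (θ.1, θ.2.1) ∈ U) {ρ : ℝ}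
    (hρ : ρ ∈ Ioo 0 R) : ContinuousAt (fun θ => meanParam h c11 T θ ρ) θ := by
  have hjoint : ∀ θ : ℝ × ℝ × ℝ × ℝ × ℝ, (θ.1, θ.2.1) ∈ U → ∀ φ : ℝ,
      ContinuousAt (fun p : (ℝ × ℝ × ℝ × ℝ × ℝ) × ℝ => Real.cos p.2 ^ 2 *
        meanKernel h p.1.1 p.1.2.1 p.1.2.2.2.2 p.1.2.2.1 c11 p.1.2.2.2.1
          (T (ρ * Real.sin p.2, p.1.1, p.1.2.1))) (θ, φ) := fun θ hθ φ => by
    have hs : |ρ * Real.sin φ| < R := abs_polarPoint_fst_lt hρ.1.le hρ.2 φ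
    obtain ⟨-, hu, hK⟩ := (H.isChart _ hθ).pos _ ((H.isChart _ hθ).mem _ hs)
    have hT : ContinuousAt (fun p : (ℝ × ℝ × ℝ × ℝ × ℝ) × ℝ =>
        T (ρ * Real.sin p.2, p.1.1, p.1.2.1)) (θ, φ) :=
      ContinuousAt.comp (f := fun p : (ℝ × ℝ × ℝ × ℝ × ℝ) × ℝ =>
        (ρ * Real.sin p.2, p.1.1, p.1.2.1)) (g := T) (H.continuousAt _ hθ _ hs) (by fun_prop)
    have hkernel := ContinuousAt.comp (f := fun p : (ℝ × ℝ × ℝ × ℝ × ℝ) × ℝ =>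
        (p.1, T (ρ * Real.sin p.2, p.1.1, p.1.2.1))) (x := (θ, φ))
      (continuousAt_meanKernel h c11 (mul_pos hK hu).ne') (continuousAt_fst.prodMk hT)
    exact ContinuousAt.mul (f := fun p : (ℝ × ℝ × ℝ × ℝ × ℝ) × ℝ => Real.cos p.2 ^ 2)
      (by fun_prop) hkernel
  refine continuousAt_intervalIntegral_param (F := fun (θ : ℝ × ℝ × ℝ × ℝ × ℝ) φ =>
    Real.cos φ ^ 2 * meanKernel h θ.1 θ.2.1 θ.2.2.2.2 θ.2.2.1 c11 θ.2.2.2.1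
      (T (ρ * Real.sin φ, θ.1, θ.2.1))) (fun φ _ => hjoint θ hθ φ) ?_
  filter_upwards [H.eventually_mem (f := fun θ : ℝ × ℝ × ℝ × ℝ × ℝ => (θ.1, θ.2.1))
    (by fun_prop) hθ] with θ' hθ'
  exact continuous_iff_continuousAt.2 fun φ =>
    ContinuousAt.comp (f := fun φ : ℝ => (θ', φ)) (hjoint θ' hθ' φ) (by fun_prop)

lemma frequently_alternates_of_c00 {l n c02 c20 : ℝ} (ha : (l, n) ∈ U) (hσ : σ ≠ 0)
    (halt : Alternates (meanParam h c11 T (l, n, c02, c20, -c02)) R σ m) :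
    ∃ᶠ θ in 𝓝 (l, n, c02, c20, -c02),
      (θ.1, θ.2.1) ∈ U ∧ Alternates (meanParam h c11 T θ) R σ (m + 1) := by
  refine Alternates.frequently_of_curve (γ := fun x => (l, n, c02, c20, x)) (k := fun _ => 1) halt
    hσ (fun ρ => H.continuousAt_meanParam c11 ha) (by fun_prop) continuousAt_const one_ne_zero
    (.of_forall fun x c hc => (H.isChart _ ha).eventually_mul_meanFun_pos_of_c00 H.radius_pos ?_)
    (.of_forall fun x hx hnot => hnot.self_of_nhds ⟨ha, hx⟩)
  simpa using hc

lemma frequently_alternates_of_c20 {l n c02 : ℝ} (ha : (l, n) ∈ U) (hσ : σ ≠ 0)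
    (halt : Alternates (meanParam h c11 T
      (l, n, c02, 3 * h * c11 + (4 - l) * c02, -c02)) R σ m) :
    ∃ᶠ θ in 𝓝 (l, n, c02, 3 * h * c11 + (4 - l) * c02, -c02),
      (θ.1, θ.2.1) ∈ U ∧ Alternates (meanParam h c11 T θ) R σ (m + 2) := by
  refine Alternates.frequently_of_curve (γ := fun x => (l, n, c02, x, -c02)) (k := fun _ => 1) halt
    hσ (fun ρ => H.continuousAt_meanParam c11 ha) (by fun_prop) continuousAt_const one_ne_zero
    (.of_forall fun x c hc =>
      (H.isChart _ ha).eventually_mul_meanFun_pos_of_c20 H.radius_pos rfl ?_)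
    (.of_forall fun x hx => H.frequently_alternates_of_c00 ha hσ hx)
  simpa using hc

lemma frequently_alternates_of_c02 {l n c02 : ℝ} (ha : (l, n) ∈ U)
    (hD : n - l + 10 * h ^ 2 ≠ 0)
    (hk : kernelCoeffOne h l n c02 c11 = 5 * h * kernelCoeffZero h l n c02 c11) (hσ : σ ≠ 0)
    (halt : Alternates (meanParam h c11 T
      (l, n, c02, 3 * h * c11 + (4 - l) * c02, -c02)) R σ m) :
    ∃ᶠ θ in 𝓝 (l, n, c02, 3 * h * c11 + (4 - l) * c02, -c02),
      (θ.1, θ.2.1) ∈ U ∧ Alternates (meanParam h c11 T θ) R σ (m + 3) := by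
  refine Alternates.frequently_of_curve
    (γ := fun x => (l, n, x, 3 * h * c11 + (4 - l) * x, -x))
    (k := fun _ => 4 * (n - l + 10 * h ^ 2)) halt
    hσ (fun ρ => H.continuousAt_meanParam c11 ha) (by fun_prop) continuousAt_const
    (mul_ne_zero four_ne_zero hD)
    (.of_forall fun x c hc => (H.isChart _ ha).eventually_mul_meanFun_pos_of_c02 H.radius_pos ?_)
    (.of_forall fun x hx => H.frequently_alternates_of_c20 ha hσ hx)
  convert hc using 2
  simp only [kernelCoeffOne, kernelCoeffZero] at hk ⊢
  linear_combination hk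

lemma frequently_alternates_of_n (hh : h ≠ 0) {l : ℝ} {a : ℝ × ℝ}
    (ha_eq : a = (l, 3 * h ^ 2 + 4 * l / 7)) (ha : a ∈ U) (hD : a.2 - a.1 + 10 * h ^ 2 ≠ 0)
    (hk : kernelCoeffZero h a.1 a.2 (solveC02 h c11 a) c11 ≠ 0) (hσ : σ ≠ 0)
    (halt : Alternates (meanParam h c11 T (degenerateParam h c11 a)) R σ m) :
    ∃ᶠ θ in 𝓝 (degenerateParam h c11 a),
      (θ.1, θ.2.1) ∈ U ∧ Alternates (meanParam h c11 T θ) R σ (m + 4) := by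
  subst ha_eq
  set n₀ := 3 * h ^ 2 + 4 * l / 7 with hn₀
  have hline : ContinuousAt (fun x : ℝ => (l, x)) n₀ := by fun_prop
  have hkcont := ContinuousAt.comp (f := fun x : ℝ => (l, x))
    (continuousAt_kernelCoeffZero_solveC02 h c11 hD) hline
  have hUx := H.eventually_mem hline ha
  have hDx : ∀ᶠ x in 𝓝 n₀, x - l + 10 * h ^ 2 ≠ 0 :=
    ContinuousAt.eventually_ne (g := fun x : ℝ => x - l + 10 * h ^ 2) (by fun_prop) hD
  refine Alternates.frequently_of_curve (γ := fun x => degenerateParam h c11 (l, x))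
    (k := fun x => kernelCoeffZero h l x (solveC02 h c11 (l, x)) c11 * (h * -14)) halt hσ
    (fun ρ => H.continuousAt_meanParam c11 ha)
    (ContinuousAt.comp (f := fun x : ℝ => (l, x)) (continuousAt_degenerateParam h c11 hD) hline)
    (hkcont.mul continuousAt_const) (mul_ne_zero hk (mul_ne_zero hh (by norm_num))) ?_ ?_
  · filter_upwards [hUx, hDx] with x hxU hxD c hc
    refine (H.isChart _ hxU).eventually_mul_meanFun_pos_of_n H.radius_pos
      ((kernelCoeffOne_eq_iff hxD).2 rfl) ?_
    convert hc using 2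
    linear_combination (-14 * kernelCoeffZero h l x (solveC02 h c11 (l, x)) c11 * h) * hn₀
  · filter_upwards [hUx, hDx] with x hxU hxD hx
    exact H.frequently_alternates_of_c02 hxU hxD ((kernelCoeffOne_eq_iff hxD).2 rfl) hσ hx

lemma frequently_alternates_of_l (hh : h ≠ 0) {l : ℝ} {a : ℝ × ℝ}
    (ha_eq : a = (l, 3 * h ^ 2 + 4 * l / 7)) (ha : a ∈ U) (hD : a.2 - a.1 + 10 * h ^ 2 ≠ 0)
    (hk : kernelCoeffZero h a.1 a.2 (solveC02 h c11 a) c11 ≠ 0)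
    (hl : l ^ 2 - 210 * h ^ 2 * l + 1617 * h ^ 4 = 0) (hl_ne : l + l - 210 * h ^ 2 ≠ 0)
    (hσ : σ ≠ 0) (halt : Alternates (meanParam h c11 T (degenerateParam h c11 a)) R σ m) :
    ∃ᶠ θ in 𝓝 (degenerateParam h c11 a),
      (θ.1, θ.2.1) ∈ U ∧ Alternates (meanParam h c11 T θ) R σ (m + 5) := by
  subst ha_eq
  set γ : ℝ → ℝ × ℝ := fun x => (x, 3 * h ^ 2 + 4 * x / 7)
  have hγ : ContinuousAt γ l := by fun_prop
  have hkcont := ContinuousAt.comp (f := γ) (continuousAt_kernelCoeffZero_solveC02 h c11 hD) hγ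
  have hUx := H.eventually_mem hγ ha
  have hDx : ∀ᶠ x in 𝓝 l, (γ x).2 - (γ x).1 + 10 * h ^ 2 ≠ 0 :=
    ContinuousAt.eventually_ne (g := fun x => (γ x).2 - (γ x).1 + 10 * h ^ 2) (by fun_prop) hD
  refine Alternates.frequently_of_curve (γ := fun x => degenerateParam h c11 (γ x))
    (k := fun x => kernelCoeffZero h (γ x).1 (γ x).2 (solveC02 h c11 (γ x)) c11 *
      (h * (x + l - 210 * h ^ 2))) halt hσ (fun ρ => H.continuousAt_meanParam c11 ha)
    (ContinuousAt.comp (f := γ) (continuousAt_degenerateParam h c11 hD) hγ)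
    (hkcont.mul (by fun_prop)) (mul_ne_zero hk (mul_ne_zero hh hl_ne)) ?_ ?_
  · filter_upwards [hUx, hDx] with x hxU hxD c hc
    refine (H.isChart _ hxU).eventually_mul_meanFun_pos_of_l H.radius_pos
      ((kernelCoeffOne_eq_iff hxD).2 rfl) rfl ?_
    convert hc using 2
    linear_combination (kernelCoeffZero h (γ x).1 (γ x).2 (solveC02 h c11 (γ x)) c11 * h) * hl
  · filter_upwards [hUx, hDx, hkcont.eventually_ne hk] with x hxU hxD hxk hx
    exact H.frequently_alternates_of_n hh rfl hxU hxD hxk hσ hx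

end IsChartFamily

lemma add_mul_ne_zero_of_sq_eq_three {w : ℝ} (hw : w ^ 2 = 3) {a b : ℝ} (hab : a ^ 2 ≠ 3 * b ^ 2) :
    a + b * w ≠ 0 := fun h0 => hab (by linear_combination (a - b * w) * h0 + b ^ 2 * hw)

section SqEqThree

variable {h c11 w : ℝ} (hw : w ^ 2 = 3) (hh : h ≠ 0)

include hw hh

lemma sub_add_ten_mul_sq_ne_zero :
    (63 + 32 * w) * h ^ 2 - (105 + 56 * w) * h ^ 2 + 10 * h ^ 2 ≠ 0 := by
  have hfactor : (63 + 32 * w) * h ^ 2 - (105 + 56 * w) * h ^ 2 + 10 * h ^ 2 =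
      (-32 + -24 * w) * h ^ 2 := by ring
  rw [hfactor]
  exact mul_ne_zero (add_mul_ne_zero_of_sq_eq_three hw (by norm_num)) (pow_ne_zero 2 hh)

lemma kernelCoeffZero_solveC02_ne_zero (hc11 : c11 ≠ 0) {a : ℝ × ℝ}
    (ha : a = ((105 + 56 * w) * h ^ 2, (63 + 32 * w) * h ^ 2)) :
    kernelCoeffZero h a.1 a.2 (solveC02 h c11 a) c11 ≠ 0 := fun hzero => by
  subst ha
  have hone := (kernelCoeffOne_eq_iff (c11 := c11) (sub_add_ten_mul_sq_ne_zero hw hh)).2 rfl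
  generalize solveC02 h c11 ((105 + 56 * w) * h ^ 2, (63 + 32 * w) * h ^ 2) = c02 at *
  have hprod : (768 + 448 * w) * (h ^ 3 * c11) = 0 := by
    simp only [kernelCoeffOne, kernelCoeffZero] at hzero hone
    linear_combination (-(4 + 3 * w) * h) * hzero + (1 / 4) * hone + (-(144 * h ^ 3 * c11)) * hw
  exact mul_ne_zero (add_mul_ne_zero_of_sq_eq_three hw (by norm_num))
    (mul_ne_zero (pow_ne_zero 3 hh) hc11) hprod

lemma IsChartFamily.frequently_alternates {U : Set (ℝ × ℝ)} {T : ℝ × ℝ × ℝ → ℝ} {τ R : ℝ}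
    (H : IsChartFamily h U T τ R) (hc11 : c11 ≠ 0) {a : ℝ × ℝ}
    (ha_eq : a = ((105 + 56 * w) * h ^ 2, (63 + 32 * w) * h ^ 2)) (ha : a ∈ U) :
    ∃ σ, ∃ᶠ θ in 𝓝 (degenerateParam h c11 a),
      (θ.1, θ.2.1) ∈ U ∧ Alternates (meanParam h c11 T θ) R σ 5 := by
  have hk := kernelCoeffZero_solveC02_ne_zero hw hh hc11 ha_eq
  have hline : a = ((105 + 56 * w) * h ^ 2, 3 * h ^ 2 + 4 * ((105 + 56 * w) * h ^ 2) / 7) := by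
    rw [ha_eq]
    congr 1
    ring
  have hD : a.2 - a.1 + 10 * h ^ 2 ≠ 0 := ha_eq ▸ sub_add_ten_mul_sq_ne_zero hw hh
  set σ := kernelCoeffZero h a.1 a.2 (solveC02 h c11 a) c11 * (h ^ 7 * (442368 + 253952 * w))
    with hσ_def
  have hσ : σ ≠ 0 := mul_ne_zero hk (mul_ne_zero (pow_ne_zero 7 hh)
    (add_mul_ne_zero_of_sq_eq_three hw (by norm_num)))
  have hl_ne : (105 + 56 * w) * h ^ 2 + (105 + 56 * w) * h ^ 2 - 210 * h ^ 2 ≠ 0 := by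
    have hfactor : (105 + 56 * w) * h ^ 2 + (105 + 56 * w) * h ^ 2 - 210 * h ^ 2 =
        (0 + 112 * w) * h ^ 2 := by ring
    rw [hfactor]
    exact mul_ne_zero (add_mul_ne_zero_of_sq_eq_three hw (by norm_num)) (pow_ne_zero 2 hh)
  refine ⟨σ, H.frequently_alternates_of_l hh hline ha hD hk
    (by linear_combination 3136 * h ^ 4 * hw) hl_ne hσ
    (alternates_zero_of_eventually H.radius_pos ?_)⟩
  subst ha_eq
  exact (H.isChart _ ha).eventually_mul_meanFun_pos_of_sq_eq_three hw H.radius_pos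
    ((kernelCoeffOne_eq_iff hD).2 rfl) (mul_self_pos.2 hσ)

end SqEqThree

/-! ### Simple zeros and limit cycles -/

/-- The simple zeros of `f` in `(0, R)`. -/
def simpleZeros (f : ℝ → ℝ) (R : ℝ) : Set ℝ := {ρ ∈ Ioo 0 R | f ρ = 0 ∧ deriv f ρ ≠ 0}

lemma Alternates.le_encard_zeros {f : ℝ → ℝ} {R σ : ℝ} {m : ℕ} (ha : Alternates f R σ m)
    (hf : ContinuousOn f (Ioo 0 R)) : (m : ℕ∞) ≤ {ρ ∈ Ioo 0 R | f ρ = 0}.encard := by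
  obtain ⟨x, hx, hlt⟩ := ha
  have hzero : ∀ i < m, ∃ ρ ∈ Ioo (x (i + 1)) (x i), ρ ∈ Ioo 0 R ∧ f ρ = 0 := fun i hi => by
    obtain ⟨hxi, hsign⟩ := hx i hi.le
    obtain ⟨hxi', hsign'⟩ := hx (i + 1) hi
    have hsub : Icc (x (i + 1)) (x i) ⊆ Ioo 0 R := Icc_subset_Ioo hxi'.1 hxi.2
    have hneg : σ * (-1) ^ i * f (x (i + 1)) < 0 := by
      rw [pow_succ] at hsign'
      linarith
    obtain ⟨ρ, hρ, hz⟩ := intermediate_value_Ioo (hlt i hi).le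
      (continuousOn_const.mul (hf.mono hsub)) ⟨hneg, hsign⟩
    exact ⟨ρ, hρ, hsub (Ioo_subset_Icc_self hρ),
      (mul_eq_zero.1 hz).resolve_left (left_ne_zero_of_mul hsign.ne')⟩
  choose! z hz hzR hz0 using hzero
  have hx_anti : StrictAntiOn x (Iic m) := strictAntiOn_Iic_of_succ_lt hlt
  have hz_anti : StrictAntiOn z (Iio m) := fun i hi j hj hij =>
    calc z j < x j := (hz j hj).2
      _ ≤ x (i + 1) :=
        hx_anti.antitoneOn (mem_Iic.2 (Nat.succ_le_of_lt hi)) (mem_Iic.2 (le_of_lt hj)) hij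
      _ < z i := (hz i hi).1
  calc (m : ℕ∞) = (Iio m).encard := by
        rw [← Finset.coe_Iio, encard_coe_eq_coe_finsetCard, Nat.card_Iio]
    _ ≤ {ρ ∈ Ioo 0 R | f ρ = 0}.encard :=
      encard_le_encard_of_injOn (fun i hi => ⟨hzR i hi, hz0 i hi⟩) hz_anti.injOn

namespace IsChart

variable {h l n τ R : ℝ} {T : ℝ → ℝ} (H : IsChart h l n T τ R) (c00 c02 c11 c20 : ℝ)

include H

lemma hasDerivAt_meanFun {ρ : ℝ} (hρ : ρ ∈ Ioo 0 R) :
    HasDerivAt (meanFun h l n c00 c02 c11 c20 T) (deriv (meanFun h l n c00 c02 c11 c20 T) ρ) ρ :=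
  (hasDerivAt_integral_cos_sq hρ.1 hρ.2
    fun _ hs => H.contDiffAt_meanKernel_comp hs).differentiableAt.hasDerivAt

lemma continuous_meanFun_integrand {ρ : ℝ} (hρ : ρ ∈ Ioo 0 R) :
    Continuous fun φ =>
      Real.cos φ ^ 2 * meanKernel h l n c00 c02 c11 c20 (T (ρ * Real.sin φ)) :=
  continuous_cos_sq_mul_comp_sin hρ.1.le hρ.2
    fun _ hs => (H.contDiffAt_meanKernel_comp hs).continuousAt

lemma meanFun_eq_add {ρ : ℝ} (hρ : ρ ∈ Ioo 0 R) :
    meanFun h l n c00 c02 c11 c20 T ρ =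
      c00 * meanFun h l n 1 0 0 0 T ρ + meanFun h l n 0 c02 c11 c20 T ρ := by
  simp only [meanFun]
  rw [← intervalIntegral.integral_const_mul, ← intervalIntegral.integral_add
    (((H.continuous_meanFun_integrand _ _ _ _ hρ).intervalIntegrable _ _).const_mul _)
    ((H.continuous_meanFun_integrand _ _ _ _ hρ).intervalIntegrable _ _)]
  congr 1
  ext φ
  simp only [meanKernel, divPoly]
  ring

lemma meanFun_pos {ρ : ℝ} (hρ : ρ ∈ Ioo 0 R) : 0 < meanFun h l n 1 0 0 0 T ρ := by
  have hpos : ∀ φ, 0 < meanKernel h l n 1 0 0 0 (T (ρ * Real.sin φ)) := fun φ => by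
    have ht := H.mem _ (abs_polarPoint_fst_lt hρ.1.le hρ.2 φ)
    obtain ⟨hcross, haxis, hslope⟩ := H.pos _ ht
    have hlead := H.lead_pos ht
    have := Real.sqrt_pos.2 hcross
    simp only [meanKernel, divPoly, zero_mul, add_zero, one_mul]
    positivity
  refine intervalIntegral.integral_pos (by positivity)
    (H.continuous_meanFun_integrand _ _ _ _ hρ).continuousOn
    (fun φ _ => mul_nonneg (sq_nonneg _) (hpos φ).le) ⟨0, ⟨le_rfl, by positivity⟩, ?_⟩
  simpa using hpos 0

lemma hasDerivAt_meanFun_add {ρ : ℝ} (hρ : ρ ∈ Ioo 0 R) :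
    HasDerivAt (meanFun h l n c00 c02 c11 c20 T)
      (c00 * deriv (meanFun h l n 1 0 0 0 T) ρ + deriv (meanFun h l n 0 c02 c11 c20 T) ρ) ρ := by
  refine (((H.hasDerivAt_meanFun 1 0 0 0 hρ).const_mul c00).add
    (H.hasDerivAt_meanFun 0 c02 c11 c20 hρ)).congr_of_eventuallyEq ?_
  filter_upwards [isOpen_Ioo.mem_nhds hρ] with y hy using H.meanFun_eq_add c00 c02 c11 c20 hy

variable {c00 c02 c11 c20} in
lemma frequently_le_encard_simpleZeros {σ : ℝ} {m : ℕ}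
    (ha : Alternates (meanFun h l n c00 c02 c11 c20 T) R σ m) :
    ∃ᶠ c in 𝓝 c00, (m : ℕ∞) ≤ (simpleZeros (meanFun h l n c c02 c11 c20 T) R).encard := by
  have hev : ∀ᶠ c in 𝓝 c00, Alternates (meanFun h l n c c02 c11 c20 T) R σ m := by
    refine ha.eventually (N := fun c => meanFun h l n c c02 c11 c20 T) fun ρ hρ => ?_
    rw [show (fun c => meanFun h l n c c02 c11 c20 T ρ) = fun c => c * meanFun h l n 1 0 0 0 T ρ +
      meanFun h l n 0 c02 c11 c20 T ρ from funext fun c => H.meanFun_eq_add c c02 c11 c20 hρ]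
    fun_prop
  have hfreq : ∃ᶠ c in 𝓝 c00, ∀ ρ ∈ Ioo 0 R,
      c * meanFun h l n 1 0 0 0 T ρ + meanFun h l n 0 c02 c11 c20 T ρ = 0 →
      c * deriv (meanFun h l n 1 0 0 0 T) ρ + deriv (meanFun h l n 0 c02 c11 c20 T) ρ ≠ 0 :=
    (nhds_basis_Ioo_pos c00).frequently_iff.2 fun δ hδ =>
      exists_forall_zero_simple (by linarith) (fun _ => H.hasDerivAt_meanFun 1 0 0 0)
        (fun _ => H.hasDerivAt_meanFun 0 c02 c11 c20) fun _ hρ => (H.meanFun_pos hρ).ne'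
  refine (hfreq.and_eventually hev).mono ?_
  rintro c ⟨hsimple, halt⟩
  refine (halt.le_encard_zeros fun ρ hρ =>
    (H.hasDerivAt_meanFun c c02 c11 c20 hρ).continuousAt.continuousWithinAt).trans
      (encard_le_encard ?_)
  rintro ρ ⟨hρ, hz⟩
  refine ⟨hρ, hz, ?_⟩
  rw [(H.hasDerivAt_meanFun_add c c02 c11 c20 hρ).deriv]
  exact hsimple ρ hρ (by rw [← H.meanFun_eq_add c c02 c11 c20 hρ, hz])

end IsChart

lemma IsPeriodicOrbit.nonempty {X : ℝ × ℝ → ℝ × ℝ} {C : Set (ℝ × ℝ)} (hC : IsPeriodicOrbit X C) :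
    C.Nonempty := by
  obtain ⟨γ, T, -, -, -, -, rfl⟩ := hC
  exact range_nonempty γ

/-- The change of coordinates `(S, V) ↦ (x, y)` given by a chart `T`. -/
noncomputable def xyCoord (h l n : ℝ) (T : ℝ → ℝ) (z : ℝ × ℝ) : ℝ × ℝ :=
  (T z.1 * √(wOfV h l n (T z.1) z.2), √(wOfV h l n (T z.1) z.2))

namespace IsChart

variable {h l n τ R : ℝ} {T : ℝ → ℝ} (H : IsChart h l n T τ R)

include H

lemma injOn_xyCoord : InjOn (xyCoord h l n T) {z | polarRadius z < R} := by
  refine LeftInvOn.injOn (f₁' := fun z => svCoord h l n (z.1 / z.2, z.2 ^ 2)) fun z hz => ?_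
  have hpos : 0 < wOfV h l n (T z.1) z.2 := H.twCoord_snd_pos hz
  simp only [xyCoord, Real.sq_sqrt hpos.le, mul_div_cancel_right₀ _ (Real.sqrt_pos.2 hpos).ne']
  exact H.svCoord_twCoord ((abs_fst_le_polarRadius z).trans_lt hz)

lemma xyCoord_image_subset_ball {r : ℝ} (hr : ∀ t V, |t| < τ → |V| < R →
      (t * √(wOfV h l n t V), √(wOfV h l n t V)) ∈ Metric.ball ((0 : ℝ), (1 : ℝ)) r)
    {C : Set (ℝ × ℝ)} (hC : C ⊆ {z | polarRadius z < R}) :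
    xyCoord h l n T '' C ⊆ Metric.ball (0, 1) r := by
  rintro _ ⟨z, hz, rfl⟩
  exact hr _ _ (H.mem _ ((abs_fst_le_polarRadius z).trans_lt (hC hz)))
    ((abs_snd_le_polarRadius z).trans_lt (hC hz))

section SymField

variable {c00 c02 c11 c20 h22 h40 : ℝ} {p q : ℝ → ℝ → ℝ} (hl : l = 2 - 4 * h22)
  (hn : n = (1 - 2 * h22) ^ 2 - 2 * h40) (hp : IsOddCubic p) (hq : IsOddCubic q)
  (hd : HasDivergence p q c00 c02 c11 c20)

include hl hn hp hq hd

theorem eventually_exists_isLimitCycle_symField {ρ : ℝ} {s : Set ℝ} (hs : IsOpen s)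
    (hsR : s ⊆ Ioo 0 R) (hρ : ρ ∈ s) (hz : meanFun h l n c00 c02 c11 c20 T ρ = 0)
    (hD : deriv (meanFun h l n c00 c02 c11 c20 T) ρ ≠ 0) :
    ∀ᶠ ε in 𝓝[>] 0, ∃ C ⊆ polarRadius ⁻¹' s,
      IsLimitCycle (symField h h22 h40 p q ε) (xyCoord h l n T '' C) := by
  obtain ⟨P₁, P₃, cP₁, cP₃, hp⟩ := hp.exists_hasRayParts
  obtain ⟨Q₁, Q₃, cQ₁, cQ₃, hq⟩ := hq.exists_hasRayParts
  filter_upwards [H.eventually_exists_isLimitCycle_twField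
    (cP₁.sub (contDiff_id.mul cQ₁)) (cP₃.sub (contDiff_id.mul cQ₃)) cQ₁ cQ₃
    (hp.hasDerivAt_linear_part hq hd (cP₁.differentiable one_ne_zero)
      (cP₃.differentiable one_ne_zero) (cQ₁.differentiable one_ne_zero)
      (cQ₃.differentiable one_ne_zero))
    (hp.hasDerivAt_cubic_part hq hd (cP₁.differentiable one_ne_zero)
      (cP₃.differentiable one_ne_zero) (cQ₁.differentiable one_ne_zero)
      (cQ₃.differentiable one_ne_zero)) hs hsR hρ hz
    (differentiableAt_of_deriv_ne_zero hD).hasDerivAt hD] with ε ⟨C, hCs, hC⟩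
  refine ⟨C, hCs, ?_⟩
  subst hl hn
  have hpos : twCoord h (2 - 4 * h22) ((1 - 2 * h22) ^ 2 - 2 * h40) T '' C ⊆ {z | 0 < z.2} :=
    image_subset_iff.2 fun z hz => H.twCoord_snd_pos (hsR (hCs hz)).2
  simpa only [image_image] using! hC.symField_of_twField hp hq hpos

theorem eventually_le_encard_limitCyclesNear {r : ℝ}
    (hr : ∀ t V, |t| < τ → |V| < R →
      (t * √(wOfV h l n t V), √(wOfV h l n t V)) ∈ Metric.ball ((0 : ℝ), (1 : ℝ)) r) {m : ℕ}
    (hm : (m : ℕ∞) ≤ (simpleZeros (meanFun h l n c00 c02 c11 c20 T) R).encard) :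
    ∀ᶠ ε in 𝓝[>] 0, (m : ℕ∞) ≤ (limitCyclesNear (symField h h22 h40 p q ε) (0, 1) r).encard := by
  obtain ⟨Z, hZ, hZm⟩ := exists_subset_encard_eq hm
  have hZfin : Z.Finite := finite_of_encard_eq_coe hZm
  obtain ⟨u, hu, hdisj⟩ := hZfin.t2_separation
  have hev : ∀ᶠ ε in 𝓝[>] 0, ∀ ρ ∈ Z, ∃ C ⊆ polarRadius ⁻¹' (u ρ ∩ Ioo 0 R),
      IsLimitCycle (symField h h22 h40 p q ε) (xyCoord h l n T '' C) :=
    (eventually_all_finite hZfin).2 fun ρ hρ =>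
      H.eventually_exists_isLimitCycle_symField hl hn hp hq hd ((hu ρ).2.inter isOpen_Ioo)
        inter_subset_right ⟨(hu ρ).1, (hZ hρ).1⟩ (hZ hρ).2.1 (hZ hρ).2.2
  filter_upwards [hev] with ε hε
  choose! C hCu hC using hε
  have hCR : ∀ ρ ∈ Z, C ρ ⊆ {z | polarRadius z < R} := fun ρ hρ z hz => (hCu ρ hρ hz).2.2
  have hinj : InjOn (fun ρ => xyCoord h l n T '' C ρ) Z := fun ρ hρ ρ' hρ' heq => by
    by_contra hne
    obtain ⟨_, z, hz, rfl⟩ := (hC ρ hρ).1.nonempty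
    obtain ⟨z', hz', hzz'⟩ := heq.subset (mem_image_of_mem _ hz)
    obtain rfl := H.injOn_xyCoord (hCR ρ' hρ' hz') (hCR ρ hρ hz) hzz'
    exact disjoint_left.1 (hdisj hρ hρ' hne) (hCu ρ hρ hz).1 (hCu ρ' hρ' hz').1
  calc (m : ℕ∞) = Z.encard := hZm.symm
    _ ≤ (limitCyclesNear (symField h h22 h40 p q ε) (0, 1) r).encard :=
      encard_le_encard_of_injOn (f := fun ρ => xyCoord h l n T '' C ρ)
      (fun ρ hρ => ⟨hC ρ hρ, H.xyCoord_image_subset_ball hr (hCR ρ hρ)⟩) hinj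

end SymField

end IsChart

/-! ### Symmetric copies -/

lemma encard_limitCyclesNear_le {X Y : ℝ × ℝ → ℝ × ℝ} {z₀ z₁ : ℝ × ℝ} {r : ℝ} {f : ℝ × ℝ → ℝ × ℝ}
    (hf : Function.Injective f) (hXY : ∀ C, IsLimitCycle X C → IsLimitCycle Y (f '' C))
    (hball : MapsTo f (Metric.ball z₀ r) (Metric.ball z₁ r)) :
    (limitCyclesNear X z₀ r).encard ≤ (limitCyclesNear Y z₁ r).encard :=
  encard_le_encard_of_injOn (fun C hC => ⟨hXY C hC.1, (hball.mono_left hC.2).image_subset⟩)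
    hf.image_injective.injOn

lemma limitCyclesNear_mono (X : ℝ × ℝ → ℝ × ℝ) (z₀ : ℝ × ℝ) {r r' : ℝ} (hr : r ≤ r') :
    limitCyclesNear X z₀ r ⊆ limitCyclesNear X z₀ r' := fun _ hC =>
  ⟨hC.1, hC.2.trans (Metric.ball_subset_ball hr)⟩

lemma disjoint_limitCyclesNear (X : ℝ × ℝ → ℝ × ℝ) {z₀ z₁ : ℝ × ℝ} {r : ℝ}
    (hr : r + r ≤ dist z₀ z₁) : Disjoint (limitCyclesNear X z₀ r) (limitCyclesNear X z₁ r) :=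
  disjoint_left.2 fun _ ⟨hC, hC₀⟩ ⟨_, hC₁⟩ =>
    let ⟨_, hz⟩ := hC.1.nonempty
    disjoint_left.1 (Metric.ball_disjoint_ball hr) (hC₀ hz) (hC₁ hz)

section SymmetricCopies

variable (h31 h22 h40 ε r : ℝ) {p q : ℝ → ℝ → ℝ}

lemma encard_limitCyclesNear_symField_le_normalField (p q : ℝ → ℝ → ℝ) :
    (limitCyclesNear (symField h31 h22 h40 p q ε) (0, 1) r).encard ≤
      (limitCyclesNear (normalField h31 h22 h40 p q ε) (0, 0) r).encard := by
  refine encard_limitCyclesNear_le (f := fun z => (1 - z.2, z.1)) (fun z z' h => ?_)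
    (fun C hC => hC.normalField) fun z hz => ?_
  · simpa [Prod.ext_iff, and_comm] using h
  · simpa [Prod.dist_eq, Real.dist_eq, abs_sub_comm, and_comm] using hz

lemma encard_limitCyclesNear_symField_le_neg (hp : IsOddCubic p) (hq : IsOddCubic q) :
    (limitCyclesNear (symField h31 h22 h40 p q ε) (0, 1) r).encard ≤
      (limitCyclesNear (symField h31 h22 h40 p q ε) (0, -1) r).encard := by
  refine encard_limitCyclesNear_le neg_injective
    (fun C hC => hC.neg_symField hp.neg_neg hq.neg_neg) fun z hz => ?_
  rw [show ((0 : ℝ), (-1 : ℝ)) = -(0, 1) by simp, Metric.mem_ball, dist_neg_neg]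
  exact hz

variable {h31 h22 h40 ε}

lemma le_encard_limitCyclesNear_copies {η : ℝ} {m : ℕ∞} (hp : IsOddCubic p) (hq : IsOddCubic q)
    (hm : m ≤ (limitCyclesNear (symField h31 h22 h40 p q ε) (0, 1) (min η 1)).encard) :
    m ≤ (limitCyclesNear (normalField h31 h22 h40 p q ε) (0, 0) η).encard ∧
      m ≤ (limitCyclesNear (symField h31 h22 h40 p q ε) (0, 1) η).encard ∧
      m ≤ (limitCyclesNear (symField h31 h22 h40 p q ε) (0, -1) η).encard ∧
      m + m ≤ (limitCyclesNear (symField h31 h22 h40 p q ε) (0, 1) η ∪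
        limitCyclesNear (symField h31 h22 h40 p q ε) (0, -1) η).encard := by
  have hmono := fun X z₀ => limitCyclesNear_mono X z₀ (min_le_left η 1)
  have hdisj : min η 1 + min η 1 ≤ dist ((0 : ℝ), (1 : ℝ)) (0, -1) := by
    rw [Prod.dist_eq, Real.dist_eq, Real.dist_eq]
    norm_num
    linarith [min_le_right η 1]
  have hneg := hm.trans (encard_limitCyclesNear_symField_le_neg h31 h22 h40 ε _ hp hq)
  refine ⟨(hm.trans (encard_limitCyclesNear_symField_le_normalField ..)).trans
    (encard_le_encard (hmono _ _)), hm.trans (encard_le_encard (hmono _ _)),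
    hneg.trans (encard_le_encard (hmono _ _)), ?_⟩
  refine le_trans ?_ (encard_le_encard (union_subset_union (hmono _ _) (hmono _ _)))
  rw [encard_union_eq (disjoint_limitCyclesNear _ hdisj)]
  exact add_le_add hm hneg

end SymmetricCopies

/-! ### The coefficients of the theorem -/

lemma frequently_five_le_encard_limitCyclesNear {h c11 w : ℝ} (hw : w ^ 2 = 3) (hh : h ≠ 0)
    (hc11 : c11 ≠ 0) {a : ℝ × ℝ}
    (ha : a = ((105 + 56 * w) * h ^ 2, (63 + 32 * w) * h ^ 2)) {r : ℝ} (hr : 0 < r) :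
    ∃ᶠ θ in 𝓝 (degenerateParam h c11 a), ∀ h22 h40 p q, θ.1 = 2 - 4 * h22 →
      θ.2.1 = (1 - 2 * h22) ^ 2 - 2 * h40 → IsOddCubic p → IsOddCubic q →
      HasDivergence p q θ.2.2.2.2 θ.2.2.1 c11 θ.2.2.2.1 →
      ∀ᶠ ε in 𝓝[>] 0, 5 ≤ (limitCyclesNear (symField h h22 h40 p q ε) (0, 1) r).encard := by
  obtain ⟨δ, hδ, hball⟩ := exists_pos_forall_sqrt_wOfV_mem_ball h a hr
  obtain ⟨U, T, τ, R, H, haU, hUδ, hτ, hR⟩ := exists_isChartFamily h a hδ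
  obtain ⟨σ, hfreq⟩ := H.frequently_alternates hw hh hc11 ha haU
  refine frequently_frequently_nhds.1 (hfreq.mono ?_)
  rintro ⟨l, n, c02, c20, c00⟩ ⟨hU, halt⟩
  have hcurve : Tendsto (fun c => (l, n, c02, c20, c)) (𝓝 c00) (𝓝 (l, n, c02, c20, c00)) :=
    Continuous.tendsto (by fun_prop) c00
  refine hcurve.frequently (((H.isChart _ hU).frequently_le_encard_simpleZeros halt).mono ?_)
  intro c hc h22 h40 p q hl hn hp hq hd
  exact (H.isChart _ hU).eventually_le_encard_limitCyclesNear hl hn hp hq hd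
    (fun t V ht hV => hball t V (ht.trans_le hτ) (hV.trans_le hR) _ (hUδ hU)) hc

lemma degenerateParam_eq {h31 h22 h40 c00 c02 c11 c20 : ℝ} (hc00 : c00 = -c02)
    (hc20 : c20 = 3 * h31 * c11 + (2 + 4 * h22) * c02)
    (hc02 : c02 = h31 * (20 * h22 ^ 2 - 8 * h22 - 10 * h40 - 1) /
      (-2 + 20 * h31 ^ 2 + 8 * h22 ^ 2 - 4 * h40) * c11) :
    degenerateParam h31 c11 (2 - 4 * h22, (1 - 2 * h22) ^ 2 - 2 * h40) =
      (2 - 4 * h22, (1 - 2 * h22) ^ 2 - 2 * h40, c02, c20, c00) := by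
  have hsolve : solveC02 h31 c11 (2 - 4 * h22, (1 - 2 * h22) ^ 2 - 2 * h40) = c02 := by
    rw [hc02, solveC02, ← mul_div_mul_left _ (4 * _) (two_ne_zero (α := ℝ)),
      div_mul_eq_mul_div, ← mul_div_mul_left _ (-2 + _ + _ - _) (four_ne_zero (α := ℝ))]
    congr 1 <;> ring
  rw [degenerateParam, hsolve, hc20, hc00]
  congr 4
  ring

lemma chart_coeffs_eq {w h31 h22 h40 : ℝ} (hh22 : h22 = 1 / 2 - (105 + 56 * w) / 4 * h31 ^ 2)
    (hh40 : h40 = 1 / 14 * (28 * h22 ^ 2 - 21 * h31 ^ 2 - 12 * h22 - 1)) :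
    (2 - 4 * h22, (1 - 2 * h22) ^ 2 - 2 * h40) =
      ((105 + 56 * w) * h31 ^ 2, (63 + 32 * w) * h31 ^ 2) := by
  rw [hh40, Prod.mk.injEq]
  constructor <;> rw [hh22] <;> ring

lemma eventually_exists_coeffs_near (h22 h40 c02 c20 c00 : ℝ) {η : ℝ} (hη : 0 < η) :
    ∀ᶠ θ in 𝓝 (2 - 4 * h22, (1 - 2 * h22) ^ 2 - 2 * h40, c02, c20, c00), ∃ h22' h40',
      θ.1 = 2 - 4 * h22' ∧ θ.2.1 = (1 - 2 * h22') ^ 2 - 2 * h40' ∧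
      |h22' - h22| < η ∧ |h40' - h40| < η ∧
      |θ.2.2.1 - c02| < η ∧ |θ.2.2.2.1 - c20| < η ∧ |θ.2.2.2.2 - c00| < η := by
  have hnear : ∀ {f : ℝ × ℝ × ℝ × ℝ × ℝ → ℝ} {a : ℝ}, Continuous f →
      f (2 - 4 * h22, (1 - 2 * h22) ^ 2 - 2 * h40, c02, c20, c00) = a →
      ∀ᶠ θ in 𝓝 (2 - 4 * h22, (1 - 2 * h22) ^ 2 - 2 * h40, c02, c20, c00), |f θ - a| < η :=
    fun hf ha => ha ▸ hf.continuousAt.eventually (eventually_abs_sub_lt _ hη)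
  filter_upwards [hnear (f := fun θ => (2 - θ.1) / 4) (a := h22) (by fun_prop) (by ring),
    hnear (f := fun θ => ((θ.1 / 2) ^ 2 - θ.2.1) / 2) (a := h40) (by fun_prop) (by ring),
    hnear (f := fun θ => θ.2.2.1) (by fun_prop) rfl,
    hnear (f := fun θ => θ.2.2.2.1) (by fun_prop) rfl,
    hnear (f := fun θ => θ.2.2.2.2) (by fun_prop) rfl] with θ hθ22 hθ40 hθ02 hθ20 hθ00
  exact ⟨_, _, by ring, by ring, hθ22, hθ40, hθ02, hθ20, hθ00⟩

theorem theorem9 (s c00' c02' c11' c20' h31' h22' h40' : ℝ)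
    (hs : s = 1 ∨ s = -1)
    (hc00 : c00' = -c02')
    (hc20 : c20' = 3 * h31' * c11' + (2 + 4 * h22') * c02')
    (hc11 : c11' ≠ 0)
    (hc02 : c02' = h31' * (20 * h22' ^ 2 - 8 * h22' - 10 * h40' - 1) /
      (-2 + 20 * h31' ^ 2 + 8 * h22' ^ 2 - 4 * h40') * c11')
    (hh31 : h31' ≠ 0)
    (hh22 : h22' = 1 / 2 - (105 + s * (56 * √3)) / 4 * h31' ^ 2)
    (hh40 : h40' = 1 / 14 * (28 * h22' ^ 2 - 21 * h31' ^ 2 - 12 * h22' - 1)) :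
    ∀ η : ℝ, 0 < η → ∃ c00 c02 c11 c20 h31 h22 h40 : ℝ,
      |c00 - c00'| < η ∧ |c02 - c02'| < η ∧ |c11 - c11'| < η ∧ |c20 - c20'| < η ∧
      |h31 - h31'| < η ∧ |h22 - h22'| < η ∧ |h40 - h40'| < η ∧
      ∀ p q : ℝ → ℝ → ℝ, IsOddCubic p → IsOddCubic q → HasDivergence p q c00 c02 c11 c20 →
        ∃ ε : ℝ, 0 < ε ∧ ε < η ∧
          5 ≤ (limitCyclesNear (normalField h31 h22 h40 p q ε) (0, 0) η).encard ∧
          5 ≤ (limitCyclesNear (symField h31 h22 h40 p q ε) (0, 1) η).encard ∧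
          5 ≤ (limitCyclesNear (symField h31 h22 h40 p q ε) (0, -1) η).encard ∧
          10 ≤ (limitCyclesNear (symField h31 h22 h40 p q ε) (0, 1) η ∪
            limitCyclesNear (symField h31 h22 h40 p q ε) (0, -1) η).encard := by
  intro η hη
  have hw : (s * √3) ^ 2 = 3 := by rcases hs with rfl | rfl <;> norm_num
  have hcoeffs := chart_coeffs_eq (w := s * √3) (by rw [hh22]; ring) hh40
  have hfreq := frequently_five_le_encard_limitCyclesNear hw hh31 hc11 hcoeffs
    (lt_min hη one_pos)
  rw [degenerateParam_eq hc00 hc20 hc02] at hfreq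
  obtain ⟨⟨l, n, c02, c20, c00⟩, hfive, h22, h40, hl, hn, hnear22, hnear40, hnear02, hnear20,
    hnear00⟩ :=
    (hfreq.and_eventually (eventually_exists_coeffs_near h22' h40' c02' c20' c00' hη)).exists
  refine ⟨c00, c02, c11', c20, h31', h22, h40, hnear00, hnear02, by simpa using hη, hnear20,
    by simpa using hη, hnear22, hnear40, fun p q hp hq hd => ?_⟩
  obtain ⟨ε, hε, hε0, hεη⟩ :=
    ((hfive h22 h40 p q hl hn hp hq hd).and (Ioo_mem_nhdsGT hη)).exists
  obtain ⟨hnormal, hpos, hneg, htotal⟩ := le_encard_limitCyclesNear_copies hp hq hε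
  have hten : (10 : ℕ∞) = 5 + 5 := by norm_num
  exact ⟨ε, hε0, hεη, hnormal, hpos, hneg, hten ▸ htotal⟩
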